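/- Let $0\le r\le\infty$. Let $\mathcal X$ be a compact smooth $n$-dimensional manifold with corners and $\pi:W\to\mathcal X$ a smooth real vector bundle of finite rank. Let $\tilde{\mathcal X}$ be a smooth $n$-dimensional manifold without boundary (Hausdorff and second countable, not necessarily compact) extending $\mathcal X$, i.e. $\mathcal X$ is smoothly embedded in $\tilde{\mathcal X}$, and let $\tilde\pi:\tilde W\to\tilde{\mathcal X}$ be a smooth vector bundle extending $\pi$, i.e. $\tilde W|_{\mathcal X}\cong W$ as smooth vector bundles over $\mathcal X$. Let $C^r(\pi)$ be the space of $C^r$ sections of $\pi$ with the $C^r$ topology (uniform convergence on compact subsets of bundle charts of all derivatives of order $\le r$ of the local representatives), and let $C^r_c(\tilde\pi)$ be the space of compactly supported $C^r$ sections of $\tilde\pi$ with the inductive limit topology (the finest locally convex topology for which, for every compact $K\subset\tilde{\mathcal X}$, the inclusion of the space of $C^r$ sections supported in $K$, with its $C^r$ topology, is continuous). A star denotes the space of continuous real linear functionals. The support of $\tilde T\in C^r_c(\tilde\pi)^*$ is the complement in $\tilde{\mathcal X}$ of the union of all open sets $U$ such that $\tilde T(\chi)=0$ for every $\chi\in C^r_c(\tilde\pi)$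 with $\operatorname{supp}\chi\subset U$. Then the restriction of sections $\rho_{\mathcal X}:C^r_c(\tilde\pi)\to C^r(\pi)$, $\tilde\chi\mapsto\tilde\chi|_{\mathcal X}$, is a well-defined continuous linear map, and its dual $$\rho_{\mathcal X}^*:C^r(\pi)^*\to C^r_c(\tilde\pi)^*,\qquad (\rho_{\mathcal X}^*T)(\tilde\chi)=T(\tilde\chi|_{\mathcal X}),$$ is injective, with image exactly $$\{\tilde T\in C^r_c(\tilde\pi)^*\mid \operatorname{supp}\tilde T\subset\mathcal X\}.$$ -/

import Mathlib

open Set Topology Manifold ContDiff Bundle TopologicalSpace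

noncomputable section

namespace SupportedFunctionals

section General

variable {E : Type*} [NormedAddCommGroup E] [NormedSpace ℝ E]
  {H : Type*} [TopologicalSpace H] (I : ModelWithCorners ℝ E H)
  {M : Type*} [TopologicalSpace M] [ChartedSpace H M]
  (F : Type*) [NormedAddCommGroup F] [NormedSpace ℝ F]
  (r : ℕ∞)
  (V : M → Type*) [TopologicalSpace (TotalSpace F V)]
  [∀ x, AddCommGroup (V x)] [∀ x, Module ℝ (V x)] [∀ x, TopologicalSpace (V x)]
  [FiberBundle F V]

/-- A vector bundle chart: a smooth chart `φ` of the base together with a local trivialization `e`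
of the bundle. -/
structure BundleChart where
  /-- the chart of the base manifold -/
  φ : OpenPartialHomeomorph M H
  smooth_φ : φ ∈ IsManifold.maximalAtlas I ∞ M
  /-- the local trivialization of the bundle -/
  e : Trivialization F (π F V)
  mem_e : MemTrivializationAtlas e

variable {I F V}

/-- The part of the model vector space over which local representatives of sections are defined. -/
def BundleChart.domain (c : BundleChart I F V) : Set E :=
  (c.φ.extend I).target ∩ (c.φ.extend I).symm ⁻¹' c.e.baseSet

/-- The local representative `E ⊇ c.domain → F` of a section. -/
def BundleChart.localRep (c : BundleChart I F V) (s : ∀ x, V x) (y : E) : F :=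
  (c.e ⟨(c.φ.extend I).symm y, s ((c.φ.extend I).symm y)⟩).2

theorem BundleChart.uniqueDiffOn_domain (c : BundleChart I F V) :
    UniqueDiffOn ℝ c.domain := by
  have h : c.domain = I.symm ⁻¹' (c.φ.target ∩ c.φ.symm ⁻¹' c.e.baseSet) ∩ range I := by
    ext y
    simp only [BundleChart.domain, OpenPartialHomeomorph.extend_target, mem_inter_iff,
      mem_preimage, OpenPartialHomeomorph.extend_coe_symm, Function.comp_apply]
    tauto
  rw [h]
  exact I.uniqueDiffOn_preimage (c.φ.isOpen_inter_preimage_symm c.e.open_baseSet)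

variable {r}

theorem BundleChart.contDiffOn_localRep [VectorBundle ℝ F V] [ContMDiffVectorBundle ∞ F V I]
    (c : BundleChart I F V) (s : Cₛ^(r : WithTop ℕ∞)⟮I; F, V⟯) :
    ContDiffOn ℝ r (c.localRep s) c.domain := by
  have hr : (r : WithTop ℕ∞) ≤ ∞ := by exact_mod_cast le_top
  have := c.mem_e
  have : ContMDiffVectorBundle (r : WithTop ℕ∞) F V I := ContMDiffVectorBundle.of_le hr
  have hφ : c.φ ∈ IsManifold.maximalAtlas I (r : WithTop ℕ∞) M :=
    IsManifold.maximalAtlas_subset_of_le hr c.smooth_φ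
  have h1 := (c.e.contMDiffOn_section_baseSet_iff (IB := I) (s := s)
    (n := (r : WithTop ℕ∞))).1 s.contMDiff.contMDiffOn
  have h2 := contMDiffOn_extend_symm (I := I) hφ
  rw [← contMDiffOn_iff_contDiffOn]
  refine h1.comp (h2.mono ?_) ?_
  · rintro y ⟨hy, -⟩
    rwa [c.φ.extend_target'] at hy
  · rintro y ⟨-, hy⟩
    exact hy

variable [VectorBundle ℝ F V] [ContMDiffVectorBundle ∞ F V I]

theorem BundleChart.bddAbove (c : BundleChart I F V) (s : Cₛ^(r : WithTop ℕ∞)⟮I; F, V⟯)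
    {K : Set E} (hK : IsCompact K) (hKc : K ⊆ c.domain) {k : ℕ} (hk : (k : ℕ∞) ≤ r) :
    BddAbove (range fun y : K => ‖iteratedFDerivWithin ℝ k (c.localRep s) c.domain y‖) := by
  have h := ((c.contDiffOn_localRep s).continuousOn_iteratedFDerivWithin (m := k)
    (by exact_mod_cast hk) c.uniqueDiffOn_domain).mono hKc
  have := (hK.image_of_continuousOn h.norm).bddAbove
  rwa [image_eq_range] at this

/-- The seminorm `sup_{y ∈ K} ‖D^k s_c (y)‖` of a `C^r` section `s` with local representative `s_c`
in the bundle chart `c`, where `K` is a compact subset of the domain of `s_c` and `k ≤ r`. -/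
def chartSeminorm (c : BundleChart I F V) {K : Set E} (hK : IsCompact K) (hKc : K ⊆ c.domain)
    {k : ℕ} (hk : (k : ℕ∞) ≤ r) : Seminorm ℝ Cₛ^(r : WithTop ℕ∞)⟮I; F, V⟯ :=
  Seminorm.of
    (fun s => ⨆ y : K, ‖iteratedFDerivWithin ℝ k (c.localRep s) c.domain y‖)
    (by
      intro s t
      refine Real.iSup_le (fun y => ?_)
        (add_nonneg (Real.iSup_nonneg fun _ => norm_nonneg _)
          (Real.iSup_nonneg fun _ => norm_nonneg _))
      have hs := ((c.contDiffOn_localRep s).of_le (m := k) (by exact_mod_cast hk)) y (hKc y.2)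
      have ht := ((c.contDiffOn_localRep t).of_le (m := k) (by exact_mod_cast hk)) y (hKc y.2)
      have := c.mem_e
      have hst : EqOn (c.localRep ⇑(s + t)) (c.localRep s + c.localRep t) c.domain := by
        intro z hz
        exact (c.e.linear ℝ hz.2).map_add _ _
      rw [iteratedFDerivWithin_congr hst (hKc y.2),
        iteratedFDerivWithin_add_apply hs ht c.uniqueDiffOn_domain (hKc y.2)]
      exact (norm_add_le _ _).trans
        (add_le_add (le_ciSup (c.bddAbove s hK hKc hk) y) (le_ciSup (c.bddAbove t hK hKc hk) y)))
    (by
      intro a s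
      rw [Real.mul_iSup_of_nonneg (norm_nonneg a)]
      refine iSup_congr fun y => ?_
      have hs := ((c.contDiffOn_localRep s).of_le (m := k) (by exact_mod_cast hk)) y (hKc y.2)
      have := c.mem_e
      have has : EqOn (c.localRep ⇑(a • s)) (a • c.localRep s) c.domain := by
        intro z hz
        exact (c.e.linear ℝ hz.2).map_smul _ _
      rw [iteratedFDerivWithin_congr has (hKc y.2),
        iteratedFDerivWithin_const_smul_apply hs c.uniqueDiffOn_domain (hKc y.2), norm_smul])

/-- The `C^r` topology on the space of `C^r` sections of a vector bundle: the coarsest vector space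
topology for which all the seminorms `chartSeminorm` are continuous, i.e. uniform convergence of
all derivatives of order at most `r` of the local representatives on compact sets. Over a compact
base and for finite `r` this is the Banachable topology of the `C^r` norm associated with any finite
family of bundle charts and compact subsets of their domains with interiors covering the base. -/
instance instTopologicalSpaceSection : TopologicalSpace Cₛ^(r : WithTop ℕ∞)⟮I; F, V⟯ :=
  ⨅ (c : BundleChart I F V) (K : Set E) (hK : IsCompact K) (hKc : K ⊆ c.domain)
    (k : ℕ) (hk : (k : ℕ∞) ≤ r),
    (chartSeminorm c hK hKc hk).toSeminormedAddCommGroup.toUniformSpace.toTopologicalSpace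

/-- The support of a section: the closure of the set where it does not vanish. -/
def sectionSupport (s : Cₛ^(r : WithTop ℕ∞)⟮I; F, V⟯) : Set M := closure {x | s x ≠ 0}

theorem sectionSupport_zero : sectionSupport (0 : Cₛ^(r : WithTop ℕ∞)⟮I; F, V⟯) = ∅ := by
  simp [sectionSupport]

theorem sectionSupport_add_subset (s t : Cₛ^(r : WithTop ℕ∞)⟮I; F, V⟯) :
    sectionSupport (s + t) ⊆ sectionSupport s ∪ sectionSupport t := by
  rw [sectionSupport, sectionSupport, sectionSupport, ← closure_union]
  refine closure_mono fun x hx => ?_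
  by_contra h
  simp only [mem_union, mem_ofPred_eq, not_or, not_not] at h
  exact hx (by simp [h.1, h.2])

theorem sectionSupport_smul_subset (a : ℝ) (s : Cₛ^(r : WithTop ℕ∞)⟮I; F, V⟯) :
    sectionSupport (a • s) ⊆ sectionSupport s := by
  refine closure_mono fun x hx h => hx ?_
  simp [h]

variable (I F r V)

/-- The space `C^r_{c,K}` of `C^r` sections with support in the compact set `K`, with the topology
of `C^r` sections. -/
def sectionsSupportedIn (K : Compacts M) : Submodule ℝ Cₛ^(r : WithTop ℕ∞)⟮I; F, V⟯ where
  carrier := {s | sectionSupport s ⊆ K}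
  zero_mem' := by simp [sectionSupport_zero]
  add_mem' hs ht := (sectionSupport_add_subset _ _).trans (union_subset hs ht)
  smul_mem' a _ hs := (sectionSupport_smul_subset a _).trans hs

/-- The linear subspace of compactly supported `C^r` sections. -/
def compactlySupportedSections : Submodule ℝ Cₛ^(r : WithTop ℕ∞)⟮I; F, V⟯ where
  carrier := {s | IsCompact (sectionSupport s)}
  zero_mem' := by simp [sectionSupport_zero]
  add_mem' hs ht := (hs.union ht).of_isClosed_subset isClosed_closure
    (sectionSupport_add_subset _ _)
  smul_mem' a _ hs := hs.of_isClosed_subset isClosed_closure (sectionSupport_smul_subset a _)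

/-- The space `C^r_c` of test sections, i.e. of compactly supported `C^r` sections. It does not
carry the subspace topology, but the inductive limit topology defined below. -/
def TestSection : Type _ := ↥(compactlySupportedSections I F r V)

instance : AddCommGroup (TestSection I F r V) :=
  inferInstanceAs (AddCommGroup ↥(compactlySupportedSections I F r V))

instance : Module ℝ (TestSection I F r V) :=
  inferInstanceAs (Module ℝ ↥(compactlySupportedSections I F r V))

variable {I F r V}

/-- The `C^r` section underlying a test section. -/
def TestSection.toSection (χ : TestSection I F r V) : Cₛ^(r : WithTop ℕ∞)⟮I; F, V⟯ := χ.1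

variable (I F r V)

/-- The inclusion of the sections supported in `K` into the space of all test sections. -/
def supportedInclusion (K : Compacts M) :
    ↥(sectionsSupportedIn I F r V K) → TestSection I F r V :=
  fun s => ⟨s.1, K.isCompact.of_isClosed_subset isClosed_closure s.2⟩

/-- The inductive limit topology on `C^r_c`: the finest locally convex vector space topology for
which the inclusions of all the spaces `C^r_{c,K}` are continuous. -/
instance instTopologicalSpaceTestSection : TopologicalSpace (TestSection I F r V) :=
  sInf {t : TopologicalSpace (TestSection I F r V) |
    @IsTopologicalAddGroup (TestSection I F r V) t _ ∧
    @ContinuousSMul ℝ (TestSection I F r V) _ _ t ∧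
    @LocallyConvexSpace ℝ (TestSection I F r V) _ _ _ _ t ∧
    ∀ K : Compacts M, @Continuous _ _ _ t (supportedInclusion I F r V K)}

variable {I F r V}

/-- The support of a functional on test sections: the complement of the union of all its open null
sets, where an open set `U` is null if the functional vanishes on all test sections with support
in `U`. -/
def functionalSupport (T : TestSection I F r V →L[ℝ] ℝ) : Set M :=
  (⋃₀ {U : Set M | IsOpen U ∧
    ∀ χ : TestSection I F r V, sectionSupport χ.toSection ⊆ U → T χ = 0})ᶜ

end General

end SupportedFunctionals

end

/-! Restriction is continuous by chart estimates, and a functional pulled back from `X` kills every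
test section supported off the closed set `range ι`. The content is injectivity, and the fact that
every functional supported in `X` is a pullback. Both are local: partitions of unity reduce them to
charts in which `ι` is the inclusion of a piece of the quadrant (`exists_adaptedCharts`). The basic
tool is the translation f ↦ f(· + εd) of local representatives, with d = (1, …, 1). As ε → 0 it
converges to f together with its derivatives of order at most N, and on sections supported in a
compact part of a chart a continuous functional only sees finitely many derivatives
(`exists_bound_of_continuous`).

Injectivity: if f is C^r on the quadrant, its translate is C^r on a neighbourhood of the quadrant
and can be cut off to the representative of a test section. Hence a functional vanishing on all
restrictions vanishes (`eq_zero_of_forall_restrictTestSection`).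

Image: let T be supported in `X`. If f vanishes on the quadrant, its translate vanishes near the
quadrant, so T kills the translate and, in the limit, f. Thus T vanishes on all test sections that
vanish on `X` (`apply_eq_zero_of_comp_eq_zero`) and factors algebraically through restriction.
Continuity of the factor requires |T χ| ≤ q(χ|X) for a continuous seminorm q. Derivatives of χ off
`X` are not controlled by χ|X, but χ may be replaced by any test section with the same restriction.
Seeley's extension from the quadrant (`exists_quadrant_extension`) supplies one whose derivatives
are bounded by those on the quadrant, order by order. Hahn–Banach
(`exists_continuousLinearMap_comp_eq`) then extends the factor from the range of restriction to all
sections over `X`; neither linearity of the extension nor surjectivity of restriction is needed. -/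

set_option linter.unusedSectionVars false

noncomputable section

namespace SupportedFunctionals

/-! ### Seeley's coefficients from an entire function with zeros at the powers of two -/

/-- The coefficients of the power series solution of `P (2 z) = (1 - 2 z) P z` with `P 0 = 1`. -/
def eulerCoeff : ℕ → ℝ
  | 0 => 1
  | j + 1 => -(2 / (2 ^ (j + 1) - 1)) * eulerCoeff j

theorem one_lt_two_pow_succ_real (j : ℕ) : (1 : ℝ) < 2 ^ (j + 1) :=
  one_lt_pow₀ one_lt_two j.succ_ne_zero

theorem eulerCoeff_ne_zero (j : ℕ) : eulerCoeff j ≠ 0 := by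
  induction j with
  | zero => simp [eulerCoeff]
  | succ j ih =>
    have := one_lt_two_pow_succ_real j
    exact mul_ne_zero (neg_ne_zero.2 (div_ne_zero two_ne_zero (by linarith))) ih

/-- The ratio of consecutive terms is 2|b| / (2^(j+1) - 1), which tends to 0: the power series P
with coefficients `eulerCoeff` is entire. -/
theorem summable_abs_eulerCoeff_mul_pow (b : ℝ) (hb : b ≠ 0) :
    Summable fun j => |eulerCoeff j| * |b| ^ j := by
  have hpos : ∀ j, 0 < |eulerCoeff j| * |b| ^ j := fun j =>
    mul_pos (abs_pos.2 (eulerCoeff_ne_zero j)) (pow_pos (abs_pos.2 hb) j)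
  refine summable_of_ratio_test_tendsto_lt_one (l := 0) one_pos
    (.of_forall fun j => (hpos j).ne') ?_
  have h : ∀ j : ℕ, ‖|eulerCoeff (j + 1)| * |b| ^ (j + 1)‖ / ‖|eulerCoeff j| * |b| ^ j‖
      = 2 * |b| / (2 ^ (j + 1) - 1) := by
    intro j
    have h1 := one_lt_two_pow_succ_real j
    have h2 : (2 : ℝ) ^ (j + 1) - 1 > 0 := by linarith
    rw [Real.norm_of_nonneg (hpos _).le, Real.norm_of_nonneg (hpos _).le,
      div_eq_iff (hpos j).ne', eulerCoeff, abs_mul, abs_neg, abs_div, abs_two, abs_of_pos h2]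
    ring
  simp_rw [h]
  refine Filter.Tendsto.const_div_atTop (r := 2 * |b|) ?_
  refine Filter.tendsto_atTop_add_const_right _ _ ?_
  exact (tendsto_pow_atTop_atTop_of_one_lt one_lt_two).comp (Filter.tendsto_add_atTop_nat 1)

theorem summable_eulerCoeff_mul_pow (b : ℝ) (hb : b ≠ 0) :
    Summable fun j => eulerCoeff j * b ^ j := by
  refine .of_norm ?_
  simpa [abs_mul, abs_pow] using summable_abs_eulerCoeff_mul_pow b hb

/-- Comparing coefficients of b^(j+1) in P(2b) - P(b) = -2b P(b) gives exactly the recursion that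
defines `eulerCoeff`. -/
theorem tsum_eulerCoeff_two_mul (b : ℝ) (hb : b ≠ 0) :
    ∑' j, eulerCoeff j * (2 * b) ^ j = (1 - 2 * b) * ∑' j, eulerCoeff j * b ^ j := by
  have h1 := summable_eulerCoeff_mul_pow (2 * b) (by simpa)
  have h2 := summable_eulerCoeff_mul_pow b hb
  have h3 : ∑' j, eulerCoeff j * (2 * b) ^ j - ∑' j, eulerCoeff j * b ^ j
      = ∑' j, eulerCoeff j * (2 ^ j - 1) * b ^ j := by
    rw [← h1.tsum_sub h2]
    exact tsum_congr fun j => by rw [mul_pow]; ring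
  have h4 : Summable fun j => eulerCoeff j * (2 ^ j - 1) * b ^ j :=
    (h1.sub h2).congr fun j => by rw [mul_pow]; ring
  rw [h4.tsum_eq_zero_add] at h3
  have h5 : ∑' j, eulerCoeff (j + 1) * (2 ^ (j + 1) - 1) * b ^ (j + 1)
      = -(2 * b) * ∑' j, eulerCoeff j * b ^ j := by
    rw [← tsum_mul_left]
    refine tsum_congr fun j => ?_
    have := one_lt_two_pow_succ_real j
    have h6 : (2 : ℝ) ^ (j + 1) - 1 ≠ 0 := by linarith
    rw [eulerCoeff]
    field_simp
    ring
  rw [h5] at h3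
  simp only [pow_zero, sub_self, mul_zero, zero_mul, zero_add] at h3
  linarith

/-- The factor 1 - 2z vanishes at z = 1/2, so P(1) = 0; the functional equation carries this zero on
to 2, 4, 8, …. -/
theorem tsum_eulerCoeff_two_pow (m : ℕ) : ∑' j, eulerCoeff j * ((2 : ℝ) ^ m) ^ j = 0 := by
  induction m with
  | zero => simpa using tsum_eulerCoeff_two_mul (1 / 2) (by norm_num)
  | succ m ih =>
    have := tsum_eulerCoeff_two_mul ((2 : ℝ) ^ m) (by positivity)
    rw [ih, mul_zero] at this
    rw [pow_succ']; exact this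

theorem abs_eulerCoeff_div_le (j : ℕ) (x : ℝ) :
    |eulerCoeff j / (2 ^ j + 1) * x| ≤ |eulerCoeff j| * |x| := by
  rw [abs_mul, abs_div]
  gcongr
  refine div_le_self (abs_nonneg _) ?_
  rw [abs_of_pos (by positivity)]
  linarith [pow_pos (two_pos : (0 : ℝ) < 2) j]

theorem summable_eulerCoeff_div_mul_pow (b : ℝ) (hb : b ≠ 0) :
    Summable fun j => eulerCoeff j / (2 ^ j + 1) * b ^ j := by
  refine .of_norm_bounded (summable_abs_eulerCoeff_mul_pow b hb) fun j => ?_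
  rw [← abs_pow]
  exact abs_eulerCoeff_div_le j _

/-- Dividing the coefficients by 2^j + 1 produces Q with Q(2z) + Q(z) = P(z). As P vanishes at the
powers of two, Q changes sign from each of them to the next. -/
theorem tsum_eulerCoeff_div_two_pow (m : ℕ) :
    ∑' j, eulerCoeff j / (2 ^ j + 1) * ((2 : ℝ) ^ m) ^ j
      = (-1) ^ m * ∑' j, eulerCoeff j / (2 ^ j + 1) := by
  induction m with
  | zero => simp
  | succ m ih =>
    have h1 := summable_eulerCoeff_div_mul_pow ((2 : ℝ) ^ m) (by positivity)
    have h2 := summable_eulerCoeff_div_mul_pow ((2 : ℝ) ^ (m + 1)) (by positivity)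
    have h3 := h2.tsum_add h1
    have h4 : ∀ j : ℕ, eulerCoeff j / (2 ^ j + 1) * ((2 : ℝ) ^ (m + 1)) ^ j
        + eulerCoeff j / (2 ^ j + 1) * ((2 : ℝ) ^ m) ^ j = eulerCoeff j * ((2 : ℝ) ^ m) ^ j := by
      intro j
      rw [pow_succ, mul_pow]
      field_simp
    simp_rw [h4, tsum_eulerCoeff_two_pow, ih] at h3
    rw [pow_succ (-1 : ℝ)]
    linarith

/-- 8/189 is the absolute value of the term of index 3; from there on consecutive terms shrink by at
least a factor 2. -/
theorem abs_eulerCoeff_add_three_le (j : ℕ) :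
    |eulerCoeff (j + 3) / (2 ^ (j + 3) + 1)| ≤ 8 / 189 * (1 / 2) ^ j := by
  induction j with
  | zero => norm_num [eulerCoeff, abs_div]
  | succ j ih =>
    have h0 : (8 : ℝ) ≤ 2 ^ (j + 3) := by
      rw [pow_add]; linarith [one_le_pow₀ (n := j) (one_le_two (α := ℝ))]
    have h1 : eulerCoeff (j + 1 + 3) / (2 ^ (j + 1 + 3) + 1)
        = (eulerCoeff (j + 3) / (2 ^ (j + 3) + 1)) *
          (-(2 / (2 ^ (j + 4) - 1)) * ((2 ^ (j + 3) + 1) / (2 ^ (j + 4) + 1))) := by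
      have : (2 : ℝ) ^ (j + 4) - 1 ≠ 0 := by rw [pow_succ]; linarith
      rw [show j + 1 + 3 = (j + 3) + 1 by ring, eulerCoeff]
      field_simp
    rw [h1, abs_mul, pow_succ (1 / 2 : ℝ), ← mul_assoc]
    refine mul_le_mul ih ?_ (abs_nonneg _) (by positivity)
    rw [pow_succ 2 (j + 3)]
    generalize (2 : ℝ) ^ (j + 3) = t at h0
    rw [abs_mul, abs_neg, abs_of_pos (by apply div_pos <;> linarith),
      abs_of_pos (by apply div_pos <;> linarith), ← mul_div_mul_comm,
      div_le_iff₀ (mul_pos (by linarith) (by linarith))]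
    nlinarith

/-- Q(1) has to be nonzero in order to be normalised to 1. Its first three terms add up to 1/10, and
the tail is at most 16/189 < 1/10. -/
theorem tsum_eulerCoeff_div_pos : 0 < ∑' j, eulerCoeff j / (2 ^ j + 1) := by
  have hs : Summable fun j => eulerCoeff j / (2 ^ j + 1) := by
    simpa using summable_eulerCoeff_div_mul_pow 1 one_ne_zero
  have hg : Summable fun j : ℕ => (8 / 189 : ℝ) * (1 / 2) ^ j := summable_geometric_two.mul_left _
  have h := tsum_of_norm_bounded (f := fun j => eulerCoeff (j + 3) / (2 ^ (j + 3) + 1)) hg.hasSum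
    abs_eulerCoeff_add_three_le
  rw [tsum_mul_left, tsum_geometric_two] at h
  have h1 := hs.sum_add_tsum_nat_add 3
  have h2 : ∑ j ∈ Finset.range 3, eulerCoeff j / (2 ^ j + 1) = 1 / 10 := by
    norm_num [Finset.sum_range_succ, eulerCoeff]
  rw [Real.norm_eq_abs, abs_le] at h
  linarith [h.1]

/-- Seeley's coefficients. -/
theorem exists_seeley_coeff : ∃ a : ℕ → ℝ, ∀ m : ℕ,
    Summable (fun j => |a j| * (2 ^ j) ^ m) ∧ HasSum (fun j => a j * (-2 ^ j) ^ m) 1 := by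
  set A := ∑' j, eulerCoeff j / (2 ^ j + 1) with hA
  have hA0 : A ≠ 0 := tsum_eulerCoeff_div_pos.ne'
  have hcomm : ∀ j m : ℕ, ((2 : ℝ) ^ j) ^ m = (2 ^ m) ^ j := fun j m => pow_right_comm _ _ _
  -- Since (-2^j)^m = (-1)^m (2^m)^j, the m-th moment is (-1)^m Q(2^m) / Q(1), and the two signs
  -- cancel.
  refine ⟨fun j => eulerCoeff j / (2 ^ j + 1) / A, fun m => ⟨?_, ?_⟩⟩
  · refine .of_norm_bounded
      ((summable_abs_eulerCoeff_mul_pow ((2 : ℝ) ^ m) (by positivity)).mul_right |A|⁻¹) fun j => ?_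
    have := abs_eulerCoeff_div_le j (((2 : ℝ) ^ m) ^ j)
    rw [abs_mul, abs_pow] at this
    rw [norm_mul, Real.norm_eq_abs, abs_abs, abs_div, hcomm, div_mul_eq_mul_div, div_eq_mul_inv,
      norm_pow, Real.norm_eq_abs]
    gcongr
  · have h := ((summable_eulerCoeff_div_mul_pow ((2 : ℝ) ^ m) (by positivity)).hasSum.mul_left
      ((-1) ^ m)).div_const A
    rw [tsum_eulerCoeff_div_two_pow, ← hA, ← mul_assoc, ← mul_pow] at h
    simp only [mul_neg, mul_one, neg_neg, one_pow, one_mul, div_self hA0] at h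
    have h' : ∀ j : ℕ, eulerCoeff j / (2 ^ j + 1) / A * (-2 ^ j) ^ m
        = (-1) ^ m * (eulerCoeff j / (2 ^ j + 1) * ((2 : ℝ) ^ m) ^ j) / A := by
      intro j
      rw [← hcomm, neg_pow ((2 : ℝ) ^ j)]
      ring
    simp_rw [h']
    exact h

/-! ### Seeley extension from a half-space and from the quadrant -/

section Extension

variable {E F : Type*} [NormedAddCommGroup E] [NormedSpace ℝ E]
  [NormedAddCommGroup F] [NormedSpace ℝ F] {r : ℕ∞}

/-- Two `C^r` functions whose derivatives agree on a hyperplane can be glued along it. -/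
theorem hasFTaylorSeriesUpTo_ite (l : E →L[ℝ] ℝ) {f g : E → F}
    (hf : ContDiff ℝ r f) (hg : ContDiff ℝ r g)
    (hfg : ∀ x, l x = 0 → ∀ k : ℕ, (k : ℕ∞) ≤ r → iteratedFDeriv ℝ k f x = iteratedFDeriv ℝ k g x) :
    HasFTaylorSeriesUpTo r (fun x => if 0 ≤ l x then f x else g x)
      (fun x k => if 0 ≤ l x then iteratedFDeriv ℝ k f x else iteratedFDeriv ℝ k g x) := by
  have hf' := contDiff_iff_ftaylorSeries.1 hf
  have hg' := contDiff_iff_ftaylorSeries.1 hg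
  have hB : ∀ k : ℕ, (k : ℕ∞) ≤ r → ∀ x, l x ≤ 0 →
      (if 0 ≤ l x then iteratedFDeriv ℝ k f x else iteratedFDeriv ℝ k g x)
        = iteratedFDeriv ℝ k g x := by
    intro k hk x hx
    split_ifs with h
    · exact hfg x (le_antisymm hx h) k hk
    · rfl
  refine ⟨fun x => ?_, fun m hm x => ?_, fun m hm => ?_⟩
  · split_ifs
    · exact hf'.zero_eq x
    · exact hg'.zero_eq x
  · have hm' : (m : ℕ∞) < r := by exact_mod_cast hm
    have hm1 : ((m + 1 : ℕ) : ℕ∞) ≤ r := by exact_mod_cast Order.add_one_le_of_lt hm'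
    have hA : IsClosed {x : E | 0 ≤ l x} := isClosed_le continuous_const l.continuous
    have hB' : IsClosed {x : E | l x ≤ 0} := isClosed_le l.continuous continuous_const
    have hU : {x : E | 0 ≤ l x} ∪ {x : E | l x ≤ 0} = univ :=
      eq_univ_of_forall fun x => le_total 0 (l x)
    rw [← hasFDerivWithinAt_univ, ← hU]
    -- The derivative is computed within each closed half-space. Off a half-space the condition is
    -- vacuous; on the hyperplane both candidates agree by `hfg`.
    refine HasFDerivWithinAt.union ?_ ?_
    · by_cases hx : 0 ≤ l x
      · have h := (hf'.fderiv m hm x).hasFDerivWithinAt (s := {x : E | 0 ≤ l x})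
        simp only [hx, if_true]
        exact h.congr (fun y hy => if_pos hy) (if_pos hx)
      · exact .of_notMem_closure (by rwa [hA.closure_eq])
    · by_cases hx : l x ≤ 0
      · have h := (hg'.fderiv m hm x).hasFDerivWithinAt (s := {x : E | l x ≤ 0})
        have hx' := hB (m + 1) hm1 x hx
        simp only [Nat.succ_eq_add_one, hx']
        exact h.congr (fun y hy => hB m hm'.le y hy) (hB m hm'.le x hx)
      · exact .of_notMem_closure (by rwa [hB'.closure_eq])
  · refine Continuous.if_le (hf'.cont m hm) (hg'.cont m hm) continuous_const l.continuous ?_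
    intro x hx
    exact hfg x hx.symm m (by exact_mod_cast hm)

/-- A `C^r` function with bounded derivatives. -/
def BoundedContDiff (r : ℕ∞) (f : E → F) : Prop :=
  ContDiff ℝ r f ∧ ∀ k : ℕ, (k : ℕ∞) ≤ r → ∃ C, ∀ x, ‖iteratedFDeriv ℝ k f x‖ ≤ C

theorem BoundedContDiff.of_hasCompactSupport {f : E → F} (hf : ContDiff ℝ r f)
    (hc : HasCompactSupport f) : BoundedContDiff r f :=
  ⟨hf, fun k hk => (hf.continuous_iteratedFDeriv (m := k)
    (by exact_mod_cast hk)).bounded_above_of_compact_support (hc.iteratedFDeriv k)⟩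

/-- The continuous linear map scaling by `c` in the direction of `e`. -/
def scaleAlong (l : E →L[ℝ] ℝ) (e : E) (c : ℝ) : E →L[ℝ] E :=
  ContinuousLinearMap.id ℝ E + (c - 1) • l.smulRight e

theorem scaleAlong_apply (l : E →L[ℝ] ℝ) (e : E) (c : ℝ) (x : E) :
    scaleAlong l e c x = (x - l x • e) + c • (l x • e) := by
  have : scaleAlong l e c x = x + (c - 1) • (l x • e) := rfl
  rw [this]
  module

theorem norm_scaleAlong_le (l : E →L[ℝ] ℝ) (e : E) (j : ℕ) :
    ‖scaleAlong l e (-2 ^ j)‖ ≤ (1 + 2 * (‖l‖ * ‖e‖)) * 2 ^ j := by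
  have h1 : (1 : ℝ) ≤ 2 ^ j := one_le_pow₀ one_le_two
  have h2 : ‖(-2 ^ j - 1 : ℝ)‖ = 2 ^ j + 1 := by
    rw [Real.norm_eq_abs, abs_of_neg (by linarith)]; ring
  have h3 : 0 ≤ ‖l‖ * ‖e‖ := by positivity
  calc ‖scaleAlong l e (-2 ^ j)‖ ≤ 1 + (2 ^ j + 1) * (‖l‖ * ‖e‖) := by
        refine (norm_add_le _ _).trans (add_le_add ContinuousLinearMap.norm_id_le ?_)
        rw [norm_smul, h2, ContinuousLinearMap.norm_smulRight_apply]
    _ ≤ _ := by nlinarith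

/-- Splitting each `v i` into its part along `e` and the remainder turns q(R_j v) into a polynomial
in -2^j. All moments of `a` equal 1, so the sum over j evaluates this polynomial at 1. This is the
matching of derivatives on the hyperplane. -/
theorem hasSum_seeley_multilinear {k : ℕ} {a : ℕ → ℝ}
    (ha : ∀ m : ℕ, HasSum (fun j => a j * (-2 ^ j) ^ m) 1)
    (q : ContinuousMultilinearMap ℝ (fun _ : Fin k => E) F) (l : E →L[ℝ] ℝ) (e : E)
    (v : Fin k → E) :
    HasSum (fun j => a j • q (fun i => scaleAlong l e (-2 ^ j) (v i))) (q v) := by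
  set u : Fin k → E := fun i => l (v i) • e
  set w : Fin k → E := fun i => v i - l (v i) • e
  have h1 : ∀ c : ℝ, q (fun i => scaleAlong l e c (v i))
      = ∑ s : Finset (Fin k), c ^ s.card • q (s.piecewise u w) := by
    intro c
    have h2 : (fun i => scaleAlong l e c (v i)) = (fun i => c • u i) + w := by
      ext i
      rw [scaleAlong_apply, add_comm]
      rfl
    rw [h2]
    refine (q.toMultilinearMap.map_add_univ _ _).trans (Finset.sum_congr rfl fun s _ => ?_)
    have h3 : s.piecewise (fun i => c • u i) w
        = s.piecewise (fun i => c • s.piecewise u w i) (s.piecewise u w) := by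
      ext i
      by_cases hi : i ∈ s <;> simp [hi]
    rw [h3]
    refine (q.toMultilinearMap.map_piecewise_smul (fun _ => c) _ s).trans ?_
    simp
  have h4 : q v = ∑ s : Finset (Fin k), (1 : ℝ) • q (s.piecewise u w) := by
    have := h1 1
    simpa [scaleAlong] using this
  rw [h4]
  simp_rw [h1, Finset.smul_sum, smul_smul]
  exact hasSum_sum fun s _ => (ha s.card).smul_const _

/-- Seeley's extension across a hyperplane. -/
theorem exists_seeley_extension_step [CompleteSpace F] (l : E →L[ℝ] ℝ) (e : E) (he : l e = 1) :
    ∃ C : ℕ → ℝ, ∀ f : E → F, BoundedContDiff r f → ∃ g : E → F, BoundedContDiff r g ∧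
      (∀ x, 0 ≤ l x → g x = f x) ∧ ∀ k : ℕ, (k : ℕ∞) ≤ r → ∀ x (b : ℝ),
        (∀ t : ℝ, 0 ≤ l (x + t • e) → ‖iteratedFDeriv ℝ k f (x + t • e)‖ ≤ b) →
          ‖iteratedFDeriv ℝ k g x‖ ≤ C k * b := by
  obtain ⟨a, ha⟩ := exists_seeley_coeff
  set R : ℕ → E →L[ℝ] E := fun j => scaleAlong l e (-2 ^ j)
  set A : ℝ := 1 + 2 * (‖l‖ * ‖e‖)
  set D : ℕ → ℕ → ℝ := fun k j => |a j| * (A * 2 ^ j) ^ k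
  have hA : 1 ≤ A := by simp only [A]; linarith [mul_nonneg (norm_nonneg l) (norm_nonneg e)]
  have hD : ∀ k, Summable (D k) := fun k => by
    refine ((ha k).1.mul_left (A ^ k)).congr fun j => ?_
    simp only [D, mul_pow]; ring
  have hD0 : ∀ k j, 0 ≤ D k j := fun k j => by positivity
  -- The 1 serves the half-space where the extension is `f` itself, the series the other side. The
  -- constant does not depend on `f`.
  refine ⟨fun k => max 1 (∑' j, D k j), fun f hf => ?_⟩
  have hterm : ∀ j, ContDiff ℝ r fun x => a j • f (R j x) :=
    fun j => (hf.1.comp (R j).contDiff).const_smul (a j)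
  have hderiv : ∀ k : ℕ, (k : ℕ∞) ≤ r → ∀ j x, iteratedFDeriv ℝ k (fun x => a j • f (R j x)) x
      = a j • (iteratedFDeriv ℝ k f (R j x)).compContinuousLinearMap fun _ => R j := by
    intro k hk j x
    have hk' : (k : WithTop ℕ∞) ≤ r := by exact_mod_cast hk
    rw [← (R j).iteratedFDeriv_comp_right hf.1 x hk']
    exact iteratedFDeriv_const_smul_apply
      ((hf.1.comp (R j).contDiff).of_le hk').contDiffAt
  have hnorm : ∀ k : ℕ, (k : ℕ∞) ≤ r → ∀ j x b, ‖iteratedFDeriv ℝ k f (R j x)‖ ≤ b →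
      ‖iteratedFDeriv ℝ k (fun x => a j • f (R j x)) x‖ ≤ D k j * b := by
    intro k hk j x b hb
    have hb0 : 0 ≤ b := (norm_nonneg _).trans hb
    rw [hderiv k hk, norm_smul]
    have h1 := ContinuousMultilinearMap.norm_compContinuousLinearMap_le
      (iteratedFDeriv ℝ k f (R j x)) (fun _ => R j)
    rw [Finset.prod_const, Finset.card_univ, Fintype.card_fin] at h1
    have h2 : ‖R j‖ ^ k ≤ (A * 2 ^ j) ^ k := by
      gcongr
      exact norm_scaleAlong_le l e j
    calc ‖a j‖ * _ ≤ |a j| * (b * (A * 2 ^ j) ^ k) := by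
          refine mul_le_mul_of_nonneg_left (h1.trans ?_) (abs_nonneg _)
          gcongr
      _ = D k j * b := by simp only [D]; ring
  choose! B hB using hf.2
  have hv : ∀ k : ℕ, (k : ℕ∞) ≤ r → Summable fun j => D k j * B k :=
    fun k _ => (hD k).mul_right _
  have hv' : ∀ (k : ℕ) (j : ℕ) (x : E), (k : ℕ∞) ≤ r →
      ‖iteratedFDeriv ℝ k (fun x => a j • f (R j x)) x‖ ≤ D k j * B k :=
    fun k j x hk => hnorm k hk j x _ (hB k hk _)
  set g₀ : E → F := fun x => ∑' j, a j • f (R j x)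
  have hg₀ : ContDiff ℝ r g₀ := contDiff_tsum hterm hv hv'
  have hg₀' : ∀ k : ℕ, (k : ℕ∞) ≤ r → ∀ x, iteratedFDeriv ℝ k g₀ x
      = ∑' j, iteratedFDeriv ℝ k (fun x => a j • f (R j x)) x :=
    fun k hk x => iteratedFDeriv_tsum_apply hterm hv hv' hk x
  have hglue := hasFTaylorSeriesUpTo_ite l hf.1 hg₀ (fun x hx k hk => by
    rw [hg₀' k hk x]
    have hs : Summable fun j => iteratedFDeriv ℝ k (fun x => a j • f (R j x)) x :=
      .of_norm_bounded (hv k hk) fun j => hv' k j x hk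
    ext v
    rw [ContinuousMultilinearMap.tsum_eval hs]
    refine (HasSum.tsum_eq ?_).symm
    have hRx : ∀ j, R j x = x := fun j => by simp [R, scaleAlong_apply, hx]
    simp_rw [hderiv k hk, hRx]
    exact hasSum_seeley_multilinear (fun m => (ha m).2) (iteratedFDeriv ℝ k f x) l e v)
  have hgd : ∀ k : ℕ, (k : ℕ∞) ≤ r → ∀ x (b : ℝ),
      (∀ t : ℝ, 0 ≤ l (x + t • e) → ‖iteratedFDeriv ℝ k f (x + t • e)‖ ≤ b) →
      ‖iteratedFDeriv ℝ k (fun x => if 0 ≤ l x then f x else g₀ x) x‖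
        ≤ max 1 (∑' j, D k j) * b := by
    intro k hk x b hb
    -- The choice t = -l x reaches the hyperplane, so the hypothesis on b is never vacuous.
    have hb0 : 0 ≤ b := by
      refine (norm_nonneg _).trans (hb (-l x) ?_)
      simp [he]
    rw [← hglue.eq_iteratedFDeriv (by exact_mod_cast hk)]
    split_ifs with hx
    · have := hb 0 (by simpa using hx)
      rw [zero_smul, add_zero] at this
      exact this.trans (le_mul_of_one_le_left hb0 (le_max_left _ _))
    · rw [hg₀' k hk]
      refine (tsum_of_norm_bounded ((hD k).mul_right b).hasSum fun j => ?_).trans ?_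
      · refine hnorm k hk j x b ?_
        -- The points R_j x stay on the line through x in direction e and, as l x < 0, lie in the
        -- half-space. So the bound only uses `f` on the half of this line.
        have h1 : R j x = x + ((-2 ^ j - 1) * l x) • e := by
          simp only [R, scaleAlong_apply]; module
        rw [h1]
        refine hb _ ?_
        have h2 : (0 : ℝ) < 2 ^ j := by positivity
        simp only [map_add, map_smul, he, smul_eq_mul]
        nlinarith
      · rw [tsum_mul_right]
        gcongr
        exact le_max_right _ _
  refine ⟨fun x => if 0 ≤ l x then f x else g₀ x, ⟨hglue.contDiff, fun k hk => ?_⟩,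
    fun x hx => if_pos hx, hgd⟩
  exact ⟨_, fun x => hgd k hk x (B k) fun t _ => hB k hk _⟩

/-- One reflection per coordinate. The bound at x only involves points with the same coordinates
outside `A`; this is what lets the steps compose, since extending in one coordinate preserves the
signs already arranged in the others. -/
theorem exists_partial_quadrant_extension [CompleteSpace F] {n : ℕ} (A : Finset (Fin n)) :
    ∃ C : ℕ → ℝ, ∀ f : EuclideanSpace ℝ (Fin n) → F, BoundedContDiff r f →
      ∃ g : EuclideanSpace ℝ (Fin n) → F, BoundedContDiff r g ∧
      (∀ x, (∀ i ∈ A, 0 ≤ x i) → g x = f x) ∧ ∀ k : ℕ, (k : ℕ∞) ≤ r → ∀ x (b : ℝ),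
        (∀ y, (∀ i ∈ A, 0 ≤ y i) → (∀ i ∉ A, y i = x i) → ‖iteratedFDeriv ℝ k f y‖ ≤ b) →
          ‖iteratedFDeriv ℝ k g x‖ ≤ C k * b := by
  induction A using Finset.induction_on with
  | empty =>
    refine ⟨fun _ => 1, fun f hf => ⟨f, hf, fun _ _ => rfl, fun k _ x b hb => ?_⟩⟩
    rw [one_mul]
    exact hb x (by simp) (by simp)
  | insert i A hi ih =>
    obtain ⟨C, hC⟩ := ih
    obtain ⟨C', hC'⟩ := exists_seeley_extension_step (F := F) (r := r)
      (EuclideanSpace.proj i : EuclideanSpace ℝ (Fin n) →L[ℝ] ℝ) (EuclideanSpace.single i 1)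
      (by simp)
    refine ⟨fun k => C k * C' k, fun f hf => ?_⟩
    obtain ⟨f₁, hf₁, hf₁f, hb₁⟩ := hC' f hf
    obtain ⟨g, hg, hgf₁, hb⟩ := hC f₁ hf₁
    refine ⟨g, hg, fun x hx => ?_, fun k hk x b hfb => ?_⟩
    · rw [hgf₁ x fun j hj => hx j (Finset.mem_insert_of_mem hj)]
      exact hf₁f x (hx i (Finset.mem_insert_self i A))
    · rw [mul_assoc]
      refine hb k hk x _ fun y hyA hyx => hb₁ k hk y b fun t ht => hfb _ ?_ ?_
      · intro j hj
        obtain rfl | hj := Finset.mem_insert.1 hj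
        · simpa using ht
        · have hji : j ≠ i := fun h => hi (h ▸ hj)
          simpa [hji] using hyA j hj
      · intro j hj
        rw [Finset.mem_insert, not_or] at hj
        simpa [hj.1] using hyx j hj.2

/-- The closed quadrant. -/
def quadrant (n : ℕ) : Set (EuclideanSpace ℝ (Fin n)) := {x | ∀ i, 0 ≤ x i}

/-- Seeley's extension theorem for the quadrant. -/
theorem exists_quadrant_extension [CompleteSpace F] (n : ℕ) :
    ∃ C : ℕ → ℝ, ∀ f : EuclideanSpace ℝ (Fin n) → F, BoundedContDiff r f →
      ∃ g : EuclideanSpace ℝ (Fin n) → F, BoundedContDiff r g ∧ EqOn g f (quadrant n) ∧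
      ∀ k : ℕ, (k : ℕ∞) ≤ r → ∀ b : ℝ, (∀ y ∈ quadrant n, ‖iteratedFDeriv ℝ k f y‖ ≤ b) →
        ∀ x, ‖iteratedFDeriv ℝ k g x‖ ≤ C k * b := by
  obtain ⟨C, hC⟩ := exists_partial_quadrant_extension (F := F) (r := r)
    (Finset.univ : Finset (Fin n))
  refine ⟨C, fun f hf => ?_⟩
  obtain ⟨g, hg, hgf, hb⟩ := hC f hf
  exact ⟨g, hg, fun x hx => hgf x fun i _ => hx i, fun k hk b h x =>
    hb k hk x b fun y hy _ => h y fun i => hy i (Finset.mem_univ i)⟩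

end Extension

/-! ### Uniform derivative estimates and convergence of translates -/

section Estimates

variable {E E' F F' : Type*} [NormedAddCommGroup E] [NormedSpace ℝ E]
  [NormedAddCommGroup E'] [NormedSpace ℝ E'] [NormedAddCommGroup F] [NormedSpace ℝ F]
  [NormedAddCommGroup F'] [NormedSpace ℝ F']

theorem exists_bound_iteratedFDerivWithin {s : Set E} (hs : UniqueDiffOn ℝ s) {f : E → F}
    (hf : ContDiffOn ℝ ∞ f s) {K : Set E} (hK : IsCompact K) (hKs : K ⊆ s) :
    ∃ C : ℕ → ℝ, ∀ k, 0 ≤ C k ∧ ∀ y ∈ K, ‖iteratedFDerivWithin ℝ k f s y‖ ≤ C k := by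
  have h : ∀ k : ℕ, ∃ C, 0 ≤ C ∧ ∀ y ∈ K, ‖iteratedFDerivWithin ℝ k f s y‖ ≤ C := by
    intro k
    obtain ⟨C, hC⟩ := hK.exists_bound_of_continuousOn
      ((hf.continuousOn_iteratedFDerivWithin (m := k) (by exact_mod_cast le_top) hs).mono hKs)
    exact ⟨max 0 C, le_max_left _ _, fun y hy => (hC y hy).trans (le_max_right _ _)⟩
  choose C hC using h
  exact ⟨C, hC⟩

/-- The derivatives of `y ↦ B y (g (τ y))` are bounded by those of `g`, uniformly in `g`. -/
theorem exists_bound_iteratedFDerivWithin_clm_comp {s : Set E} {t : Set E'}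
    (hs : UniqueDiffOn ℝ s) (ht : UniqueDiffOn ℝ t) {τ : E → E'} (hτ : ContDiffOn ℝ ∞ τ s)
    (hst : MapsTo τ s t) {B : E → F' →L[ℝ] F} (hB : ContDiffOn ℝ ∞ B s) {K : Set E}
    (hK : IsCompact K) (hKs : K ⊆ s) (k : ℕ) :
    ∃ C, 0 ≤ C ∧ ∀ g : E' → F', ContDiffOn ℝ k g t → ∀ y ∈ K,
      ‖iteratedFDerivWithin ℝ k (fun y => B y (g (τ y))) s y‖
        ≤ C * ∑ m ∈ Finset.range (k + 1), ‖iteratedFDerivWithin ℝ m g t (τ y)‖ := by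
  obtain ⟨b, hb⟩ := exists_bound_iteratedFDerivWithin hs hB hK hKs
  obtain ⟨d, hd⟩ := exists_bound_iteratedFDerivWithin hs hτ hK hKs
  -- The composition estimate wants the m-th derivative of `τ` bounded by D^m; with D ≥ 1 a common
  -- bound D suffices for all m ≥ 1.
  set D : ℝ := 1 + ∑ i ∈ Finset.range (k + 1), d i
  have hD1 : 1 ≤ D := by
    simp only [D]; linarith [Finset.sum_nonneg fun i (_ : i ∈ Finset.range (k + 1)) => (hd i).1]
  have hdD : ∀ i ≤ k, d i ≤ D := fun i hi => by
    have := Finset.single_le_sum (fun i _ => (hd i).1) (Finset.mem_range_succ_iff.2 hi)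
    simp only [D]; linarith
  refine ⟨∑ i ∈ Finset.range (k + 1), (k.choose i * b i * ((k - i).factorial * D ^ (k - i))),
    Finset.sum_nonneg fun i _ => ?_, fun g hg y hy => ?_⟩
  · have := (hb i).1
    positivity
  set S : ℝ := ∑ m ∈ Finset.range (k + 1), ‖iteratedFDerivWithin ℝ m g t (τ y)‖
  have hS0 : 0 ≤ S := Finset.sum_nonneg fun _ _ => norm_nonneg _
  have hcomp : ∀ i ≤ k, ‖iteratedFDerivWithin ℝ i (g ∘ τ) s y‖ ≤ i.factorial * S * D ^ i := by
    intro i hi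
    refine norm_iteratedFDerivWithin_comp_le (N := i)
      (hg.of_le (by exact_mod_cast hi)) (hτ.of_le (by exact_mod_cast le_top)) le_rfl ht hs hst
      (hKs hy) (fun m hm => ?_) (fun m hm1 hm => ?_)
    · exact Finset.single_le_sum (f := fun m => ‖iteratedFDerivWithin ℝ m g t (τ y)‖)
        (fun _ _ => norm_nonneg _) (Finset.mem_range_succ_iff.2 (hm.trans hi))
    · refine ((hd m).2 y hy).trans ((hdD m (hm.trans hi)).trans ?_)
      exact le_self_pow₀ hD1 (by omega)
  have h := (ContinuousLinearMap.id ℝ (F' →L[ℝ] F)).norm_iteratedFDerivWithin_le_of_bilinear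
    (N := k) (hB.of_le (by exact_mod_cast le_top))
    (hg.comp (hτ.of_le (by exact_mod_cast le_top)) hst) hs (hKs hy) le_rfl
  refine h.trans ((mul_le_of_le_one_left (Finset.sum_nonneg fun i _ => by positivity)
    ContinuousLinearMap.norm_id_le).trans ?_)
  rw [Finset.sum_mul]
  refine Finset.sum_le_sum fun i _ => ?_
  calc _ ≤ k.choose i * b i * ((k - i).factorial * S * D ^ (k - i)) := by
        have := (hb i).1
        gcongr
        · exact (hb i).2 y hy
        · exact hcomp _ (Nat.sub_le _ _)
    _ = _ := by ring

theorem iteratedFDerivWithin_eq_zero_of_eqOn_diff {S K : Set E} (hK : IsClosed K) {f : E → F}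
    (hf : ∀ x ∈ S, x ∉ K → f x = 0) (k : ℕ) {x : E} (hx : x ∈ S) (hxK : x ∉ K) :
    iteratedFDerivWithin ℝ k f S x = 0 := by
  have h : f =ᶠ[𝓝[S] x] fun _ => 0 := by
    filter_upwards [self_mem_nhdsWithin, mem_nhdsWithin_of_mem_nhds (hK.isOpen_compl.mem_nhds hxK)]
      with y hy hyK using hf y hy hyK
  rw [h.iteratedFDerivWithin_eq (hf x hx hxK)]
  simp

open Pointwise in
/-- Translations are strongly continuous on compactly supported `C^k` functions. -/
theorem eventually_norm_iteratedFDerivWithin_translate_sub_le [ProperSpace E] {S : Set E}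
    (hSc : IsClosed S) (hS : UniqueDiffOn ℝ S) (v : E)
    (hv : ∀ ε : ℝ, 0 ≤ ε → ∀ x ∈ S, x + ε • v ∈ S) {k : ℕ} {f : E → F} (hf : ContDiffOn ℝ k f S)
    {K : Set E} (hK : IsCompact K) (hfK : ∀ x ∈ S, x ∉ K → f x = 0) {δ : ℝ} (hδ : 0 < δ) :
    ∀ᶠ ε : ℝ in 𝓝[>] 0, ∀ x ∈ S,
      ‖iteratedFDerivWithin ℝ k (fun z => f z - f (z + ε • v)) S x‖ ≤ δ := by
  set G := iteratedFDerivWithin ℝ k f S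
  have hGK : ∀ x ∈ S, x ∉ K → G x = 0 := fun x hx hxK =>
    iteratedFDerivWithin_eq_zero_of_eqOn_diff hK.isClosed hfK k hx hxK
  -- For ε ≤ 1, if one of x and x + ε • v is in `K`, both are in this compact set, where `G` is
  -- uniformly continuous; otherwise both derivatives vanish.
  have hK' : IsCompact (S ∩ Metric.cthickening ‖v‖ K) := hK.cthickening.inter_left hSc
  have hG : ContinuousOn G (S ∩ Metric.cthickening ‖v‖ K) :=
    (hf.continuousOn_iteratedFDerivWithin le_rfl hS).mono inter_subset_left
  obtain ⟨δ', hδ', hδG⟩ := Metric.uniformContinuousOn_iff_le.1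
    (hK'.uniformContinuousOn_of_continuous hG) δ hδ
  have h1 : ∀ᶠ ε : ℝ in 𝓝[>] 0, ‖ε • v‖ ≤ δ' ∧ ε ≤ 1 := by
    have h2 : Filter.Tendsto (fun ε : ℝ => ‖ε • v‖) (𝓝 0) (𝓝 0) := by
      have : Continuous fun ε : ℝ => ‖ε • v‖ := by fun_prop
      simpa using this.tendsto 0
    exact ((h2.eventually (ge_mem_nhds hδ')).and (ge_mem_nhds one_pos)).filter_mono
      nhdsWithin_le_nhds
  filter_upwards [h1, self_mem_nhdsWithin] with ε ⟨hε, hε1⟩ hε0 x hx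
  have hε0' : 0 ≤ ε := le_of_lt hε0
  have hsub : (ε • v) +ᵥ S ⊆ S := by
    rintro _ ⟨y, hy, rfl⟩
    have := hv ε hε0' y hy
    rwa [add_comm] at this
  have hu : UniqueDiffOn ℝ ((ε • v) +ᵥ S) := by
    exact hS.image (f' := fun _ => ContinuousLinearMap.id ℝ E)
      (fun y _ => (hasFDerivWithinAt_id y S).const_add (ε • v)) fun y _ => Function.surjective_id.denseRange
  -- Translation gives the derivative within the translated set, which is contained in `S` by `hv`
  -- and has unique derivatives, so it agrees with the derivative within `S`.
  have h3 : iteratedFDerivWithin ℝ k (fun z => f (z + ε • v)) S x = G (x + ε • v) := by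
    rw [iteratedFDerivWithin_comp_add_right]
    refine iteratedFDerivWithin_subset hsub hu hS hf ⟨x, hx, ?_⟩
    simp [add_comm]
  have h4 : ContDiffOn ℝ k (fun z => f (z + ε • v)) S :=
    hf.comp (contDiff_id.add contDiff_const).contDiffOn fun z hz => hv ε hε0' z hz
  rw [show (fun z => f z - f (z + ε • v)) = f - fun z => f (z + ε • v) from rfl,
    iteratedFDerivWithin_sub_apply (hf x hx) (h4 x hx) hS hx, h3, ← dist_eq_norm]
  have hxv := hv ε hε0' x hx
  have hdist : dist x (x + ε • v) ≤ ‖v‖ := by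
    rw [dist_self_add_right, norm_smul, Real.norm_of_nonneg hε0']
    exact mul_le_of_le_one_left (norm_nonneg v) hε1
  by_cases h : x ∈ K ∨ x + ε • v ∈ K
  · refine hδG x ⟨hx, ?_⟩ _ ⟨hxv, ?_⟩ (by rwa [dist_self_add_right])
    · rcases h with h | h
      · exact Metric.self_subset_cthickening K h
      · exact Metric.mem_cthickening_of_dist_le _ _ _ _ h hdist
    · rcases h with h | h
      · exact Metric.mem_cthickening_of_dist_le _ _ _ _ h (by rwa [dist_comm])
      · exact Metric.self_subset_cthickening K h
  · rw [not_or] at h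
    rw [show iteratedFDerivWithin ℝ k f S x = 0 from hGK x hx h.1, hGK _ hxv h.2, dist_self]
    exact hδ.le

end Estimates

/-! ### Translation on the closed quadrant -/

section Quadrant

variable {F : Type*} [NormedAddCommGroup F] [NormedSpace ℝ F] {n : ℕ} {r : ℕ∞}

theorem range_quadrantModel : range (modelWithCornersEuclideanQuadrant n) = quadrant n :=
  range_euclideanQuadrant n

theorem uniqueDiffOn_quadrant : UniqueDiffOn ℝ (quadrant n) :=
  range_quadrantModel (n := n) ▸ (modelWithCornersEuclideanQuadrant n).uniqueDiffOn

theorem isClosed_quadrant : IsClosed (quadrant n) :=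
  range_quadrantModel (n := n) ▸ (modelWithCornersEuclideanQuadrant n).isClosed_range

theorem interior_quadrant : interior (quadrant n) = {x | ∀ i, 0 < x i} :=
  interior_euclideanQuadrant n 2 0

/-- The diagonal vector, pointing into the quadrant. -/
def diagVec (n : ℕ) : EuclideanSpace ℝ (Fin n) := WithLp.toLp 2 fun _ => 1

@[simp]
theorem add_smul_diagVec_apply (x : EuclideanSpace ℝ (Fin n)) (ε : ℝ) (i : Fin n) :
    (x + ε • diagVec n) i = x i + ε := by
  simp [diagVec]

theorem add_smul_diagVec_mem_quadrant {ε : ℝ} (hε : 0 ≤ ε) {x : EuclideanSpace ℝ (Fin n)}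
    (hx : x ∈ quadrant n) : x + ε • diagVec n ∈ quadrant n := fun i => by
  rw [add_smul_diagVec_apply]
  exact add_nonneg (hx i) hε

/-- A translate of a `C^r` function on the quadrant extends to a `C^r` function. -/
theorem exists_contDiff_eqOn_translate {f : EuclideanSpace ℝ (Fin n) → F}
    (hf : ContDiffOn ℝ r f (quadrant n)) {ε : ℝ} (hε : 0 < ε) :
    ∃ g : EuclideanSpace ℝ (Fin n) → F, ContDiff ℝ r g ∧
      (∀ x ∈ quadrant n, g x = f (x + ε • diagVec n)) ∧
      ∀ x, g x ≠ 0 → x + ε • diagVec n ∈ quadrant n ∧ f (x + ε • diagVec n) ≠ 0 := by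
  -- The translate of `f` is C^r where all x_i > -ε. The cutoff is 1 where all x_i ≥ 0 and already
  -- vanishes once some x_i ≤ -ε/2, which leaves room for gluing with zero.
  set η : EuclideanSpace ℝ (Fin n) → ℝ := fun x => ∏ i, Real.smoothTransition (1 + 2 * x i / ε)
  have hη : ContDiff ℝ r η := by
    refine contDiff_prod fun i _ => Real.smoothTransition.contDiff.comp ?_
    have : ContDiff ℝ r fun x : EuclideanSpace ℝ (Fin n) => x i :=
      (EuclideanSpace.proj i : EuclideanSpace ℝ (Fin n) →L[ℝ] ℝ).contDiff
    exact contDiff_const.add ((contDiff_const.mul this).div_const ε)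
  have hη0 : ∀ x i, x i ≤ -(ε / 2) → η x = 0 := fun x i hx => by
    refine Finset.prod_eq_zero (Finset.mem_univ i) (Real.smoothTransition.zero_of_nonpos ?_)
    have : 2 * x i / ε ≤ -1 := by rw [div_le_iff₀ hε]; linarith
    linarith
  have hη1 : ∀ x ∈ quadrant n, η x = 1 := fun x hx =>
    Finset.prod_eq_one fun i _ => Real.smoothTransition.one_of_one_le
      (le_add_of_nonneg_right (div_nonneg (mul_nonneg two_pos.le (hx i)) hε.le))
  refine ⟨fun x => η x • f (x + ε • diagVec n), contDiff_iff_contDiffAt.2 fun x => ?_,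
    fun x hx => by simp [hη1 x hx], fun x hx => ⟨fun i => ?_, fun h => hx (by simp [h])⟩⟩
  · by_cases hx : ∀ i, -ε < x i
    · have h1 : x + ε • diagVec n ∈ interior (quadrant n) := by
        rw [interior_quadrant]
        intro i
        rw [add_smul_diagVec_apply]
        linarith [hx i]
      have h2 := hf.contDiffAt (mem_interior_iff_mem_nhds.1 h1)
      exact hη.contDiffAt.smul (ContDiffAt.comp x h2 (contDiffAt_id.add contDiffAt_const))
    · obtain ⟨i, hi⟩ := not_forall.1 hx
      have h1 : ∀ᶠ y : EuclideanSpace ℝ (Fin n) in 𝓝 x, y i < -(ε / 2) := by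
        have : Continuous fun y : EuclideanSpace ℝ (Fin n) => y i := by fun_prop
        exact this.continuousAt.eventually (gt_mem_nhds (by linarith))
      refine (contDiffAt_const (c := (0 : F))).congr_of_eventuallyEq ?_
      filter_upwards [h1] with y hy
      rw [hη0 y i hy.le, zero_smul]
  · rw [add_smul_diagVec_apply]
    by_contra h
    refine hx ?_
    simp [hη0 x i (by linarith)]

end Quadrant

/-! ### Bundle charts and their domains -/

section Charts

variable {E : Type*} [NormedAddCommGroup E] [NormedSpace ℝ E]
  {H : Type*} [TopologicalSpace H] {I : ModelWithCorners ℝ E H}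
  {M : Type*} [TopologicalSpace M] [ChartedSpace H M]
  {F : Type*} [NormedAddCommGroup F] [NormedSpace ℝ F]
  {V : M → Type*} [TopologicalSpace (TotalSpace F V)]
  [∀ x, AddCommGroup (V x)] [∀ x, Module ℝ (V x)] [∀ x, TopologicalSpace (V x)]
  [FiberBundle F V]

/-- The part of the base over which a bundle chart is defined. -/
def BundleChart.source (c : BundleChart I F V) : Set M := c.φ.source ∩ c.e.baseSet

theorem BundleChart.isOpen_source (c : BundleChart I F V) : IsOpen c.source :=
  c.φ.open_source.inter c.e.open_baseSet

theorem BundleChart.extend_mem_domain (c : BundleChart I F V) {x : M} (hx : x ∈ c.source) :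
    c.φ.extend I x ∈ c.domain := by
  have h : x ∈ (c.φ.extend I).source := by rw [c.φ.extend_source]; exact hx.1
  refine ⟨(c.φ.extend I).map_source h, ?_⟩
  rw [mem_preimage, (c.φ.extend I).left_inv h]
  exact hx.2

theorem BundleChart.extend_left_inv (c : BundleChart I F V) {x : M} (hx : x ∈ c.source) :
    (c.φ.extend I).symm (c.φ.extend I x) = x :=
  (c.φ.extend I).left_inv (by rw [c.φ.extend_source]; exact hx.1)

theorem BundleChart.symm_mem_source (c : BundleChart I F V) {y : E} (hy : y ∈ c.domain) :
    (c.φ.extend I).symm y ∈ c.source := by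
  refine ⟨?_, hy.2⟩
  have := (c.φ.extend I).map_target hy.1
  rwa [c.φ.extend_source] at this

theorem BundleChart.extend_right_inv (c : BundleChart I F V) {y : E} (hy : y ∈ c.domain) :
    c.φ.extend I ((c.φ.extend I).symm y) = y :=
  (c.φ.extend I).right_inv hy.1

theorem BundleChart.domain_subset_range (c : BundleChart I F V) : c.domain ⊆ range I :=
  fun _ hy => c.φ.extend_target_subset_range hy.1

theorem BundleChart.exists_isOpen_domain_inter (c : BundleChart I F V) {U : Set M}
    (hU : IsOpen U) :
    ∃ O : Set E, IsOpen O ∧ c.domain ∩ (c.φ.extend I).symm ⁻¹' U = range I ∩ O := by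
  refine ⟨I.symm ⁻¹' (c.φ.target ∩ c.φ.symm ⁻¹' (c.e.baseSet ∩ U)),
    (c.φ.isOpen_inter_preimage_symm (c.e.open_baseSet.inter hU)).preimage I.continuous_symm, ?_⟩
  ext y
  simp only [BundleChart.domain, OpenPartialHomeomorph.extend_target, mem_inter_iff,
    mem_preimage, OpenPartialHomeomorph.extend_coe_symm, Function.comp_apply]
  tauto

theorem BundleChart.exists_isOpen_domain (c : BundleChart I F V) :
    ∃ O : Set E, IsOpen O ∧ c.domain = range I ∩ O := by
  simpa using c.exists_isOpen_domain_inter isOpen_univ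

theorem BundleChart.uniqueDiffOn_domain_inter (c : BundleChart I F V) {U : Set M}
    (hU : IsOpen U) : UniqueDiffOn ℝ (c.domain ∩ (c.φ.extend I).symm ⁻¹' U) := by
  obtain ⟨O, hO, h⟩ := c.exists_isOpen_domain_inter hU
  exact h ▸ I.uniqueDiffOn.inter hO

/-- The domain is relatively open in `range I`, so restricting to it does not affect derivatives. -/
theorem BundleChart.iteratedFDerivWithin_domain (c : BundleChart I F V) {G : Type*}
    [NormedAddCommGroup G] [NormedSpace ℝ G] (g : E → G) (k : ℕ) {y : E} (hy : y ∈ c.domain) :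
    iteratedFDerivWithin ℝ k g c.domain y = iteratedFDerivWithin ℝ k g (range I) y := by
  obtain ⟨O, hO, h⟩ := c.exists_isOpen_domain
  rw [h] at hy ⊢
  exact iteratedFDerivWithin_inter_open hO hy.2

theorem BundleChart.iteratedFDerivWithin_domain_inter (c : BundleChart I F V) {G : Type*}
    [NormedAddCommGroup G] [NormedSpace ℝ G] {U : Set M} (hU : IsOpen U) (g : E → G) (k : ℕ)
    {y : E} (hy : y ∈ c.domain) (hyU : (c.φ.extend I).symm y ∈ U) :
    iteratedFDerivWithin ℝ k g (c.domain ∩ (c.φ.extend I).symm ⁻¹' U) y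
      = iteratedFDerivWithin ℝ k g c.domain y := by
  obtain ⟨O, hO, h⟩ := c.exists_isOpen_domain_inter hU
  rw [c.iteratedFDerivWithin_domain g k hy]
  have hy' : y ∈ range I ∩ O := h ▸ ⟨hy, hyU⟩
  rw [h, iteratedFDerivWithin_inter_open hO hy'.2]

theorem BundleChart.continuousOn_extend_symm (c : BundleChart I F V) :
    ContinuousOn (c.φ.extend I).symm c.domain :=
  (c.φ.continuousOn_extend_symm).mono inter_subset_left

theorem BundleChart.continuousOn_extend (c : BundleChart I F V) :
    ContinuousOn (c.φ.extend I) c.source :=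
  c.φ.continuousOn_extend.mono (by rw [c.φ.extend_source]; exact inter_subset_left)

theorem BundleChart.contMDiffOn_extend_symm (c : BundleChart I F V) :
    ContMDiffOn 𝓘(ℝ, E) I ∞ (c.φ.extend I).symm c.domain := by
  refine (_root_.contMDiffOn_extend_symm c.smooth_φ).mono fun y hy => ?_
  have := hy.1
  rwa [c.φ.extend_target'] at this

theorem BundleChart.contMDiffOn_extend (c : BundleChart I F V) :
    ContMDiffOn I 𝓘(ℝ, E) ∞ (c.φ.extend I) c.source :=
  (c.φ.contMDiffOn_extend c.smooth_φ).mono inter_subset_left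

variable [VectorBundle ℝ F V]

/-- The linear isomorphism from a fiber to the model fiber given by a bundle chart. -/
def BundleChart.fiberEquiv (c : BundleChart I F V) {x : M} (hx : x ∈ c.e.baseSet) : V x ≃ₗ[ℝ] F :=
  haveI := c.mem_e
  c.e.linearEquivAt ℝ x hx

theorem BundleChart.fiberEquiv_apply (c : BundleChart I F V) {x : M} (hx : x ∈ c.e.baseSet)
    (v : V x) : c.fiberEquiv hx v = (c.e ⟨x, v⟩).2 :=
  haveI := c.mem_e
  c.e.linearEquivAt_apply x hx v

theorem BundleChart.mk_fiberEquiv_symm (c : BundleChart I F V) {x : M} (hx : x ∈ c.e.baseSet)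
    (w : F) : (⟨x, (c.fiberEquiv hx).symm w⟩ : TotalSpace F V) = c.e.toOpenPartialHomeomorph.symm (x, w) := by
  have h : c.e ⟨x, (c.fiberEquiv hx).symm w⟩ = (x, w) := by
    refine Prod.ext (c.e.coe_fst' hx) ?_
    rw [← c.fiberEquiv_apply hx, LinearEquiv.apply_symm_apply]
  rw [← h]
  exact (c.e.symm_apply_apply (c.e.mem_source.2 hx)).symm

theorem BundleChart.localRep_eq_fiberEquiv (c : BundleChart I F V) (s : ∀ x, V x) {y : E}
    (hy : y ∈ c.domain) : c.localRep s y = c.fiberEquiv hy.2 (s _) :=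
  (c.fiberEquiv_apply hy.2 _).symm

end Charts

/-! ### Vector bundle morphisms in bundle charts -/

section Transition

variable {E E' : Type*} [NormedAddCommGroup E] [NormedSpace ℝ E]
  [NormedAddCommGroup E'] [NormedSpace ℝ E']
  {H H' : Type*} [TopologicalSpace H] {I : ModelWithCorners ℝ E H}
  [TopologicalSpace H'] {I' : ModelWithCorners ℝ E' H'}
  {M : Type*} [TopologicalSpace M] [ChartedSpace H M]
  {M' : Type*} [TopologicalSpace M'] [ChartedSpace H' M']
  {F : Type*} [NormedAddCommGroup F] [NormedSpace ℝ F]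
  {V : M → Type*} [TopologicalSpace (TotalSpace F V)]
  [∀ x, AddCommGroup (V x)] [∀ x, Module ℝ (V x)] [∀ x, TopologicalSpace (V x)]
  [FiberBundle F V] [VectorBundle ℝ F V]
  {V' : M' → Type*} [TopologicalSpace (TotalSpace F V')]
  [∀ x, AddCommGroup (V' x)] [∀ x, Module ℝ (V' x)] [∀ x, TopologicalSpace (V' x)]
  [FiberBundle F V'] [VectorBundle ℝ F V']
  {f : M → M'} {Φ : ∀ x, V x ≃ₗ[ℝ] V' (f x)}

/-- The base map is the bundle map preceded by the zero section and followed by the projection. -/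
theorem contMDiff_of_contMDiff_totalSpace
    (hΦ : ContMDiff (I.prod 𝓘(ℝ, F)) (I'.prod 𝓘(ℝ, F)) ∞
      (fun w : TotalSpace F V => (⟨f w.proj, Φ w.proj w.snd⟩ : TotalSpace F V'))) :
    ContMDiff I I' ∞ f :=
  (Bundle.contMDiff_proj V').comp (hΦ.comp (Bundle.contMDiff_zeroSection ℝ V))

/-- The domain, in a bundle chart `c`, of the representative in the bundle charts `c` and `c'` of a
vector bundle morphism over `f`. -/
def transitionDomain (f : M → M') (c : BundleChart I F V) (c' : BundleChart I' F V') : Set E :=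
  c.domain ∩ (c.φ.extend I).symm ⁻¹' (f ⁻¹' c'.source)

theorem contDiffOn_transition (hf : ContMDiff I I' ∞ f) (c : BundleChart I F V)
    (c' : BundleChart I' F V') :
    ContDiffOn ℝ ∞ (fun y => c'.φ.extend I' (f ((c.φ.extend I).symm y)))
      (transitionDomain f c c') := by
  rw [← contMDiffOn_iff_contDiffOn]
  exact c'.contMDiffOn_extend.comp
    (hf.comp_contMDiffOn (c.contMDiffOn_extend_symm.mono inter_subset_left)) fun y hy => hy.2

variable [FiniteDimensional ℝ F] [ContMDiffVectorBundle ∞ F V I] [ContMDiffVectorBundle ∞ F V' I']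

/-- The representative of a vector bundle isomorphism and of its inverse in bundle charts. -/
theorem exists_contDiffOn_fiber_transition
    (hΦ : ContMDiff (I.prod 𝓘(ℝ, F)) (I'.prod 𝓘(ℝ, F)) ∞
      (fun w : TotalSpace F V => (⟨f w.proj, Φ w.proj w.snd⟩ : TotalSpace F V')))
    (c : BundleChart I F V) (c' : BundleChart I' F V') :
    ∃ A B : E → F →L[ℝ] F, ContDiffOn ℝ ∞ A (transitionDomain f c c') ∧
      ContDiffOn ℝ ∞ B (transitionDomain f c c') ∧ ∀ y ∈ transitionDomain f c c',
      ∀ v : V ((c.φ.extend I).symm y),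
        (c'.e ⟨f ((c.φ.extend I).symm y), Φ _ v⟩).2 = A y (c.e ⟨(c.φ.extend I).symm y, v⟩).2 ∧
        (c.e ⟨(c.φ.extend I).symm y, v⟩).2
          = B y (c'.e ⟨f ((c.φ.extend I).symm y), Φ _ v⟩).2 := by
  classical
  have := c.mem_e
  have := c'.mem_e
  set D := transitionDomain f c c'
  let L : ∀ y, y ∈ D → F ≃L[ℝ] F := fun y hy =>
    ((c.fiberEquiv hy.1.2).symm.trans ((Φ _).trans (c'.fiberEquiv hy.2.2))).toContinuousLinearEquiv
  have hL : ∀ y (hy : y ∈ D) (v : V ((c.φ.extend I).symm y)),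
      L y hy (c.e ⟨(c.φ.extend I).symm y, v⟩).2
        = (c'.e ⟨f ((c.φ.extend I).symm y), Φ _ v⟩).2 := by
    intro y hy v
    rw [← c.fiberEquiv_apply hy.1.2, ← c'.fiberEquiv_apply hy.2.2]
    simp only [L, LinearEquiv.coe_toContinuousLinearEquiv', LinearEquiv.trans_apply,
      LinearEquiv.symm_apply_apply]
  let A : E → F →L[ℝ] F := fun y => if hy : y ∈ D then L y hy else 0
  have hA : ∀ y (hy : y ∈ D), A y = L y hy := fun y hy => dif_pos hy
  have hAs : ContDiffOn ℝ ∞ A D := by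
    -- As `F` is finite-dimensional, smoothness of `A` can be tested on a fixed vector w, that is,
    -- on the bundle map along the constant local section w.
    rw [contDiffOn_clm_apply]
    intro w
    rw [← contMDiffOn_iff_contDiffOn]
    have h1 : ContMDiffOn 𝓘(ℝ, E) (I.prod 𝓘(ℝ, F)) ∞
        (fun y => c.e.toOpenPartialHomeomorph.symm ((c.φ.extend I).symm y, w)) D :=
      (Trivialization.contMDiffOn_symm c.e).comp
        ((c.contMDiffOn_extend_symm.mono inter_subset_left).prodMk contMDiffOn_const)
        fun y hy => c.e.mem_target.2 hy.1.2
    have h2 := (Trivialization.contMDiffOn (IB := I') (n := ∞) c'.e).comp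
      (hΦ.comp_contMDiffOn h1) fun y hy => by
        rw [mem_preimage, c'.e.mem_source]
        change f (c.e.toOpenPartialHomeomorph.symm ((c.φ.extend I).symm y, w)).proj ∈ c'.e.baseSet
        rw [← c.mk_fiberEquiv_symm hy.1.2]
        exact hy.2.2
    refine (contMDiff_snd.comp_contMDiffOn h2).congr fun y hy => ?_
    have h3 := hL y hy ((c.fiberEquiv hy.1.2).symm w)
    rw [← c.fiberEquiv_apply hy.1.2, LinearEquiv.apply_symm_apply] at h3
    rw [hA y hy]
    refine h3.trans ?_
    change _ = (c'.e ((fun w : TotalSpace F V => (⟨f w.proj, Φ w.proj w.snd⟩ : TotalSpace F V'))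
      (c.e.toOpenPartialHomeomorph.symm ((c.φ.extend I).symm y, w)))).2
    rw [← c.mk_fiberEquiv_symm hy.1.2 w]
  -- Inversion is smooth at invertible operators, so the inverse fiber maps are smooth without being
  -- assumed so.
  refine ⟨A, fun y => (A y).inverse, hAs, fun y hy => ?_, fun y hy v => ⟨?_, ?_⟩⟩
  · refine ContDiffAt.comp_contDiffWithinAt (g := ContinuousLinearMap.inverse) y ?_ (hAs y hy)
    rw [hA y hy]
    exact contDiffAt_map_inverse _
  · rw [hA y hy]
    exact (hL y hy v).symm
  · change _ = (A y).inverse _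
    rw [hA y hy, ContinuousLinearMap.inverse_equiv, ← hL y hy v]
    simp

end Transition

/-! ### The C^r topology through its family of seminorms -/

section SeminormTopology

variable {E : Type*} [NormedAddCommGroup E] [NormedSpace ℝ E]
  {H : Type*} [TopologicalSpace H] {I : ModelWithCorners ℝ E H}
  {M : Type*} [TopologicalSpace M] [ChartedSpace H M]
  {F : Type*} [NormedAddCommGroup F] [NormedSpace ℝ F] {r : ℕ∞}
  {V : M → Type*} [TopologicalSpace (TotalSpace F V)]
  [∀ x, AddCommGroup (V x)] [∀ x, Module ℝ (V x)] [∀ x, TopologicalSpace (V x)]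
  [FiberBundle F V]

theorem BundleChart.exists_mem_source [IsManifold I ∞ M] (x : M) :
    ∃ c : BundleChart I F V, x ∈ c.source :=
  ⟨⟨chartAt H x, IsManifold.chart_mem_maximalAtlas x, trivializationAt F V x,
    inferInstance⟩, mem_chart_source H x, mem_baseSet_trivializationAt F V x⟩

variable (I F r V) in
/-- The index type of the family of all seminorms `chartSeminorm`. -/
structure SeminormIndex where
  /-- the bundle chart -/
  c : BundleChart I F V
  /-- the compact set -/
  K : Set E
  hK : IsCompact K
  hKc : K ⊆ c.domain
  /-- the order of differentiation -/
  k : ℕ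
  hk : (k : ℕ∞) ≤ r

variable [VectorBundle ℝ F V] [ContMDiffVectorBundle ∞ F V I]

variable (I F r V) in
/-- The family of all seminorms `chartSeminorm`. -/
def sectionSeminorms : SeminormFamily ℝ Cₛ^(r : WithTop ℕ∞)⟮I; F, V⟯ (SeminormIndex I F r V) :=
  fun i => chartSeminorm i.c i.hK i.hKc i.hk

instance : IsTopologicalAddGroup Cₛ^(r : WithTop ℕ∞)⟮I; F, V⟯ :=
  topologicalAddGroup_iInf fun c => topologicalAddGroup_iInf fun _ =>
    topologicalAddGroup_iInf fun hK => topologicalAddGroup_iInf fun hKc =>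
    topologicalAddGroup_iInf fun _ => topologicalAddGroup_iInf fun hk =>
    (chartSeminorm c hK hKc hk).toSeminormedAddCommGroup.toIsTopologicalAddGroup

theorem withSeminorms_section : WithSeminorms (sectionSeminorms I F r V) := by
  rw [SeminormFamily.withSeminorms_iff_topologicalSpace_eq_iInf]
  refine le_antisymm (le_iInf fun i => ?_) ?_
  · exact (iInf_le _ i.c).trans <| (iInf_le _ i.K).trans <| (iInf_le _ i.hK).trans <|
      (iInf_le _ i.hKc).trans <| (iInf_le _ i.k).trans <| iInf_le _ i.hk
  · exact le_iInf fun c => le_iInf fun K => le_iInf fun hK => le_iInf fun hKc =>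
      le_iInf fun k => le_iInf fun hk => iInf_le_of_le ⟨c, K, hK, hKc, k, hk⟩ le_rfl

theorem continuous_chartSeminorm (c : BundleChart I F V) {K : Set E} (hK : IsCompact K)
    (hKc : K ⊆ c.domain) {k : ℕ} (hk : (k : ℕ∞) ≤ r) : Continuous (chartSeminorm c hK hKc hk) :=
  withSeminorms_section.continuous_seminorm ⟨c, K, hK, hKc, k, hk⟩

theorem le_chartSeminorm (c : BundleChart I F V) {K : Set E} (hK : IsCompact K)
    (hKc : K ⊆ c.domain) {k : ℕ} (hk : (k : ℕ∞) ≤ r) (s : Cₛ^(r : WithTop ℕ∞)⟮I; F, V⟯) {y : E}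
    (hy : y ∈ K) :
    ‖iteratedFDerivWithin ℝ k (c.localRep s) c.domain y‖ ≤ chartSeminorm c hK hKc hk s :=
  le_ciSup (c.bddAbove s hK hKc hk) (⟨y, hy⟩ : K)

theorem chartSeminorm_le (c : BundleChart I F V) {K : Set E} (hK : IsCompact K)
    (hKc : K ⊆ c.domain) {k : ℕ} (hk : (k : ℕ∞) ≤ r) (s : Cₛ^(r : WithTop ℕ∞)⟮I; F, V⟯) {b : ℝ}
    (hb : 0 ≤ b) (h : ∀ y ∈ K, ‖iteratedFDerivWithin ℝ k (c.localRep s) c.domain y‖ ≤ b) :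
    chartSeminorm c hK hKc hk s ≤ b :=
  Real.iSup_le (fun y => h y y.2) hb

/-- The sum of the seminorms `chartSeminorm` of order at most `k`. -/
def chartNorm (c : BundleChart I F V) {K : Set E} (hK : IsCompact K) (hKc : K ⊆ c.domain)
    {k : ℕ} (hk : (k : ℕ∞) ≤ r) : Seminorm ℝ Cₛ^(r : WithTop ℕ∞)⟮I; F, V⟯ :=
  ∑ m : Fin (k + 1), chartSeminorm c hK hKc
    ((Nat.cast_le.2 (Nat.lt_succ_iff.1 m.2)).trans hk : ((m : ℕ) : ℕ∞) ≤ r)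

theorem chartNorm_apply (c : BundleChart I F V) {K : Set E} (hK : IsCompact K)
    (hKc : K ⊆ c.domain) {k : ℕ} (hk : (k : ℕ∞) ≤ r) (s : Cₛ^(r : WithTop ℕ∞)⟮I; F, V⟯) :
    chartNorm c hK hKc hk s = ∑ m : Fin (k + 1), chartSeminorm c hK hKc
      ((Nat.cast_le.2 (Nat.lt_succ_iff.1 m.2)).trans hk : ((m : ℕ) : ℕ∞) ≤ r) s := by
  rw [chartNorm, ← FunLike.coeAddMonoidHom_apply, map_sum, Finset.sum_apply]
  rfl

theorem continuous_chartNorm (c : BundleChart I F V) {K : Set E} (hK : IsCompact K)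
    (hKc : K ⊆ c.domain) {k : ℕ} (hk : (k : ℕ∞) ≤ r) : Continuous (chartNorm c hK hKc hk) := by
  refine Continuous.congr ?_ fun s => (chartNorm_apply c hK hKc hk s).symm
  exact continuous_finsetSum _ fun m _ => continuous_chartSeminorm c hK hKc _

theorem sum_norm_le_chartNorm (c : BundleChart I F V) {K : Set E} (hK : IsCompact K)
    (hKc : K ⊆ c.domain) {k : ℕ} (hk : (k : ℕ∞) ≤ r) (s : Cₛ^(r : WithTop ℕ∞)⟮I; F, V⟯) {y : E}
    (hy : y ∈ K) :
    ∑ m ∈ Finset.range (k + 1), ‖iteratedFDerivWithin ℝ m (c.localRep s) c.domain y‖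
      ≤ chartNorm c hK hKc hk s := by
  rw [chartNorm_apply, Finset.sum_range]
  exact Finset.sum_le_sum fun m _ => le_chartSeminorm c hK hKc _ s hy

theorem chartNorm_le (c : BundleChart I F V) {K : Set E} (hK : IsCompact K)
    (hKc : K ⊆ c.domain) {k : ℕ} (hk : (k : ℕ∞) ≤ r) (s : Cₛ^(r : WithTop ℕ∞)⟮I; F, V⟯) {b : ℝ}
    (hb : 0 ≤ b)
    (h : ∀ m ≤ k, ∀ y ∈ K, ‖iteratedFDerivWithin ℝ m (c.localRep s) c.domain y‖ ≤ b) :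
    chartNorm c hK hKc hk s ≤ (k + 1) * b := by
  rw [chartNorm_apply]
  refine (Finset.sum_le_sum (g := fun _ => b) fun (m : Fin (k + 1)) _ =>
    chartSeminorm_le c hK hKc _ s hb (h m (Nat.lt_succ_iff.1 m.2))).trans ?_
  simp

theorem chartSeminorm_le_chartNorm (c : BundleChart I F V) {K : Set E} (hK : IsCompact K)
    (hKc : K ⊆ c.domain) {k m : ℕ} (hk : (k : ℕ∞) ≤ r) (hm : (m : ℕ∞) ≤ r) (hmk : m ≤ k)
    (s : Cₛ^(r : WithTop ℕ∞)⟮I; F, V⟯) :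
    chartSeminorm c hK hKc hm s ≤ chartNorm c hK hKc hk s := by
  rw [chartNorm_apply]
  exact Finset.single_le_sum (f := fun i : Fin (k + 1) => chartSeminorm c hK hKc
      ((Nat.cast_le.2 (Nat.lt_succ_iff.1 i.2)).trans hk : ((i : ℕ) : ℕ∞) ≤ r) s)
    (fun _ _ => apply_nonneg _ _) (Finset.mem_univ (⟨m, Nat.lt_succ_iff.2 hmk⟩ : Fin (k + 1)))

theorem chartNorm_mono (c : BundleChart I F V) {K : Set E} (hK : IsCompact K)
    (hKc : K ⊆ c.domain) {k l : ℕ} (hk : (k : ℕ∞) ≤ r) (hl : (l : ℕ∞) ≤ r) (hlk : l ≤ k)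
    (s : Cₛ^(r : WithTop ℕ∞)⟮I; F, V⟯) :
    chartNorm c hK hKc hl s ≤ (l + 1) * chartNorm c hK hKc hk s := by
  rw [chartNorm_apply]
  refine (Finset.sum_le_sum fun m _ => chartSeminorm_le_chartNorm c hK hKc hk _
    ((Nat.lt_succ_iff.1 m.2).trans hlk) s).trans ?_
  simp

end SeminormTopology

/-! ### Comparing seminorms across charts and bundle maps -/

section Comparison

variable {E E' : Type*} [NormedAddCommGroup E] [NormedSpace ℝ E]
  [NormedAddCommGroup E'] [NormedSpace ℝ E']
  {H H' : Type*} [TopologicalSpace H] {I : ModelWithCorners ℝ E H}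
  [TopologicalSpace H'] {I' : ModelWithCorners ℝ E' H'}
  {M : Type*} [TopologicalSpace M] [ChartedSpace H M]
  {M' : Type*} [TopologicalSpace M'] [ChartedSpace H' M']
  {F : Type*} [NormedAddCommGroup F] [NormedSpace ℝ F] [FiniteDimensional ℝ F] {r : ℕ∞}
  {V : M → Type*} [TopologicalSpace (TotalSpace F V)]
  [∀ x, AddCommGroup (V x)] [∀ x, Module ℝ (V x)] [∀ x, TopologicalSpace (V x)]
  [FiberBundle F V] [VectorBundle ℝ F V] [ContMDiffVectorBundle ∞ F V I]
  {V' : M' → Type*} [TopologicalSpace (TotalSpace F V')]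
  [∀ x, AddCommGroup (V' x)] [∀ x, Module ℝ (V' x)] [∀ x, TopologicalSpace (V' x)]
  [FiberBundle F V'] [VectorBundle ℝ F V'] [ContMDiffVectorBundle ∞ F V' I']
  {f : M → M'} {Φ : ∀ x, V x ≃ₗ[ℝ] V' (f x)}

/-- The derivatives of the local representative of a section are bounded by those of a section
related to it by a vector bundle isomorphism. -/
theorem exists_bound_localRep
    (hΦ : ContMDiff (I.prod 𝓘(ℝ, F)) (I'.prod 𝓘(ℝ, F)) ∞
      (fun w : TotalSpace F V => (⟨f w.proj, Φ w.proj w.snd⟩ : TotalSpace F V')))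
    (c : BundleChart I F V) (c' : BundleChart I' F V') {K : Set E} (hK : IsCompact K)
    (hKD : K ⊆ transitionDomain f c c') {k : ℕ} (hk : (k : ℕ∞) ≤ r) :
    ∃ C, 0 ≤ C ∧ ∀ (s : Cₛ^(r : WithTop ℕ∞)⟮I; F, V⟯) (s' : Cₛ^(r : WithTop ℕ∞)⟮I'; F, V'⟯),
      (∀ x, Φ x (s x) = s' (f x)) → ∀ y ∈ K,
      ‖iteratedFDerivWithin ℝ k (c.localRep s) c.domain y‖ ≤ C * ∑ m ∈ Finset.range (k + 1),
        ‖iteratedFDerivWithin ℝ m (c'.localRep s') c'.domain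
          (c'.φ.extend I' (f ((c.φ.extend I).symm y)))‖ := by
  have hf := contMDiff_of_contMDiff_totalSpace hΦ
  obtain ⟨A, B, -, hB, hAB⟩ := exists_contDiffOn_fiber_transition hΦ c c'
  have hU : IsOpen (f ⁻¹' c'.source) := c'.isOpen_source.preimage hf.continuous
  obtain ⟨C, hC0, hC⟩ := exists_bound_iteratedFDerivWithin_clm_comp
    (s := transitionDomain f c c') (t := c'.domain)
    (c.uniqueDiffOn_domain_inter hU) c'.uniqueDiffOn_domain (contDiffOn_transition hf c c')
    (fun y hy => c'.extend_mem_domain hy.2) hB hK hKD k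
  refine ⟨C, hC0, fun s s' hs y hy => ?_⟩
  refine le_trans (le_of_eq ?_) (hC (c'.localRep s')
    ((c'.contDiffOn_localRep s').of_le (by exact_mod_cast hk)) y hy)
  rw [← c.iteratedFDerivWithin_domain_inter hU _ k (hKD hy).1 (hKD hy).2]
  congr 1
  refine iteratedFDerivWithin_congr (fun z hz => ?_) (hKD hy) k
  have h1 := (hAB z hz (s _)).2
  rw [hs] at h1
  simp only [BundleChart.localRep]
  rw [c'.extend_left_inv hz.2]
  exact h1

/-- The image of `K` need not fit into one bundle chart of the target. Compactness reduces to small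
pieces of `K` whose images do, and the seminorms obtained there are added. -/
theorem exists_continuous_seminorm_bound [IsManifold I' ∞ M']
    (hΦ : ContMDiff (I.prod 𝓘(ℝ, F)) (I'.prod 𝓘(ℝ, F)) ∞
      (fun w : TotalSpace F V => (⟨f w.proj, Φ w.proj w.snd⟩ : TotalSpace F V')))
    (c : BundleChart I F V) {K : Set E} (hK : IsCompact K)
    (hKc : K ⊆ c.domain) {k : ℕ} (hk : (k : ℕ∞) ≤ r) :
    ∃ q : Seminorm ℝ Cₛ^(r : WithTop ℕ∞)⟮I'; F, V'⟯, Continuous q ∧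
      ∀ (s : Cₛ^(r : WithTop ℕ∞)⟮I; F, V⟯) (s' : Cₛ^(r : WithTop ℕ∞)⟮I'; F, V'⟯),
      (∀ x, Φ x (s x) = s' (f x)) → chartSeminorm c hK hKc hk s ≤ q s' := by
  have hf := contMDiff_of_contMDiff_totalSpace hΦ
  suffices h : ∃ q : Seminorm ℝ Cₛ^(r : WithTop ℕ∞)⟮I'; F, V'⟯, Continuous q ∧
      ∀ (s : Cₛ^(r : WithTop ℕ∞)⟮I; F, V⟯) (s' : Cₛ^(r : WithTop ℕ∞)⟮I'; F, V'⟯),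
      (∀ x, Φ x (s x) = s' (f x)) → ∀ y ∈ K,
      ‖iteratedFDerivWithin ℝ k (c.localRep s) c.domain y‖ ≤ q s' by
    obtain ⟨q, hq, h⟩ := h
    exact ⟨q, hq, fun s s' hs => chartSeminorm_le c hK hKc hk s (apply_nonneg q s') (h s s' hs)⟩
  refine hK.induction_on (p := fun S => ∃ q : Seminorm ℝ Cₛ^(r : WithTop ℕ∞)⟮I'; F, V'⟯,
    Continuous q ∧ ∀ (s : Cₛ^(r : WithTop ℕ∞)⟮I; F, V⟯) (s' : Cₛ^(r : WithTop ℕ∞)⟮I'; F, V'⟯),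
      (∀ x, Φ x (s x) = s' (f x)) → ∀ y ∈ S,
      ‖iteratedFDerivWithin ℝ k (c.localRep s) c.domain y‖ ≤ q s') ?_ ?_ ?_ ?_
  · exact ⟨0, continuous_const, fun _ _ _ y hy => hy.elim⟩
  · rintro S S' hSS' ⟨q, hq, h⟩
    exact ⟨q, hq, fun s s' hs y hy => h s s' hs y (hSS' hy)⟩
  · rintro S S' ⟨q, hq, h⟩ ⟨q', hq', h'⟩
    refine ⟨q + q', hq.add hq', fun s s' hs y hy => ?_⟩
    change _ ≤ q s' + q' s'
    rcases hy with hy | hy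
    · exact (h s s' hs y hy).trans (le_add_of_nonneg_right (apply_nonneg q' s'))
    · exact (h' s s' hs y hy).trans (le_add_of_nonneg_left (apply_nonneg q s'))
  · intro y hy
    obtain ⟨c', hc'⟩ := BundleChart.exists_mem_source (I := I') (F := F) (V := V')
      (f ((c.φ.extend I).symm y))
    have hU : IsOpen (f ⁻¹' c'.source) := c'.isOpen_source.preimage hf.continuous
    obtain ⟨O, hO, hDO⟩ := c.exists_isOpen_domain_inter hU
    have hyO : y ∈ range I ∩ O := hDO ▸ ⟨hKc hy, hc'⟩
    obtain ⟨δ, hδ, hball⟩ := Metric.nhds_basis_closedBall.mem_iff.1 (hO.mem_nhds hyO.2)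
    have hK₁ : IsCompact (K ∩ Metric.closedBall y δ) := hK.inter_right Metric.isClosed_closedBall
    have hK₁D : K ∩ Metric.closedBall y δ ⊆ transitionDomain f c c' := by
      rintro z ⟨hzK, hz⟩
      change z ∈ c.domain ∩ _
      rw [hDO]
      exact ⟨c.domain_subset_range (hKc hzK), hball hz⟩
    obtain ⟨C, hC0, hC⟩ := exists_bound_localRep hΦ c c' hK₁ hK₁D hk
    have hK₂ : IsCompact ((fun z => c'.φ.extend I' (f ((c.φ.extend I).symm z))) ''
        (K ∩ Metric.closedBall y δ)) :=
      hK₁.image_of_continuousOn ((contDiffOn_transition hf c c').continuousOn.mono hK₁D)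
    have hK₂c : (fun z => c'.φ.extend I' (f ((c.φ.extend I).symm z))) ''
        (K ∩ Metric.closedBall y δ) ⊆ c'.domain := by
      rintro _ ⟨z, hz, rfl⟩
      exact c'.extend_mem_domain (hK₁D hz).2
    refine ⟨K ∩ Metric.closedBall y δ, Filter.inter_mem self_mem_nhdsWithin
      (mem_nhdsWithin_of_mem_nhds (Metric.closedBall_mem_nhds y hδ)),
      C.toNNReal • chartNorm c' hK₂ hK₂c hk, ?_, fun s s' hs z hz => ?_⟩
    · exact (continuous_chartNorm c' hK₂ hK₂c hk).const_smul C.toNNReal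
    · refine (hC s s' hs z hz).trans ?_
      change _ ≤ (C.toNNReal : ℝ) * chartNorm c' hK₂ hK₂c hk s'
      rw [Real.coe_toNNReal C hC0]
      exact mul_le_mul_of_nonneg_left
        (sum_norm_le_chartNorm c' hK₂ hK₂c hk s' (mem_image_of_mem _ hz)) hC0

end Comparison

/-! ### Sections supported in a compact part of one chart -/

section SupportedIn

variable {E : Type*} [NormedAddCommGroup E] [NormedSpace ℝ E]
  {H : Type*} [TopologicalSpace H] {I : ModelWithCorners ℝ E H}
  {M : Type*} [TopologicalSpace M] [T2Space M] [ChartedSpace H M]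
  {F : Type*} [NormedAddCommGroup F] [NormedSpace ℝ F] [FiniteDimensional ℝ F] {r : ℕ∞}
  {V : M → Type*} [TopologicalSpace (TotalSpace F V)]
  [∀ x, AddCommGroup (V x)] [∀ x, Module ℝ (V x)] [∀ x, TopologicalSpace (V x)]
  [FiberBundle F V] [VectorBundle ℝ F V] [ContMDiffVectorBundle ∞ F V I]

theorem BundleChart.isCompact_image_symm (c : BundleChart I F V) {K : Set E} (hK : IsCompact K)
    (hKc : K ⊆ c.domain) : IsCompact ((c.φ.extend I).symm '' K) :=
  hK.image_of_continuousOn (c.continuousOn_extend_symm.mono hKc)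

theorem BundleChart.localRep_eq_zero (c : BundleChart I F V) {s : ∀ x, V x} {y : E}
    (hy : y ∈ c.domain) (hs : s ((c.φ.extend I).symm y) = 0) : c.localRep s y = 0 := by
  rw [c.localRep_eq_fiberEquiv s hy, hs, map_zero]

/-- On sections supported in a compact part of a bundle chart, all seminorms are bounded by those
of this bundle chart. -/
theorem exists_bound_chartSeminorm_of_supported (c₁ c : BundleChart I F V) {K₁ K : Set E}
    (hK₁ : IsCompact K₁) (hK₁c : K₁ ⊆ c₁.domain) (hK : IsCompact K) (hKc : K ⊆ c.domain) {k : ℕ}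
    (hk : (k : ℕ∞) ≤ r) :
    ∃ C, 0 ≤ C ∧ ∀ s : Cₛ^(r : WithTop ℕ∞)⟮I; F, V⟯,
      (∀ x, s x ≠ 0 → x ∈ (c.φ.extend I).symm '' K) →
      chartSeminorm c₁ hK₁ hK₁c hk s ≤ C * chartNorm c hK hKc hk s := by
  set S := (c.φ.extend I).symm '' K
  have hS : IsClosed S := (c.isCompact_image_symm hK hKc).isClosed
  have hK₂ : IsCompact (K₁ ∩ (c₁.φ.extend I).symm ⁻¹' S) :=
    hK₁.of_isClosed_subset ((c₁.continuousOn_extend_symm.mono hK₁c).preimage_isClosed_of_isClosed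
      hK₁.isClosed hS) inter_subset_left
  have hK₂D : K₁ ∩ (c₁.φ.extend I).symm ⁻¹' S ⊆ transitionDomain id c₁ c := by
    rintro y ⟨hy, z, hz, hzy⟩
    refine ⟨hK₁c hy, ?_⟩
    rw [mem_preimage, mem_preimage, ← hzy]
    exact c.symm_mem_source (hKc hz)
  -- The change of bundle charts is the comparison for the identity morphism. It is only needed over
  -- `S`; off the closed set `S` the section vanishes locally.
  obtain ⟨C, hC0, hC⟩ := exists_bound_localRep (f := id) (Φ := fun x => LinearEquiv.refl ℝ (V x))
    (r := r) contMDiff_id c₁ c hK₂ hK₂D hk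
  refine ⟨C, hC0, fun s hs => chartSeminorm_le c₁ hK₁ hK₁c hk s
    (mul_nonneg hC0 (apply_nonneg _ _)) fun y hy => ?_⟩
  by_cases hyS : (c₁.φ.extend I).symm y ∈ S
  · refine (hC s s (fun _ => rfl) y ⟨hy, hyS⟩).trans (mul_le_mul_of_nonneg_left ?_ hC0)
    refine sum_norm_le_chartNorm c hK hKc hk s ?_
    obtain ⟨z, hz, hzy⟩ := hyS
    rw [id, ← hzy, c.extend_right_inv (hKc hz)]
    exact hz
  · have h0 : ∀ z ∈ c₁.domain, (c₁.φ.extend I).symm z ∉ S → c₁.localRep s z = 0 :=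
      fun z hz hzS => c₁.localRep_eq_zero hz (by_contra fun h => hzS (hs _ h))
    have h : c₁.localRep s =ᶠ[𝓝[c₁.domain] y] fun _ => 0 := by
      filter_upwards [self_mem_nhdsWithin,
        c₁.continuousOn_extend_symm y (hK₁c hy) (hS.isOpen_compl.mem_nhds hyS)] with z hz hzS
      exact h0 z hz hzS
    rw [h.iteratedFDerivWithin_eq (h0 y (hK₁c hy) hyS), iteratedFDerivWithin_fun_zero]
    simpa using mul_nonneg hC0 (apply_nonneg (chartNorm c hK hKc hk) s)

/-- Continuity gives a bound by finitely many seminorms, each dominated by the single chart `c` for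
such supports; N is the largest order that occurs. The map `j` allows both the space of all sections
and the subspaces of sections with prescribed support. -/
theorem exists_bound_of_continuous {Z : Type*} [AddCommGroup Z] [Module ℝ Z] [TopologicalSpace Z]
    (j : Z →ₗ[ℝ] Cₛ^(r : WithTop ℕ∞)⟮I; F, V⟯) (hj : IsInducing j) (T : Z →ₗ[ℝ] ℝ)
    (hT : Continuous T) (c : BundleChart I F V) {K : Set E} (hK : IsCompact K)
    (hKc : K ⊆ c.domain) :
    ∃ (N : ℕ) (hN : (N : ℕ∞) ≤ r) (C : ℝ), 0 ≤ C ∧ ∀ z : Z,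
      (∀ x, j z x ≠ 0 → x ∈ (c.φ.extend I).symm '' K) →
      |T z| ≤ C * chartNorm c hK hKc hN (j z) := by
  have hw : WithSeminorms ((sectionSeminorms I F r V).comp j) := by
    rw [hj.eq_induced]
    exact LinearMap.withSeminorms_induced withSeminorms_section j
  obtain ⟨J, C, -, hC⟩ := Seminorm.bound_of_continuous hw ((normSeminorm ℝ ℝ).comp T)
    (continuous_norm.comp hT)
  choose D hD0 hD using fun i : SeminormIndex I F r V =>
    exists_bound_chartSeminorm_of_supported i.c c i.hK i.hKc hK hKc i.hk
  have hN : ((J.sup fun i => i.k : ℕ) : ℕ∞) ≤ r := by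
    obtain rfl | hJ := J.eq_empty_or_nonempty
    · simp
    · obtain ⟨i, -, hi⟩ := Finset.exists_mem_eq_sup J hJ fun i => i.k
      rw [hi]
      exact i.hk
  refine ⟨J.sup fun i => i.k, hN, C * ∑ i ∈ J, D i * (i.k + 1), ?_, fun z hz => ?_⟩
  · exact mul_nonneg C.2 (Finset.sum_nonneg fun i _ => mul_nonneg (hD0 i) (by positivity))
  · have h1 : |T z| ≤ C * (J.sup ((sectionSeminorms I F r V).comp j)) z := hC z
    refine h1.trans ?_
    rw [mul_assoc, Finset.sum_mul]
    refine mul_le_mul_of_nonneg_left ?_ C.2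
    refine (Seminorm.finset_sup_le_sum _ J z).trans ?_
    rw [← FunLike.coeAddMonoidHom_apply, map_sum, Finset.sum_apply]
    refine Finset.sum_le_sum fun i hi => ?_
    refine (hD i (j z) hz).trans ?_
    rw [mul_assoc]
    exact mul_le_mul_of_nonneg_left
      (chartNorm_mono c hK hKc hN i.hk (Finset.le_sup (f := fun i => i.k) hi) (j z)) (hD0 i)

end SupportedIn

/-! ### Constructing sections from local representatives -/

section SectionConstructions

variable {E : Type*} [NormedAddCommGroup E] [NormedSpace ℝ E]
  {H : Type*} [TopologicalSpace H] {I : ModelWithCorners ℝ E H}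
  {M : Type*} [TopologicalSpace M] [ChartedSpace H M]
  {F : Type*} [NormedAddCommGroup F] [NormedSpace ℝ F] {r : ℕ∞}
  {V : M → Type*} [TopologicalSpace (TotalSpace F V)]
  [∀ x, AddCommGroup (V x)] [∀ x, Module ℝ (V x)] [∀ x, TopologicalSpace (V x)]
  [FiberBundle F V] [VectorBundle ℝ F V] [ContMDiffVectorBundle ∞ F V I]

theorem natCast_le_infty (r : ℕ∞) : (r : WithTop ℕ∞) ≤ ∞ := by exact_mod_cast le_top

theorem BundleChart.contMDiffAt_section_iff (c : BundleChart I F V) {s : ∀ x, V x} {x : M}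
    (hx : x ∈ c.e.baseSet) :
    ContMDiffAt I (I.prod 𝓘(ℝ, F)) r (fun x => (⟨x, s x⟩ : TotalSpace F V)) x ↔
      ContMDiffAt I 𝓘(ℝ, F) r (fun x => (c.e ⟨x, s x⟩).2) x := by
  have := c.mem_e
  have : ContMDiffVectorBundle (r : WithTop ℕ∞) F V I :=
    ContMDiffVectorBundle.of_le (natCast_le_infty r)
  exact Trivialization.contMDiffAt_section_iff c.e hx

theorem contMDiffAt_section_of_eventually_eq_zero {s : ∀ x, V x} {x : M}
    (hs : ∀ᶠ y in 𝓝 x, s y = 0) :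
    ContMDiffAt I (I.prod 𝓘(ℝ, F)) r (fun x => (⟨x, s x⟩ : TotalSpace F V)) x := by
  refine (Bundle.contMDiff_zeroSection (n := r) (IB := I) ℝ V x).congr_of_eventuallyEq ?_
  filter_upwards [hs] with y hy
  rw [hy]
  rfl

/-- The product of a smooth function and a `C^r` section. -/
def smulSection (θ : C^∞⟮I, M; ℝ⟯) (s : Cₛ^(r : WithTop ℕ∞)⟮I; F, V⟯) :
    Cₛ^(r : WithTop ℕ∞)⟮I; F, V⟯ where
  toFun x := θ x • s x
  contMDiff_toFun := (θ.contMDiff.of_le (natCast_le_infty r)).smul_section s.contMDiff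

@[simp]
theorem smulSection_apply (θ : C^∞⟮I, M; ℝ⟯) (s : Cₛ^(r : WithTop ℕ∞)⟮I; F, V⟯) (x : M) :
    smulSection θ s x = θ x • s x := rfl

theorem sectionSupport_smulSection_subset (θ : C^∞⟮I, M; ℝ⟯)
    (s : Cₛ^(r : WithTop ℕ∞)⟮I; F, V⟯) : sectionSupport (smulSection θ s) ⊆ sectionSupport s :=
  closure_mono fun x hx h => hx (by simp [h])

/-- The section with a given local representative that is supported in a compact part of a bundle
chart. -/
theorem BundleChart.exists_section_localRep_eq [T2Space M] (c : BundleChart I F V) {g : E → F}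
    (hg : ContDiffOn ℝ r g c.domain) {K : Set E} (hK : IsCompact K) (hKc : K ⊆ c.domain)
    (hgK : ∀ y ∈ c.domain, y ∉ K → g y = 0) :
    ∃ s : Cₛ^(r : WithTop ℕ∞)⟮I; F, V⟯, (∀ y ∈ c.domain, c.localRep s y = g y) ∧
      ∀ x, s x ≠ 0 → x ∈ (c.φ.extend I).symm '' K := by
  classical
  let s : ∀ x, V x := fun x =>
    if hx : x ∈ c.source then (c.fiberEquiv hx.2).symm (g (c.φ.extend I x)) else 0
  have hs : ∀ x (hx : x ∈ c.source), s x = (c.fiberEquiv hx.2).symm (g (c.φ.extend I x)) :=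
    fun x hx => dif_pos hx
  have hsK : ∀ x, s x ≠ 0 → x ∈ (c.φ.extend I).symm '' K := by
    intro x h
    have hx : x ∈ c.source := by
      by_contra hx
      exact h (dif_neg hx)
    refine ⟨c.φ.extend I x, ?_, c.extend_left_inv hx⟩
    by_contra hxK
    rw [hs x hx, hgK _ (c.extend_mem_domain hx) hxK, map_zero] at h
    exact h rfl
  -- Closedness of the compact image makes the extension by zero vanish near every point outside the
  -- chart.
  have hS : IsClosed ((c.φ.extend I).symm '' K) :=
    (hK.image_of_continuousOn (c.continuousOn_extend_symm.mono hKc)).isClosed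
  have hsm : ContMDiff I (I.prod 𝓘(ℝ, F)) r (fun x => (⟨x, s x⟩ : TotalSpace F V)) := by
    intro x
    by_cases hx : x ∈ c.source
    · rw [c.contMDiffAt_section_iff hx.2]
      have h1 : ContMDiffOn I 𝓘(ℝ, F) r (fun x => g (c.φ.extend I x)) c.source :=
        (contMDiffOn_iff_contDiffOn.2 hg).comp
          (c.contMDiffOn_extend.of_le (natCast_le_infty r)) fun x hx => c.extend_mem_domain hx
      refine (h1.contMDiffAt (c.isOpen_source.mem_nhds hx)).congr_of_eventuallyEq ?_
      filter_upwards [c.isOpen_source.mem_nhds hx] with y hy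
      rw [← c.fiberEquiv_apply hy.2, hs y hy, LinearEquiv.apply_symm_apply]
    · refine contMDiffAt_section_of_eventually_eq_zero ?_
      have hxK : x ∉ (c.φ.extend I).symm '' K := by
        rintro ⟨y, hy, rfl⟩
        exact hx (c.symm_mem_source (hKc hy))
      filter_upwards [hS.isOpen_compl.mem_nhds hxK] with y hy
      exact by_contra fun h => hy (hsK y h)
  refine ⟨⟨s, hsm⟩, fun y hy => ?_, hsK⟩
  rw [c.localRep_eq_fiberEquiv _ hy]
  change c.fiberEquiv _ (s _) = _
  rw [hs _ (c.symm_mem_source hy), LinearEquiv.apply_symm_apply, c.extend_right_inv hy]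

theorem BundleChart.section_eq_zero_iff_localRep (c : BundleChart I F V) (s : ∀ x, V x) {y : E}
    (hy : y ∈ c.domain) : s ((c.φ.extend I).symm y) = 0 ↔ c.localRep s y = 0 := by
  rw [c.localRep_eq_fiberEquiv s hy, LinearEquiv.map_eq_zero_iff]

end SectionConstructions

/-! ### Localisation by finite partitions of unity -/

section Partition

variable {E : Type*} [NormedAddCommGroup E] [NormedSpace ℝ E] [FiniteDimensional ℝ E]
  {H : Type*} [TopologicalSpace H] {I : ModelWithCorners ℝ E H}
  {M : Type*} [TopologicalSpace M] [ChartedSpace H M] [IsManifold I ∞ M] [T2Space M]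
  [SigmaCompactSpace M]

/-- This is the local-to-global device: a property of multipliers that holds for all sufficiently
small supports near each point of `K` holds for finitely many multipliers summing to 1 on `K`. -/
theorem exists_smooth_partition {K : Set M} (hK : IsCompact K) {Q : C^∞⟮I, M; ℝ⟯ → Prop}
    (hQ : ∀ p ∈ K, ∃ U, IsOpen U ∧ p ∈ U ∧ ∀ θ : C^∞⟮I, M; ℝ⟯, tsupport θ ⊆ U → Q θ) :
    ∃ (t : Finset M) (θ : t → C^∞⟮I, M; ℝ⟯), (∀ i, Q (θ i)) ∧ ∀ x ∈ K, ∑ i, θ i x = 1 := by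
  choose! U hUo hpU hU using hQ
  obtain ⟨t, htK, ht⟩ := hK.elim_nhds_subcover U fun p hp => (hUo p hp).mem_nhds (hpU p hp)
  obtain ⟨f, hf⟩ := SmoothPartitionOfUnity.exists_isSubordinate I hK.isClosed
    (fun i : t => U i) (fun i => hUo i (htK i i.2)) (fun x hx => by
      obtain ⟨i, hi, hxi⟩ := mem_iUnion₂.1 (ht hx)
      exact mem_iUnion.2 ⟨⟨i, hi⟩, hxi⟩)
  refine ⟨t, f, fun i => hU i (htK i i.2) _ (hf i), fun x hx => ?_⟩
  rw [← finsum_eq_sum_of_fintype]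
  exact f.sum_eq_one hx

end Partition

/-! ### Test sections and the inductive limit topology -/

section TestSections

variable {E : Type*} [NormedAddCommGroup E] [NormedSpace ℝ E]
  {H : Type*} [TopologicalSpace H] {I : ModelWithCorners ℝ E H}
  {M : Type*} [TopologicalSpace M] [ChartedSpace H M]
  {F : Type*} [NormedAddCommGroup F] [NormedSpace ℝ F] {r : ℕ∞}
  {V : M → Type*} [TopologicalSpace (TotalSpace F V)]
  [∀ x, AddCommGroup (V x)] [∀ x, Module ℝ (V x)] [∀ x, TopologicalSpace (V x)]
  [FiberBundle F V] [VectorBundle ℝ F V] [ContMDiffVectorBundle ∞ F V I]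

variable (I F r V) in
/-- The linear map from test sections to sections. -/
def TestSection.toSectionₗ : TestSection I F r V →ₗ[ℝ] Cₛ^(r : WithTop ℕ∞)⟮I; F, V⟯ :=
  (compactlySupportedSections I F r V).subtype

theorem TestSection.toSectionₗ_apply (χ : TestSection I F r V) :
    TestSection.toSectionₗ I F r V χ = χ.toSection := rfl

theorem TestSection.ext {χ ψ : TestSection I F r V} (h : ∀ x, χ.toSection x = ψ.toSection x) :
    χ = ψ :=
  Subtype.ext (ContMDiffSection.ext h)

/-- The product of a smooth function and a test section. -/
def smulTestSection (θ : C^∞⟮I, M; ℝ⟯) (χ : TestSection I F r V) : TestSection I F r V :=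
  ⟨smulSection θ χ.toSection, IsCompact.of_isClosed_subset χ.2 isClosed_closure
    (sectionSupport_smulSection_subset θ χ.toSection)⟩

@[simp]
theorem smulTestSection_apply (θ : C^∞⟮I, M; ℝ⟯) (χ : TestSection I F r V) (x : M) :
    (smulTestSection θ χ).toSection x = θ x • χ.toSection x := rfl

theorem TestSection.sum_apply {ι : Type*} (t : Finset ι) (χ : ι → TestSection I F r V) (x : M) :
    (∑ i ∈ t, χ i).toSection x = ∑ i ∈ t, (χ i).toSection x := by
  rw [← TestSection.toSectionₗ_apply, map_sum]
  change (ContMDiffSection.coeAddHom I F r V (∑ i ∈ t, _)) x = _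
  rw [map_sum, Finset.sum_apply]
  rfl

theorem continuous_supportedInclusion (K : Compacts M) :
    Continuous (supportedInclusion I F r V K) :=
  continuous_sInf_rng.2 fun _ ht => ht.2.2.2 K

/-- The topology induced by `L` is one of the locally convex topologies over which the inductive
limit topology is the infimum. -/
theorem continuous_of_continuous_comp_supportedInclusion {Z : Type*} [AddCommGroup Z] [Module ℝ Z]
    [TopologicalSpace Z] [IsTopologicalAddGroup Z] [ContinuousSMul ℝ Z] [LocallyConvexSpace ℝ Z]
    (L : TestSection I F r V →ₗ[ℝ] Z)
    (hL : ∀ K : Compacts M, Continuous (L ∘ supportedInclusion I F r V K)) : Continuous L := by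
  rw [continuous_iff_le_induced]
  exact sInf_le ⟨topologicalAddGroup_induced L, continuousSMul_induced (L : _ →ₗ[ℝ] Z),
    LocallyConvexSpace.induced L, fun K => continuous_induced_rng.2 (hL K)⟩

/-- The bound of a continuous functional on test sections supported in a compact part of a bundle
chart. -/
theorem exists_bound_testSection [T2Space M] [FiniteDimensional ℝ F]
    (T : TestSection I F r V →L[ℝ] ℝ) (c : BundleChart I F V) {K : Set E} (hK : IsCompact K)
    (hKc : K ⊆ c.domain) :
    ∃ (N : ℕ) (hN : (N : ℕ∞) ≤ r) (C : ℝ), 0 ≤ C ∧ ∀ χ : TestSection I F r V,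
      (∀ x, χ.toSection x ≠ 0 → x ∈ (c.φ.extend I).symm '' K) →
      |T χ| ≤ C * chartNorm c hK hKc hN χ.toSection := by
  set K' : Compacts M := ⟨(c.φ.extend I).symm '' K, c.isCompact_image_symm hK hKc⟩
  let T' : ↥(sectionsSupportedIn I F r V K') →ₗ[ℝ] ℝ :=
    { toFun := fun s => T (supportedInclusion I F r V K' s)
      map_add' := fun s t => T.map_add (supportedInclusion I F r V K' s)
        (supportedInclusion I F r V K' t)
      map_smul' := fun a s => T.map_smul a (supportedInclusion I F r V K' s) }
  obtain ⟨N, hN, C, hC0, hC⟩ := exists_bound_of_continuous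
    (sectionsSupportedIn I F r V K').subtype ⟨rfl⟩ T'
    (T.continuous.comp (continuous_supportedInclusion K')) c hK hKc
  refine ⟨N, hN, C, hC0, fun χ hχ => ?_⟩
  have hχ' : χ.toSection ∈ sectionsSupportedIn I F r V K' :=
    closure_minimal (fun x hx => hχ x hx) K'.isCompact.isClosed
  exact hC ⟨χ.toSection, hχ'⟩ hχ

end TestSections

/-! ### Restriction of sections -/

section Pullback

variable {E E' : Type*} [NormedAddCommGroup E] [NormedSpace ℝ E]
  [NormedAddCommGroup E'] [NormedSpace ℝ E']
  {H H' : Type*} [TopologicalSpace H] {I : ModelWithCorners ℝ E H}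
  [TopologicalSpace H'] {I' : ModelWithCorners ℝ E' H'}
  {M : Type*} [TopologicalSpace M] [ChartedSpace H M] [IsManifold I ∞ M]
  {M' : Type*} [TopologicalSpace M'] [ChartedSpace H' M'] [IsManifold I' ∞ M']
  {F : Type*} [NormedAddCommGroup F] [NormedSpace ℝ F] [FiniteDimensional ℝ F] {r : ℕ∞}
  {V : M → Type*} [TopologicalSpace (TotalSpace F V)]
  [∀ x, AddCommGroup (V x)] [∀ x, Module ℝ (V x)] [∀ x, TopologicalSpace (V x)]
  [FiberBundle F V] [VectorBundle ℝ F V] [ContMDiffVectorBundle ∞ F V I]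
  {V' : M' → Type*} [TopologicalSpace (TotalSpace F V')]
  [∀ x, AddCommGroup (V' x)] [∀ x, Module ℝ (V' x)] [∀ x, TopologicalSpace (V' x)]
  [FiberBundle F V'] [VectorBundle ℝ F V'] [ContMDiffVectorBundle ∞ F V' I']
  {f : M → M'} {Φ : ∀ x, V x ≃ₗ[ℝ] V' (f x)}

/-- In bundle charts the pullback is `B` applied to the representative of `s'` along `f`, with `B`
the smooth family of inverse fiber maps. -/
theorem contMDiff_pullback_section
    (hΦ : ContMDiff (I.prod 𝓘(ℝ, F)) (I'.prod 𝓘(ℝ, F)) ∞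
      (fun w : TotalSpace F V => (⟨f w.proj, Φ w.proj w.snd⟩ : TotalSpace F V')))
    (s' : Cₛ^(r : WithTop ℕ∞)⟮I'; F, V'⟯) :
    ContMDiff I (I.prod 𝓘(ℝ, F)) r
      (fun x => (⟨x, (Φ x).symm (s' (f x))⟩ : TotalSpace F V)) := by
  intro x
  have hf := contMDiff_of_contMDiff_totalSpace hΦ
  obtain ⟨c, hc⟩ := BundleChart.exists_mem_source (I := I) (F := F) (V := V) x
  obtain ⟨c', hc'⟩ := BundleChart.exists_mem_source (I := I') (F := F) (V := V') (f x)
  obtain ⟨A, B, -, hB, hAB⟩ := exists_contDiffOn_fiber_transition hΦ c c'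
  rw [c.contMDiffAt_section_iff hc.2]
  set U : Set M := c.source ∩ f ⁻¹' c'.source
  have hU : IsOpen U := c.isOpen_source.inter (c'.isOpen_source.preimage hf.continuous)
  have h1 : ContMDiffOn I 𝓘(ℝ, F →L[ℝ] F) r (fun x => B (c.φ.extend I x)) U :=
    ((contMDiffOn_iff_contDiffOn.2 hB).comp (c.contMDiffOn_extend.mono inter_subset_left)
      fun z hz => ⟨c.extend_mem_domain hz.1, by
        rw [mem_preimage, c.extend_left_inv hz.1]; exact hz.2⟩).of_le (natCast_le_infty r)
  have h2 : ContMDiffOn I' 𝓘(ℝ, F) r (fun x => (c'.e ⟨x, s' x⟩).2) c'.source := fun z hz =>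
    ((c'.contMDiffAt_section_iff hz.2).1 (s'.contMDiff z)).contMDiffWithinAt
  have h3 : ContMDiffOn I 𝓘(ℝ, F) r (fun x => (c'.e ⟨f x, s' (f x)⟩).2) U :=
    h2.comp (hf.of_le (natCast_le_infty r)).contMDiffOn fun z hz => hz.2
  refine ((h1.clm_apply h3).contMDiffAt (hU.mem_nhds ⟨hc, hc'⟩)).congr_of_eventuallyEq ?_
  filter_upwards [hU.mem_nhds ⟨hc, hc'⟩] with z hz
  have h4 : c.φ.extend I z ∈ transitionDomain f c c' :=
    ⟨c.extend_mem_domain hz.1, by rw [mem_preimage, c.extend_left_inv hz.1]; exact hz.2⟩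
  have h5 := hAB _ h4
  rw [c.extend_left_inv hz.1] at h5
  rw [(h5 _).2, LinearEquiv.apply_symm_apply]

/-- The pullback of sections along a vector bundle isomorphism over `f`. -/
def pullbackSection
    (hΦ : ContMDiff (I.prod 𝓘(ℝ, F)) (I'.prod 𝓘(ℝ, F)) ∞
      (fun w : TotalSpace F V => (⟨f w.proj, Φ w.proj w.snd⟩ : TotalSpace F V'))) :
    Cₛ^(r : WithTop ℕ∞)⟮I'; F, V'⟯ →ₗ[ℝ] Cₛ^(r : WithTop ℕ∞)⟮I; F, V⟯ where
  toFun s' := ⟨fun x => (Φ x).symm (s' (f x)), contMDiff_pullback_section hΦ s'⟩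
  map_add' s t := ContMDiffSection.ext fun x => map_add (Φ x).symm (s (f x)) (t (f x))
  map_smul' a s := ContMDiffSection.ext fun x => map_smul (Φ x).symm a (s (f x))

theorem pullbackSection_apply
    (hΦ : ContMDiff (I.prod 𝓘(ℝ, F)) (I'.prod 𝓘(ℝ, F)) ∞
      (fun w : TotalSpace F V => (⟨f w.proj, Φ w.proj w.snd⟩ : TotalSpace F V')))
    (s' : Cₛ^(r : WithTop ℕ∞)⟮I'; F, V'⟯) (x : M) :
    pullbackSection hΦ s' x = (Φ x).symm (s' (f x)) := rfl

theorem continuous_pullbackSection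
    (hΦ : ContMDiff (I.prod 𝓘(ℝ, F)) (I'.prod 𝓘(ℝ, F)) ∞
      (fun w : TotalSpace F V => (⟨f w.proj, Φ w.proj w.snd⟩ : TotalSpace F V'))) :
    Continuous (pullbackSection (r := r) hΦ) := by
  refine WithSeminorms.continuous_of_continuous_comp withSeminorms_section _ fun i => ?_
  obtain ⟨q, hq, h⟩ := exists_continuous_seminorm_bound hΦ i.c i.hK i.hKc i.hk
  exact Seminorm.continuous_of_le hq fun s' => h _ s' fun x => by
    rw [pullbackSection_apply, LinearEquiv.apply_symm_apply]

/-- The restriction of test sections. -/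
def restrictTestSection
    (hΦ : ContMDiff (I.prod 𝓘(ℝ, F)) (I'.prod 𝓘(ℝ, F)) ∞
      (fun w : TotalSpace F V => (⟨f w.proj, Φ w.proj w.snd⟩ : TotalSpace F V'))) :
    TestSection I' F r V' →L[ℝ] Cₛ^(r : WithTop ℕ∞)⟮I; F, V⟯ where
  toLinearMap := pullbackSection hΦ ∘ₗ TestSection.toSectionₗ I' F r V'
  cont := by
    have : ContinuousSMul ℝ Cₛ^(r : WithTop ℕ∞)⟮I; F, V⟯ := withSeminorms_section.continuousSMul
    have : LocallyConvexSpace ℝ Cₛ^(r : WithTop ℕ∞)⟮I; F, V⟯ :=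
      withSeminorms_section.toLocallyConvexSpace
    exact continuous_of_continuous_comp_supportedInclusion _ fun K =>
      (continuous_pullbackSection hΦ).comp continuous_subtype_val

theorem restrictTestSection_apply
    (hΦ : ContMDiff (I.prod 𝓘(ℝ, F)) (I'.prod 𝓘(ℝ, F)) ∞
      (fun w : TotalSpace F V => (⟨f w.proj, Φ w.proj w.snd⟩ : TotalSpace F V')))
    (χ : TestSection I' F r V') (x : M) :
    Φ x (restrictTestSection hΦ χ x) = χ.toSection (f x) :=
  (Φ x).apply_symm_apply _

end Pullback

/-! ### Charts adapted to the embedding -/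

section AdaptedCharts

theorem trans_continuousLinearEquiv_mem_maximalAtlas {E : Type*} [NormedAddCommGroup E]
    [NormedSpace ℝ E] {M : Type*} [TopologicalSpace M] [ChartedSpace E M]
    {φ : OpenPartialHomeomorph M E} (hφ : φ ∈ IsManifold.maximalAtlas 𝓘(ℝ, E) ∞ M) (L : E ≃L[ℝ] E) :
    φ ≫ₕ L.toHomeomorph.toOpenPartialHomeomorph ∈ IsManifold.maximalAtlas 𝓘(ℝ, E) ∞ M := by
  have hL : L.toHomeomorph.toOpenPartialHomeomorph ∈ contDiffGroupoid ∞ 𝓘(ℝ, E) := by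
    rw [contDiffGroupoid, mem_groupoid_of_pregroupoid]
    exact ⟨by simpa [contDiffPregroupoid] using! L.contDiff.contDiffOn,
      by simpa [contDiffPregroupoid] using! L.symm.contDiff.contDiffOn⟩
  rw [IsManifold.maximalAtlas, mem_maximalAtlas_iff] at hφ ⊢
  intro e he
  obtain ⟨h1, h2⟩ := hφ e he
  refine ⟨?_, ?_⟩
  · rw [OpenPartialHomeomorph.trans_symm_eq_symm_trans_symm, OpenPartialHomeomorph.trans_assoc]
    exact StructureGroupoid.trans _ (StructureGroupoid.symm _ hL) h1
  · rw [← OpenPartialHomeomorph.trans_assoc]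
    exact StructureGroupoid.trans _ h2 hL

variable {n : ℕ} {F : Type*} [NormedAddCommGroup F] [NormedSpace ℝ F]
  {X : Type*} [TopologicalSpace X] [ChartedSpace (EuclideanQuadrant n) X]
  [IsManifold (modelWithCornersEuclideanQuadrant n) ∞ X]
  {W : X → Type*} [TopologicalSpace (TotalSpace F W)]
  [∀ x, AddCommGroup (W x)] [∀ x, Module ℝ (W x)] [∀ x, TopologicalSpace (W x)]
  [FiberBundle F W]
  {X' : Type*} [TopologicalSpace X']
  [ChartedSpace (EuclideanSpace ℝ (Fin n)) X'] [IsManifold (𝓡 n) ∞ X']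
  {W' : X' → Type*} [TopologicalSpace (TotalSpace F W')]
  [∀ y, AddCommGroup (W' y)] [∀ y, Module ℝ (W' y)] [∀ y, TopologicalSpace (W' y)]
  [FiberBundle F W']
  {ι : X → X'}

/-- Bundle charts of the two manifolds in which the embedding is the inclusion of the intersection
of the quadrant with an open set. -/
structure AdaptedCharts (ι : X → X')
    (c : BundleChart (modelWithCornersEuclideanQuadrant n) F W)
    (c' : BundleChart (𝓡 n) F W') : Prop where
  source_eq : c.source = ι ⁻¹' c'.source
  extend_eq : ∀ x ∈ c.source, c'.φ.extend (𝓡 n) (ι x)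
    = c.φ.extend (modelWithCornersEuclideanQuadrant n) x
  domain_eq : c.domain = c'.domain ∩ quadrant n

/-- Equality of dimensions makes the immersion normal form u ↦ `h.equiv (u, 0)` a linear
isomorphism, which is absorbed into the target chart. Shrinking the charts then ensures that the
image of `X` in the target chart is exactly its intersection with the quadrant. -/
theorem exists_adaptedCharts
    (hι : IsSmoothEmbedding (modelWithCornersEuclideanQuadrant n) (𝓡 n) ∞ ι) (x : X) :
    ∃ (c : BundleChart (modelWithCornersEuclideanQuadrant n) F W) (c' : BundleChart (𝓡 n) F W'),
      x ∈ c.source ∧ AdaptedCharts ι c c' := by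
  set I := modelWithCornersEuclideanQuadrant n
  have h := hι.isImmersion.isImmersionAt x
  set φ₀ := h.domChart
  set ψ₀ := h.codChart
  -- An injective endomorphism of a finite-dimensional space is bijective, so no transverse
  -- directions remain.
  let l₀ : EuclideanSpace ℝ (Fin n) →ₗ[ℝ] EuclideanSpace ℝ (Fin n) :=
    h.equiv.toLinearEquiv.toLinearMap ∘ₗ LinearMap.inl ℝ (EuclideanSpace ℝ (Fin n)) h.complement
  have hl₀ : Function.Injective l₀ := h.equiv.injective.comp LinearMap.inl_injective
  let L : EuclideanSpace ℝ (Fin n) ≃L[ℝ] EuclideanSpace ℝ (Fin n) :=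
    (LinearEquiv.ofInjectiveEndo l₀ hl₀).toContinuousLinearEquiv
  have hL : ∀ u, L u = h.equiv (u, 0) := fun u => rfl
  let ψ := ψ₀ ≫ₕ L.symm.toHomeomorph.toOpenPartialHomeomorph
  have hψ : ψ ∈ IsManifold.maximalAtlas (𝓡 n) ∞ X' :=
    trans_continuousLinearEquiv_mem_maximalAtlas h.codChart_mem_maximalAtlas L.symm
  have hψs : ψ.source = ψ₀.source := by simp [ψ]
  have hψι : ∀ z ∈ φ₀.source, ψ (ι z) = φ₀.extend I z := by
    intro z hz
    have hz' : z ∈ (φ₀.extend I).source := by rwa [φ₀.extend_source]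
    have h1 := h.writtenInCharts ((φ₀.extend I).map_source hz')
    simp only [Function.comp_apply] at h1
    rw [(φ₀.extend I).left_inv hz', ← hL] at h1
    have h2 : ψ₀ (ι z) = L (φ₀.extend I z) := h1
    change L.symm (ψ₀ (ι z)) = _
    rw [h2, L.symm_apply_apply]
  set e := trivializationAt F W x
  set e' := trivializationAt F W' (ι x)
  -- The embedding topology is used here: `G` excludes points of `X` that lie outside the source
  -- chart but are mapped into the target chart.
  obtain ⟨G, hG, hGS⟩ := hι.isEmbedding.isInducing.isOpen_iff.1
    (φ₀.open_source.inter e.open_baseSet)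
  -- The target of the source chart is `O` intersected with the quadrant; confining the target chart
  -- to `O` makes every quadrant point in it come from `X`.
  set O : Set (EuclideanSpace ℝ (Fin n)) := I.symm ⁻¹' φ₀.target
  have hO : IsOpen O := φ₀.open_target.preimage I.continuous_symm
  set U : Set X' := (ψ.source ∩ ψ ⁻¹' O) ∩ (G ∩ e'.baseSet)
  have hU : IsOpen U := (ψ.isOpen_inter_preimage hO).inter (hG.inter e'.open_baseSet)
  have hιU : IsOpen (ι ⁻¹' U) := hU.preimage hι.isEmbedding.continuous
  have hιUS : ι ⁻¹' U ⊆ φ₀.source ∩ e.baseSet := fun z hz => hGS ▸ hz.2.1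
  let c : BundleChart I F W := ⟨φ₀.restr (ι ⁻¹' U),
    restr_mem_maximalAtlas _ h.domChart_mem_maximalAtlas hιU, e, inferInstance⟩
  let c' : BundleChart (𝓡 n) F W' := ⟨ψ.restr U, restr_mem_maximalAtlas _ hψ hU, e', inferInstance⟩
  have hcs : c.source = ι ⁻¹' U := by
    refine subset_antisymm (fun z hz => ?_) fun z hz => ⟨?_, (hιUS hz).2⟩
    · have := hz.1
      rw [φ₀.restr_source' _ hιU] at this
      exact this.2
    · rw [φ₀.restr_source' _ hιU]
      exact ⟨(hιUS hz).1, hz⟩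
  have hcs' : c'.source = U := by
    refine subset_antisymm (fun z hz => ?_) fun z hz => ⟨?_, hz.2.2⟩
    · have := hz.1
      rw [ψ.restr_source' _ hU] at this
      exact this.2
    · rw [ψ.restr_source' _ hU]
      exact ⟨hz.1.1, hz⟩
  have hext : ∀ z ∈ c.source, c'.φ.extend (𝓡 n) (ι z) = c.φ.extend I z := fun z hz =>
    hψι z (hιUS (hcs ▸ hz)).1
  refine ⟨c, c', ?_, by rw [hcs, hcs'], hext, ?_⟩
  · have hx : x ∈ φ₀.source := h.mem_domChart_source
    rw [hcs]
    refine ⟨⟨?_, ?_⟩, ?_, mem_baseSet_trivializationAt F W' (ι x)⟩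
    · rw [hψs]; exact h.mem_codChart_source
    · rw [mem_preimage, hψι x hx]
      have : I.symm (φ₀.extend I x) = φ₀ x := I.left_inv _
      rw [mem_preimage, this]
      exact φ₀.map_source hx
    · rw [← mem_preimage, hGS]
      exact ⟨hx, mem_baseSet_trivializationAt F W x⟩
  · apply subset_antisymm
    · intro y hy
      have hz := c.symm_mem_source hy
      refine ⟨?_, ?_⟩
      · rw [← c.extend_right_inv hy, ← hext _ hz]
        refine c'.extend_mem_domain ?_
        rw [hcs']
        rwa [hcs] at hz
      · rw [← range_quadrantModel]
        exact c.domain_subset_range hy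
    · rintro y ⟨hy', hyQ⟩
      have hu := c'.symm_mem_source hy'
      have hyu : ψ ((c'.φ.extend (𝓡 n)).symm y) = y := c'.extend_right_inv hy'
      set u := (c'.φ.extend (𝓡 n)).symm y
      rw [hcs'] at hu
      have hyO : y ∈ O := hyu ▸ hu.1.2
      have hyt : y ∈ (φ₀.extend I).target := by
        rw [φ₀.extend_target]
        exact ⟨hyO, by rwa [range_quadrantModel]⟩
      have hz : (φ₀.extend I).symm y ∈ φ₀.source := by
        rw [← φ₀.extend_source (I := I)]
        exact (φ₀.extend I).map_target hyt
      -- Both points have coordinate y in `ψ`, which is injective on its source.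
      have hzu : ι ((φ₀.extend I).symm y) = u := by
        refine ψ.injOn ?_ hu.1.1 ?_
        · rw [hψs]; exact h.source_subset_preimage_source hz
        · rw [hψι _ hz, (φ₀.extend I).right_inv hyt, hyu]
      have hzc : (φ₀.extend I).symm y ∈ c.source := by
        rw [hcs, mem_preimage, hzu]
        exact hu
      have := c.extend_mem_domain hzc
      rwa [show c.φ.extend I ((φ₀.extend I).symm y) = y from (φ₀.extend I).right_inv hyt] at this

variable {c : BundleChart (modelWithCornersEuclideanQuadrant n) F W} {c' : BundleChart (𝓡 n) F W'}

theorem AdaptedCharts.map_symm (h : AdaptedCharts ι c c') {y : EuclideanSpace ℝ (Fin n)}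
    (hy : y ∈ c.domain) :
    ι ((c.φ.extend (modelWithCornersEuclideanQuadrant n)).symm y)
      = (c'.φ.extend (𝓡 n)).symm y := by
  have hx := c.symm_mem_source hy
  have h1 := h.extend_eq _ hx
  rw [c.extend_right_inv hy] at h1
  rw [h.source_eq] at hx
  exact (c'.extend_left_inv hx).symm.trans (congrArg _ h1)

theorem AdaptedCharts.domain_subset (h : AdaptedCharts ι c c') : c.domain ⊆ c'.domain := by
  rw [h.domain_eq]; exact inter_subset_left

theorem AdaptedCharts.mem_quadrant (h : AdaptedCharts ι c c') {y : EuclideanSpace ℝ (Fin n)}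
    (hy : y ∈ c'.domain) {x : X} (hx : ι x = (c'.φ.extend (𝓡 n)).symm y) : y ∈ quadrant n := by
  have hxs : x ∈ c.source := by
    rw [h.source_eq, mem_preimage, hx]
    exact c'.symm_mem_source hy
  rw [← c'.extend_right_inv hy, ← hx, h.extend_eq x hxs]
  exact (h.domain_eq ▸ c.extend_mem_domain hxs).2

theorem AdaptedCharts.transitionDomain_eq (h : AdaptedCharts ι c c') :
    transitionDomain ι c c' = c.domain := by
  refine inter_eq_left.2 fun y hy => ?_
  rw [mem_preimage, ← h.source_eq]
  exact c.symm_mem_source hy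

theorem isOpen_domain_boundaryless (c' : BundleChart (𝓡 n) F W') : IsOpen c'.domain := by
  obtain ⟨O, hO, h⟩ := c'.exists_isOpen_domain
  rw [h]
  simpa using hO

end AdaptedCharts

/-! ### Local representatives and localisation of functionals -/

section LocalRepresentatives

variable {E : Type*} [NormedAddCommGroup E] [NormedSpace ℝ E]
  {H : Type*} [TopologicalSpace H] {I : ModelWithCorners ℝ E H}
  {M : Type*} [TopologicalSpace M] [ChartedSpace H M]
  {F : Type*} [NormedAddCommGroup F] [NormedSpace ℝ F] {r : ℕ∞}
  {V : M → Type*} [TopologicalSpace (TotalSpace F V)]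
  [∀ x, AddCommGroup (V x)] [∀ x, Module ℝ (V x)] [∀ x, TopologicalSpace (V x)]
  [FiberBundle F V]

/-- Extension by zero of a function supported in a compact subset of the domain of a bundle
chart. -/
theorem BundleChart.exists_contDiffOn_range (c : BundleChart I F V) {g : E → F}
    (hg : ContDiffOn ℝ r g c.domain) {K : Set E} (hK : IsCompact K)
    (hKc : K ⊆ c.domain) (hgK : ∀ y ∈ c.domain, y ∉ K → g y = 0) :
    ∃ f : E → F, ContDiffOn ℝ r f (range I) ∧ EqOn f g c.domain ∧ (∀ y ∉ c.domain, f y = 0) ∧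
      ∀ y ∉ K, f y = 0 := by
  classical
  have hf : EqOn (fun y => if y ∈ c.domain then g y else 0) g c.domain := fun y hy => if_pos hy
  have hfK : ∀ y ∉ K, (if y ∈ c.domain then g y else 0) = 0 := by
    intro y hy
    split_ifs with h
    · exact hgK y h hy
    · rfl
  refine ⟨fun y => if y ∈ c.domain then g y else 0, fun y hy => ?_, hf, fun y hy => if_neg hy, hfK⟩
  by_cases hyc : y ∈ c.domain
  · obtain ⟨O, hO, h⟩ := c.exists_isOpen_domain
    refine ((hg.congr hf) y hyc).mono_of_mem_nhdsWithin ?_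
    rw [h] at hyc ⊢
    exact Filter.inter_mem self_mem_nhdsWithin (mem_nhdsWithin_of_mem_nhds (hO.mem_nhds hyc.2))
  · by_cases hyK : y ∈ K
    · exact absurd (hKc hyK) hyc
    · refine (contDiffWithinAt_const (c := (0 : F))).congr_of_eventuallyEq ?_ (hfK y hyK)
      filter_upwards [mem_nhdsWithin_of_mem_nhds (hK.isClosed.isOpen_compl.mem_nhds hyK)] with z hz
      exact hfK z hz

variable [VectorBundle ℝ F V] [ContMDiffVectorBundle ∞ F V I]

theorem BundleChart.localRep_sub (c : BundleChart I F V) (s t : Cₛ^(r : WithTop ℕ∞)⟮I; F, V⟯)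
    {y : E} (hy : y ∈ c.domain) :
    c.localRep (s - t : Cₛ^(r : WithTop ℕ∞)⟮I; F, V⟯) y = c.localRep s y - c.localRep t y := by
  simp only [c.localRep_eq_fiberEquiv _ hy, ContMDiffSection.coe_sub, Pi.sub_apply, map_sub]

theorem BundleChart.exists_testSection_localRep_eq [T2Space M] (c : BundleChart I F V) {g : E → F}
    (hg : ContDiffOn ℝ r g c.domain) {K : Set E} (hK : IsCompact K) (hKc : K ⊆ c.domain)
    (hgK : ∀ y ∈ c.domain, y ∉ K → g y = 0) :
    ∃ χ : TestSection I F r V, (∀ y ∈ c.domain, c.localRep χ.toSection y = g y) ∧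
      ∀ x, χ.toSection x ≠ 0 → x ∈ (c.φ.extend I).symm '' K := by
  obtain ⟨s, hs, hsK⟩ := c.exists_section_localRep_eq hg hK hKc hgK
  have hc : IsCompact ((c.φ.extend I).symm '' K) :=
    hK.image_of_continuousOn (c.continuousOn_extend_symm.mono hKc)
  exact ⟨⟨s, hc.of_isClosed_subset isClosed_closure (closure_minimal hsK hc.isClosed)⟩, hs, hsK⟩

theorem sectionSupport_smulSection_subset_tsupport (θ : C^∞⟮I, M; ℝ⟯)
    (s : Cₛ^(r : WithTop ℕ∞)⟮I; F, V⟯) : sectionSupport (smulSection θ s) ⊆ tsupport θ :=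
  closure_mono fun x hx h => hx (by simp [h])

theorem TestSection.eq_sum_smul {ι : Type*} [Fintype ι] (χ : TestSection I F r V)
    (θ : ι → C^∞⟮I, M; ℝ⟯) (hθ : ∀ x, χ.toSection x ≠ 0 → ∑ i, θ i x = 1) :
    χ = ∑ i, smulTestSection (θ i) χ := by
  refine TestSection.ext fun x => ?_
  simp only [TestSection.sum_apply, smulTestSection_apply, ← Finset.sum_smul]
  by_cases hx : χ.toSection x = 0
  · simp [hx]
  · rw [hθ x hx, one_smul]

theorem BundleChart.isOpen_source_inter_ball (c : BundleChart I F V) (y₀ : E) (δ : ℝ) :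
    IsOpen (c.source ∩ c.φ.extend I ⁻¹' Metric.ball y₀ δ) :=
  c.continuousOn_extend.isOpen_inter_preimage c.isOpen_source Metric.isOpen_ball

/-- A smooth function supported near a point of a bundle chart multiplies sections into sections
supported in a ball of this chart. -/
theorem BundleChart.mem_image_symm_of_smul_ne_zero (c : BundleChart I F V) {y₀ : E} {δ : ℝ}
    {θ : C^∞⟮I, M; ℝ⟯} (hθ : tsupport θ ⊆ c.source ∩ c.φ.extend I ⁻¹' Metric.ball y₀ δ)
    {s : ∀ x, V x} {x : M} (hx : θ x • s x ≠ 0) :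
    x ∈ (c.φ.extend I).symm '' (c.domain ∩ Metric.closedBall y₀ δ) := by
  have hθx : θ x ≠ 0 := fun h => hx (by rw [h, zero_smul])
  have h := hθ (subset_tsupport _ hθx)
  exact ⟨c.φ.extend I x, ⟨c.extend_mem_domain h.1, Metric.ball_subset_closedBall h.2⟩,
    c.extend_left_inv h.1⟩

/-- A functional vanishes on test sections supported away from its support. -/
theorem apply_eq_zero_of_disjoint_functionalSupport [FiniteDimensional ℝ E] [IsManifold I ∞ M]
    [T2Space M] [SigmaCompactSpace M] (T : TestSection I F r V →L[ℝ] ℝ) (χ : TestSection I F r V)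
    (hχ : Disjoint (sectionSupport χ.toSection) (functionalSupport T)) : T χ = 0 := by
  obtain ⟨t, θ, hθT, hθ⟩ := exists_smooth_partition (I := I) (K := sectionSupport χ.toSection) χ.2
    (Q := fun θ => T (smulTestSection θ χ) = 0) fun p hp => by
      have h := disjoint_left.1 hχ hp
      rw [functionalSupport, notMem_compl_iff] at h
      obtain ⟨U, ⟨hU, hTU⟩, hpU⟩ := h
      exact ⟨U, hU, hpU, fun θ hθ => hTU _
        ((sectionSupport_smulSection_subset_tsupport θ χ.toSection).trans hθ)⟩
  rw [χ.eq_sum_smul θ fun x hx => hθ x (subset_closure hx), map_sum]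
  exact Finset.sum_eq_zero fun i _ => hθT i

end LocalRepresentatives

/-! ### Functionals supported in X kill sections vanishing on X -/

section Kernel

variable {n : ℕ} {r : ℕ∞} {F : Type*} [NormedAddCommGroup F] [NormedSpace ℝ F]
  [FiniteDimensional ℝ F]
  {X : Type*} [TopologicalSpace X] [ChartedSpace (EuclideanQuadrant n) X]
  [IsManifold (modelWithCornersEuclideanQuadrant n) ∞ X] [CompactSpace X]
  {W : X → Type*} [TopologicalSpace (TotalSpace F W)]
  [∀ x, AddCommGroup (W x)] [∀ x, Module ℝ (W x)] [∀ x, TopologicalSpace (W x)]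
  [FiberBundle F W] [VectorBundle ℝ F W]
  [ContMDiffVectorBundle ∞ F W (modelWithCornersEuclideanQuadrant n)]
  {X' : Type*} [TopologicalSpace X'] [T2Space X'] [SecondCountableTopology X']
  [ChartedSpace (EuclideanSpace ℝ (Fin n)) X'] [IsManifold (𝓡 n) ∞ X']
  {W' : X' → Type*} [TopologicalSpace (TotalSpace F W')]
  [∀ y, AddCommGroup (W' y)] [∀ y, Module ℝ (W' y)] [∀ y, TopologicalSpace (W' y)]
  [FiberBundle F W'] [VectorBundle ℝ F W'] [ContMDiffVectorBundle ∞ F W' (𝓡 n)]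
  {ι : X → X'}

theorem sigmaCompactSpace_of_chartedSpace (n : ℕ) (X' : Type*) [TopologicalSpace X']
    [SecondCountableTopology X'] [ChartedSpace (EuclideanSpace ℝ (Fin n)) X'] :
    SigmaCompactSpace X' :=
  have : LocallyCompactSpace X' := ChartedSpace.locallyCompactSpace (EuclideanSpace ℝ (Fin n)) X'
  sigmaCompactSpace_of_locallyCompact_secondCountable

theorem eventually_norm_smul_le {E : Type*} [NormedAddCommGroup E] [NormedSpace ℝ E] (v : E)
    {δ : ℝ} (hδ : 0 < δ) : ∀ᶠ ε : ℝ in 𝓝[>] 0, ‖ε • v‖ ≤ δ := by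
  have h : Filter.Tendsto (fun ε : ℝ => ‖ε • v‖) (𝓝 0) (𝓝 0) := by
    have : Continuous fun ε : ℝ => ‖ε • v‖ := by fun_prop
    simpa using this.tendsto 0
  exact (h.eventually (ge_mem_nhds hδ)).filter_mono nhdsWithin_le_nhds

/-- A functional supported in `X` vanishes on a test section that vanishes on `X` and is supported
in an adapted chart. -/
theorem AdaptedCharts.apply_eq_zero
    {c : BundleChart (modelWithCornersEuclideanQuadrant n) F W} {c' : BundleChart (𝓡 n) F W'}
    (hc : AdaptedCharts ι c c') (T : TestSection (𝓡 n) F r W' →L[ℝ] ℝ)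
    (hT : functionalSupport T ⊆ range ι) {y₀ : EuclideanSpace ℝ (Fin n)} {δ δ₀ : ℝ}
    (hδ : δ < δ₀) (hball : Metric.closedBall y₀ δ₀ ⊆ c'.domain) (χ : TestSection (𝓡 n) F r W')
    (hχ : ∀ x, χ.toSection x ≠ 0 → x ∈ (c'.φ.extend (𝓡 n)).symm '' Metric.closedBall y₀ δ)
    (hχι : ∀ x, χ.toSection (ι x) = 0) : T χ = 0 := by
  have := sigmaCompactSpace_of_chartedSpace n X'
  set K := Metric.closedBall y₀ δ
  set K₁ := Metric.closedBall y₀ δ₀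
  have hKK₁ : K ⊆ K₁ := Metric.closedBall_subset_closedBall hδ.le
  have hK : IsCompact K := isCompact_closedBall _ _
  have hK₁ : IsCompact K₁ := isCompact_closedBall _ _
  have hrange : range (𝓡 n) = univ := ModelWithCorners.range_eq_univ _
  obtain ⟨f, hf, hfe, hfd, hfK⟩ := c'.exists_contDiffOn_range (c'.contDiffOn_localRep χ.toSection)
    hK (hKK₁.trans hball) fun y hy hyK => c'.localRep_eq_zero hy <| by_contra fun h => by
      obtain ⟨z, hz, hzy⟩ := hχ _ h
      have hzy' : z = y := by
        rw [← c'.extend_right_inv (hball (hKK₁ hz)), hzy, c'.extend_right_inv hy]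
      rw [hzy'] at hz
      exact hyK hz
  rw [hrange] at hf
  have hfQ : ∀ y ∈ quadrant n, f y = 0 := by
    intro y hy
    by_cases hyd : y ∈ c'.domain
    · rw [hfe hyd]
      refine c'.localRep_eq_zero hyd ?_
      rw [← hc.map_symm (hc.domain_eq ▸ ⟨hyd, hy⟩)]
      exact hχι _
    · exact hfd y hyd
  obtain ⟨N, hN, C, hC0, hC⟩ := exists_bound_testSection T c' hK₁ hball
  -- T kills the translate `χε`, and `χ - χε` is C^N-small, so T χ is arbitrarily small.
  have key : ∀ η : ℝ, 0 < η → |T χ| ≤ C * ((N + 1) * η) := by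
    intro η hη
    have h1 : ∀ᶠ ε : ℝ in 𝓝[>] 0, ∀ m ∈ Finset.range (N + 1), ∀ x ∈ univ,
        ‖iteratedFDerivWithin ℝ m (fun z => f z - f (z + ε • diagVec n)) univ x‖ ≤ η := by
      rw [Finset.eventually_all]
      intro m hm
      refine eventually_norm_iteratedFDerivWithin_translate_sub_le isClosed_univ uniqueDiffOn_univ
        (diagVec n) (fun _ _ _ _ => mem_univ _) (hf.of_le ?_) hK (fun x _ hx => hfK x hx) hη
      exact_mod_cast (Nat.cast_le.2 (Finset.mem_range_succ_iff.1 hm)).trans hN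
    obtain ⟨ε, h1, h2, hε⟩ := (h1.and ((eventually_norm_smul_le (diagVec n)
      (sub_pos.2 hδ)).and self_mem_nhdsWithin)).exists
    have hε : 0 < ε := hε
    have hfε : ContDiff ℝ r fun z => f (z + ε • diagVec n) :=
      (contDiffOn_univ.1 hf).comp (contDiff_id.add contDiff_const)
    -- A shift of length at most δ₀ - δ keeps the support inside the larger ball.
    have hfεK : ∀ y ∉ K₁, f (y + ε • diagVec n) = 0 := by
      intro y hy
      refine hfK _ fun h => hy ?_
      rw [Metric.mem_closedBall] at h ⊢
      have h3 : dist y (y + ε • diagVec n) ≤ δ₀ - δ := by rwa [dist_self_add_right]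
      linarith [dist_triangle y (y + ε • diagVec n) y₀]
    obtain ⟨χε, hχε, hχεK⟩ := c'.exists_testSection_localRep_eq hfε.contDiffOn hK₁ hball
      fun y _ hy => hfεK y hy
    -- At a quadrant point y the shifted point is interior to the quadrant, where f = 0; so the
    -- translate vanishes near y and the support of `χε` misses `X`.
    have hTε : T χε = 0 := by
      refine apply_eq_zero_of_disjoint_functionalSupport T χε (disjoint_left.2 fun p hp hpT => ?_)
      obtain ⟨x, rfl⟩ := hT hpT
      have hcl : sectionSupport χε.toSection ⊆ (c'.φ.extend (𝓡 n)).symm '' K₁ :=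
        closure_minimal hχεK (c'.isCompact_image_symm hK₁ hball).isClosed
      obtain ⟨y, hy, hyx⟩ := hcl hp
      have hyQ : y ∈ quadrant n := hc.mem_quadrant (hball hy) hyx.symm
      have hO : IsOpen {z : EuclideanSpace ℝ (Fin n) | z + ε • diagVec n ∈ interior (quadrant n)} :=
        isOpen_interior.preimage (by fun_prop)
      have hyO : y + ε • diagVec n ∈ interior (quadrant n) := by
        rw [interior_quadrant]
        intro i
        rw [add_smul_diagVec_apply]
        linarith [hyQ i]
      have hU := c'.continuousOn_extend.isOpen_inter_preimage c'.isOpen_source hO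
      have hxU : ι x ∈ c'.source ∩ c'.φ.extend (𝓡 n) ⁻¹'
          {z | z + ε • diagVec n ∈ interior (quadrant n)} := by
        rw [← hyx]
        refine ⟨c'.symm_mem_source (hball hy), ?_⟩
        rw [mem_preimage, c'.extend_right_inv (hball hy)]
        exact hyO
      obtain ⟨z, ⟨hz, hzO⟩, hz0⟩ := mem_closure_iff.1 hp _ hU hxU
      refine hz0 ?_
      have hzd := c'.extend_mem_domain hz
      have h4 := (c'.section_eq_zero_iff_localRep χε.toSection hzd).2
        ((hχε _ hzd).trans (hfQ _ (interior_subset hzO)))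
      rwa [c'.extend_left_inv hz] at h4
    have hsub : (χ - χε).toSection = χ.toSection - χε.toSection := rfl
    have h5 : T χ = T (χ - χε) := by rw [map_sub, hTε, sub_zero]
    rw [h5]
    refine (hC (χ - χε) fun x hx => ?_).trans (mul_le_mul_of_nonneg_left
      (chartNorm_le c' hK₁ hball hN _ hη.le fun m hm y hy => ?_) hC0)
    · by_contra hxK
      refine hx ?_
      have h6 : χ.toSection x = 0 := by_contra fun h => hxK (image_mono hKK₁ (hχ x h))
      have h7 : χε.toSection x = 0 := by_contra fun h => hxK (hχεK x h)
      rw [hsub, ContMDiffSection.coe_sub, Pi.sub_apply, h6, h7, sub_zero]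
    · have h8 : EqOn (c'.localRep (χ - χε).toSection) (fun z => f z - f (z + ε • diagVec n))
          c'.domain := fun z hz => by
        rw [hsub, c'.localRep_sub _ _ hz, hχε z hz, ← hfe hz]
      rw [iteratedFDerivWithin_congr h8 (hball hy), c'.iteratedFDerivWithin_domain _ _ (hball hy),
        hrange]
      exact h1 m (Finset.mem_range_succ_iff.2 hm) y (mem_univ y)
  by_contra hne
  have hpos : 0 < |T χ| := abs_pos.2 hne
  have hden : 0 < C * (N + 1) + 1 := by positivity
  -- This η makes the bound smaller than |T χ|; the summand 1 covers C = 0.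
  have := key (|T χ| / (2 * (C * (N + 1) + 1))) (by positivity)
  rw [← mul_assoc, ← mul_div_assoc, le_div_iff₀ (by positivity)] at this
  nlinarith

/-- A functional supported in `X` vanishes on test sections vanishing on `X`. -/
theorem apply_eq_zero_of_comp_eq_zero
    (hι : IsSmoothEmbedding (modelWithCornersEuclideanQuadrant n) (𝓡 n) ∞ ι)
    (W : X → Type*) [TopologicalSpace (TotalSpace F W)]
    [∀ x, AddCommGroup (W x)] [∀ x, Module ℝ (W x)] [∀ x, TopologicalSpace (W x)]
    [FiberBundle F W] [VectorBundle ℝ F W]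
    [ContMDiffVectorBundle ∞ F W (modelWithCornersEuclideanQuadrant n)]
    (T : TestSection (𝓡 n) F r W' →L[ℝ] ℝ)
    (hT : functionalSupport T ⊆ range ι) (χ : TestSection (𝓡 n) F r W')
    (hχι : ∀ x, χ.toSection (ι x) = 0) : T χ = 0 := by
  have := sigmaCompactSpace_of_chartedSpace n X'
  obtain ⟨t, θ, hθT, hθ⟩ := exists_smooth_partition (I := 𝓡 n) (K := sectionSupport χ.toSection) χ.2
    (Q := fun θ => T (smulTestSection θ χ) = 0) fun p hp => by
      by_cases hpι : p ∈ range ι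
      · obtain ⟨x, rfl⟩ := hpι
        obtain ⟨c, c', hxc, hc⟩ := exists_adaptedCharts (F := F) (W := W) (W' := W') hι x
        have hxc' : ι x ∈ c'.source := by rwa [hc.source_eq] at hxc
        obtain ⟨δ₀, hδ₀, hball⟩ := Metric.nhds_basis_closedBall.mem_iff.1
          ((isOpen_domain_boundaryless c').mem_nhds (c'.extend_mem_domain hxc'))
        refine ⟨_, c'.isOpen_source_inter_ball (c'.φ.extend (𝓡 n) (ι x)) (δ₀ / 2),
          ⟨hxc', Metric.mem_ball_self (half_pos hδ₀)⟩, fun θ hθ => ?_⟩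
        refine hc.apply_eq_zero T hT (half_lt_self hδ₀) hball _ (fun z hz => ?_) fun z => ?_
        · exact image_mono inter_subset_right (c'.mem_image_symm_of_smul_ne_zero hθ hz)
        · rw [smulTestSection_apply, hχι, smul_zero]
      · refine ⟨(range ι)ᶜ, (isCompact_range hι.isEmbedding.continuous).isClosed.isOpen_compl, hpι,
          fun θ hθ => apply_eq_zero_of_disjoint_functionalSupport T _ ?_⟩
        exact disjoint_left.2 fun q hq hqT =>
          hθ (sectionSupport_smulSection_subset_tsupport θ χ.toSection hq) (hT hqT)
  rw [χ.eq_sum_smul θ fun x hx => hθ x (subset_closure hx), map_sum]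
  exact Finset.sum_eq_zero fun i _ => hθT i

end Kernel

/-! ### Injectivity: density of restrictions -/

section Density

variable {n : ℕ} {r : ℕ∞} {F : Type*} [NormedAddCommGroup F] [NormedSpace ℝ F]
  [FiniteDimensional ℝ F]
  {X : Type*} [TopologicalSpace X] [ChartedSpace (EuclideanQuadrant n) X]
  [IsManifold (modelWithCornersEuclideanQuadrant n) ∞ X] [CompactSpace X]
  {W : X → Type*} [TopologicalSpace (TotalSpace F W)]
  [∀ x, AddCommGroup (W x)] [∀ x, Module ℝ (W x)] [∀ x, TopologicalSpace (W x)]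
  [FiberBundle F W] [VectorBundle ℝ F W]
  [ContMDiffVectorBundle ∞ F W (modelWithCornersEuclideanQuadrant n)]
  {X' : Type*} [TopologicalSpace X'] [T2Space X'] [SecondCountableTopology X']
  [ChartedSpace (EuclideanSpace ℝ (Fin n)) X'] [IsManifold (𝓡 n) ∞ X']
  {W' : X' → Type*} [TopologicalSpace (TotalSpace F W')]
  [∀ y, AddCommGroup (W' y)] [∀ y, Module ℝ (W' y)] [∀ y, TopologicalSpace (W' y)]
  [FiberBundle F W'] [VectorBundle ℝ F W'] [ContMDiffVectorBundle ∞ F W' (𝓡 n)]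
  {ι : X → X'} {Φ : ∀ x, W x ≃ₗ[ℝ] W' (ι x)}

theorem eq_zero_of_forall_abs_le_mul {a C : ℝ} (h : ∀ η : ℝ, 0 < η → |a| ≤ C * η) : a = 0 := by
  have h1 : Filter.Tendsto (fun η : ℝ => C * η) (𝓝[>] 0) (𝓝 0) := by
    have : Continuous fun η : ℝ => C * η := by fun_prop
    simpa using (this.tendsto 0).mono_left nhdsWithin_le_nhds
  have h2 : |a| ≤ 0 := ge_of_tendsto h1 (by
    filter_upwards [self_mem_nhdsWithin] with η hη using h η hη)
  exact abs_nonpos_iff.1 h2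

/-- In adapted charts the base map is the identity in coordinates, so related sections have
representatives at the same y that differ only by the fiber isomorphism. -/
theorem AdaptedCharts.exists_fiber_transition
    {c : BundleChart (modelWithCornersEuclideanQuadrant n) F W} {c' : BundleChart (𝓡 n) F W'}
    (hc : AdaptedCharts ι c c')
    (hΦ : ContMDiff ((modelWithCornersEuclideanQuadrant n).prod 𝓘(ℝ, F))
      ((𝓡 n).prod 𝓘(ℝ, F)) ∞
      (fun w : TotalSpace F W => (⟨ι w.proj, Φ w.proj w.snd⟩ : TotalSpace F W'))) :
    ∃ A B : EuclideanSpace ℝ (Fin n) → F →L[ℝ] F,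
      ContDiffOn ℝ ∞ A c.domain ∧ ContDiffOn ℝ ∞ B c.domain ∧ ∀ y ∈ c.domain,
        (∀ s : ∀ x, W x, c.localRep s y = B y (A y (c.localRep s y))) ∧
        ∀ (s : ∀ x, W x) (s' : ∀ x, W' x), (∀ x, Φ x (s x) = s' (ι x)) →
          c'.localRep s' y = A y (c.localRep s y) ∧
          c.localRep s y = B y (c'.localRep s' y) := by
  obtain ⟨A, B, hA, hB, hAB⟩ := exists_contDiffOn_fiber_transition hΦ c c'
  rw [hc.transitionDomain_eq] at hA hB hAB
  refine ⟨A, B, hA, hB, fun y hy => ⟨fun s => ?_, fun s s' hss' => ?_⟩⟩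
  · have h := hAB y hy (s _)
    rw [h.1] at h
    exact h.2
  · have h := hAB y hy (s _)
    rw [hss'] at h
    have h' : c'.localRep s' y = (c'.e ⟨ι ((c.φ.extend (modelWithCornersEuclideanQuadrant n)).symm y), s' (ι _)⟩).2 := by
      rw [BundleChart.localRep, ← hc.map_symm hy]
    rw [h']
    exact h

theorem AdaptedCharts.isCompact_domain_inter_closedBall
    {c : BundleChart (modelWithCornersEuclideanQuadrant n) F W} {c' : BundleChart (𝓡 n) F W'}
    (hc : AdaptedCharts ι c c') {y₀ : EuclideanSpace ℝ (Fin n)} {δ : ℝ}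
    (hball : Metric.closedBall y₀ δ ⊆ c'.domain) :
    IsCompact (c.domain ∩ Metric.closedBall y₀ δ) := by
  have h : c.domain ∩ Metric.closedBall y₀ δ = Metric.closedBall y₀ δ ∩ quadrant n := by
    rw [hc.domain_eq, inter_right_comm, inter_eq_right.2 hball]
  rw [h]
  exact (isCompact_closedBall _ _).inter_right isClosed_quadrant

/-- The representative of `s`, moved to the fiber coordinates of `W'`, is translated inwards and cut
off to a C^r function on the whole space. This yields a test section whose restriction is C^N-close
to `s`. -/
theorem AdaptedCharts.apply_section_eq_zero [T2Space X]
    {c : BundleChart (modelWithCornersEuclideanQuadrant n) F W} {c' : BundleChart (𝓡 n) F W'}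
    (hc : AdaptedCharts ι c c') (hι : Function.Injective ι)
    (hΦ : ContMDiff ((modelWithCornersEuclideanQuadrant n).prod 𝓘(ℝ, F))
      ((𝓡 n).prod 𝓘(ℝ, F)) ∞
      (fun w : TotalSpace F W => (⟨ι w.proj, Φ w.proj w.snd⟩ : TotalSpace F W')))
    (T : Cₛ^(r : WithTop ℕ∞)⟮modelWithCornersEuclideanQuadrant n; F, W⟯ →L[ℝ] ℝ)
    (hT : ∀ χ : TestSection (𝓡 n) F r W', T (restrictTestSection hΦ χ) = 0)
    {y₀ : EuclideanSpace ℝ (Fin n)} {δ δ₀ : ℝ}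
    (hδ : δ < δ₀) (hball : Metric.closedBall y₀ δ₀ ⊆ c'.domain)
    (s : Cₛ^(r : WithTop ℕ∞)⟮modelWithCornersEuclideanQuadrant n; F, W⟯)
    (hs : ∀ x, s x ≠ 0 → x ∈ (c.φ.extend (modelWithCornersEuclideanQuadrant n)).symm ''
      (c.domain ∩ Metric.closedBall y₀ δ)) : T s = 0 := by
  set K := c.domain ∩ Metric.closedBall y₀ δ
  set K₁ := c.domain ∩ Metric.closedBall y₀ δ₀
  have hKK₁ : K ⊆ K₁ := inter_subset_inter_right _ (Metric.closedBall_subset_closedBall hδ.le)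
  have hK : IsCompact K := hc.isCompact_domain_inter_closedBall
    ((Metric.closedBall_subset_closedBall hδ.le).trans hball)
  have hK₁ : IsCompact K₁ := hc.isCompact_domain_inter_closedBall hball
  obtain ⟨A, B, hA, hB, hAB⟩ := hc.exists_fiber_transition hΦ
  obtain ⟨f, hf, hfe, -, hfK⟩ := c.exists_contDiffOn_range
    ((hA.of_le (natCast_le_infty r)).clm_apply (c.contDiffOn_localRep s)) hK inter_subset_left
    fun y hy hyK => by
      rw [c.localRep_eq_zero hy, map_zero]
      by_contra h
      obtain ⟨z, hz, hzy⟩ := hs _ h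
      have hzy' : z = y := by
        rw [← c.extend_right_inv hz.1, hzy, c.extend_right_inv hy]
      exact hyK (hzy' ▸ hz)
  rw [range_quadrantModel] at hf
  obtain ⟨N, hN, C, hC0, hC⟩ := exists_bound_of_continuous LinearMap.id ⟨induced_id.symm⟩
    T.toLinearMap T.continuous c hK₁ inter_subset_left
  choose D hD0 hD using fun k => exists_bound_iteratedFDerivWithin_clm_comp c.uniqueDiffOn_domain
    c.uniqueDiffOn_domain contDiffOn_id (mapsTo_id _) hB hK₁ inter_subset_left k
  have hadd : ∀ ε : ℝ, 0 ≤ ε → ContDiffOn ℝ r (fun z => f (z + ε • diagVec n)) (quadrant n) :=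
    fun ε hε => hf.comp (contDiff_id.add contDiff_const).contDiffOn fun z hz =>
      add_smul_diagVec_mem_quadrant hε hz
  have hdQ : c.domain ⊆ quadrant n := by rw [hc.domain_eq]; exact inter_subset_right
  refine eq_zero_of_forall_abs_le_mul
    (C := C * ((N + 1) * ∑ m ∈ Finset.range (N + 1), D m * (m + 1))) fun η hη => ?_
  have h1 : ∀ᶠ ε : ℝ in 𝓝[>] 0, ∀ m ∈ Finset.range (N + 1), ∀ x ∈ quadrant n,
      ‖iteratedFDerivWithin ℝ m (fun z => f z - f (z + ε • diagVec n)) (quadrant n) x‖ ≤ η := by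
    rw [Finset.eventually_all]
    intro m hm
    refine eventually_norm_iteratedFDerivWithin_translate_sub_le isClosed_quadrant
      uniqueDiffOn_quadrant (diagVec n) (fun ε hε x hx => add_smul_diagVec_mem_quadrant hε hx)
      (hf.of_le ?_) hK (fun x _ hx => hfK x hx) hη
    exact_mod_cast (Nat.cast_le.2 (Finset.mem_range_succ_iff.1 hm)).trans hN
  obtain ⟨ε, h1, h2, hε⟩ := (h1.and ((eventually_norm_smul_le (diagVec n)
    (sub_pos.2 hδ)).and self_mem_nhdsWithin)).exists
  have hε : 0 < ε := hε
  obtain ⟨g, hg, hgf, hg0⟩ := exists_contDiff_eqOn_translate hf hε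
  have hgK : ∀ y ∉ Metric.closedBall y₀ δ₀, g y = 0 := by
    intro y hy
    by_contra h
    refine (hg0 y h).2 (hfK _ fun h => hy ?_)
    have h := h.2
    rw [Metric.mem_closedBall] at h ⊢
    have h3 : dist y (y + ε • diagVec n) ≤ δ₀ - δ := by rwa [dist_self_add_right]
    linarith [dist_triangle y (y + ε • diagVec n) y₀]
  obtain ⟨χ, hχ, hχK⟩ := c'.exists_testSection_localRep_eq hg.contDiffOn
    (isCompact_closedBall _ _) hball fun y _ hy => hgK y hy
  -- On the quadrant `g` is the translate of `f`; `B` returns the difference to the fiber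
  -- coordinates of `W`, at the cost of the constants `D`.
  have hrep : EqOn (c.localRep (s - restrictTestSection hΦ χ :
      Cₛ^(r : WithTop ℕ∞)⟮modelWithCornersEuclideanQuadrant n; F, W⟯))
      (fun y => B y (f y - f (y + ε • diagVec n))) c.domain := by
    intro y hy
    have hfy : f y = A y (c.localRep s y) := hfe hy
    rw [c.localRep_sub _ _ hy, (hAB y hy).1 s,
      ((hAB y hy).2 _ _ (restrictTestSection_apply hΦ χ)).2, ← map_sub, ← hfy,
      hχ y (hc.domain_subset hy), hgf y (hdQ hy)]
  have h5 : T s = T (s - restrictTestSection hΦ χ) := by rw [map_sub, hT, sub_zero]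
  rw [h5, mul_assoc, mul_assoc]
  refine (hC (s - restrictTestSection hΦ χ) fun x hx => ?_).trans (mul_le_mul_of_nonneg_left
    (chartNorm_le c hK₁ inter_subset_left hN _
      (mul_nonneg (Finset.sum_nonneg fun m _ => mul_nonneg (hD0 m) (by positivity)) hη.le)
      fun m hm y hy => ?_) hC0)
  · by_contra hxK
    have h6 : s x = 0 := by_contra fun h => hxK (image_mono hKK₁ (hs x h))
    have h7 : restrictTestSection hΦ χ x = 0 := by
      rw [← (Φ x).map_eq_zero_iff, restrictTestSection_apply]
      by_contra h
      obtain ⟨y, hy, hyx⟩ := hχK _ h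
      have hyQ := hc.mem_quadrant (hball hy) hyx.symm
      have hyd : y ∈ c.domain := hc.domain_eq ▸ ⟨hball hy, hyQ⟩
      exact hxK ⟨y, ⟨hyd, hy⟩, hι ((hc.map_symm hyd).trans hyx)⟩
    refine hx ?_
    change (s - restrictTestSection hΦ χ :
      Cₛ^(r : WithTop ℕ∞)⟮modelWithCornersEuclideanQuadrant n; F, W⟯) x = 0
    rw [ContMDiffSection.coe_sub, Pi.sub_apply, h6, h7, sub_zero]
  · change ‖iteratedFDerivWithin ℝ m (c.localRep (s - restrictTestSection hΦ χ :
      Cₛ^(r : WithTop ℕ∞)⟮modelWithCornersEuclideanQuadrant n; F, W⟯)) c.domain y‖ ≤ _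
    rw [iteratedFDerivWithin_congr hrep hy.1]
    have hmr : (m : WithTop ℕ∞) ≤ r := by exact_mod_cast (Nat.cast_le.2 hm).trans hN
    refine (hD m (fun y => f y - f (y + ε • diagVec n))
      (((hf.sub (hadd ε hε.le)).mono hdQ).of_le hmr) y hy).trans ?_
    have h8 : ∑ j ∈ Finset.range (m + 1), ‖iteratedFDerivWithin ℝ j
        (fun y => f y - f (y + ε • diagVec n)) c.domain y‖ ≤ (m + 1) * η := by
      refine (Finset.sum_le_card_nsmul _ _ η fun j hj => ?_).trans (by simp)
      rw [c.iteratedFDerivWithin_domain _ _ hy.1, range_quadrantModel]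
      exact h1 j (Finset.mem_range.2 (by have := Finset.mem_range.1 hj; omega)) y (hdQ hy.1)
    refine (mul_le_mul_of_nonneg_left h8 (hD0 m)).trans ?_
    rw [← mul_assoc]
    exact mul_le_mul_of_nonneg_right (Finset.single_le_sum
      (f := fun m : ℕ => D m * ((m : ℝ) + 1)) (fun m _ => mul_nonneg (hD0 m) (by positivity))
      (Finset.mem_range_succ_iff.2 hm)) hη.le

/-- The restrictions of test sections are dense. -/
theorem eq_zero_of_forall_restrictTestSection
    (hι : IsSmoothEmbedding (modelWithCornersEuclideanQuadrant n) (𝓡 n) ∞ ι)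
    (hΦ : ContMDiff ((modelWithCornersEuclideanQuadrant n).prod 𝓘(ℝ, F))
      ((𝓡 n).prod 𝓘(ℝ, F)) ∞
      (fun w : TotalSpace F W => (⟨ι w.proj, Φ w.proj w.snd⟩ : TotalSpace F W')))
    (T : Cₛ^(r : WithTop ℕ∞)⟮modelWithCornersEuclideanQuadrant n; F, W⟯ →L[ℝ] ℝ)
    (hT : ∀ χ : TestSection (𝓡 n) F r W', T (restrictTestSection hΦ χ) = 0) (s) : T s = 0 := by
  have : T2Space X := hι.isEmbedding.t2Space
  obtain ⟨t, θ, hθT, hθ⟩ := exists_smooth_partition (I := modelWithCornersEuclideanQuadrant n)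
    (isCompact_univ (X := X)) (Q := fun θ => T (smulSection θ s) = 0) fun x _ => by
      obtain ⟨c, c', hxc, hc⟩ := exists_adaptedCharts (F := F) (W := W) (W' := W') hι x
      have hxd := hc.domain_subset (c.extend_mem_domain hxc)
      obtain ⟨δ₀, hδ₀, hball⟩ := Metric.nhds_basis_closedBall.mem_iff.1
        ((isOpen_domain_boundaryless c').mem_nhds hxd)
      refine ⟨_, c.isOpen_source_inter_ball _ (δ₀ / 2),
        ⟨hxc, Metric.mem_ball_self (half_pos hδ₀)⟩, fun θ hθ => ?_⟩
      exact hc.apply_section_eq_zero hι.isEmbedding.injective hΦ T hT (half_lt_self hδ₀) hball _ fun z hz =>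
        c.mem_image_symm_of_smul_ne_zero hθ hz
  have h : s = ∑ i, smulSection (θ i) s := by
    refine ContMDiffSection.ext fun x => ?_
    change _ = (ContMDiffSection.coeAddHom _ F r W (∑ i, _)) x
    rw [map_sum, Finset.sum_apply]
    change s x = ∑ i, θ i x • s x
    rw [← Finset.sum_smul, hθ x (mem_univ x), one_smul]
  rw [h, map_sum]
  exact Finset.sum_eq_zero fun i _ => hθT i

end Density

/-! ### The image: Seeley extension and Hahn–Banach -/

section Image

variable {n : ℕ} {r : ℕ∞} {F : Type*} [NormedAddCommGroup F] [NormedSpace ℝ F]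
  [FiniteDimensional ℝ F]
  {X : Type*} [TopologicalSpace X] [ChartedSpace (EuclideanQuadrant n) X]
  [IsManifold (modelWithCornersEuclideanQuadrant n) ∞ X] [CompactSpace X]
  {W : X → Type*} [TopologicalSpace (TotalSpace F W)]
  [∀ x, AddCommGroup (W x)] [∀ x, Module ℝ (W x)] [∀ x, TopologicalSpace (W x)]
  [FiberBundle F W] [VectorBundle ℝ F W]
  [ContMDiffVectorBundle ∞ F W (modelWithCornersEuclideanQuadrant n)]
  {X' : Type*} [TopologicalSpace X'] [T2Space X'] [SecondCountableTopology X']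
  [ChartedSpace (EuclideanSpace ℝ (Fin n)) X'] [IsManifold (𝓡 n) ∞ X']
  {W' : X' → Type*} [TopologicalSpace (TotalSpace F W')]
  [∀ y, AddCommGroup (W' y)] [∀ y, Module ℝ (W' y)] [∀ y, TopologicalSpace (W' y)]
  [FiberBundle F W'] [VectorBundle ℝ F W'] [ContMDiffVectorBundle ∞ F W' (𝓡 n)]
  {ι : X → X'} {Φ : ∀ x, W x ≃ₗ[ℝ] W' (ι x)}

/-- The bound makes T vanish on the kernel of `ρ`, hence factor through `ρ`; on the range of `ρ` the
factor is dominated by q, and Hahn–Banach extends it continuously. -/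
theorem exists_continuousLinearMap_comp_eq {Y Z : Type*} [AddCommGroup Y] [Module ℝ Y]
    [AddCommGroup Z] [Module ℝ Z] [TopologicalSpace Z] [PolynormableSpace ℝ Z] (ρ : Y →ₗ[ℝ] Z)
    (T : Y →ₗ[ℝ] ℝ) (q : Seminorm ℝ Z) (hq : Continuous q) (h : ∀ y, |T y| ≤ q (ρ y)) :
    ∃ g : Z →L[ℝ] ℝ, ∀ y, g (ρ y) = T y := by
  have hT : T ∈ LinearMap.range ρ.dualMap := by
    rw [LinearMap.range_dualMap_eq_dualAnnihilator_ker, Submodule.mem_dualAnnihilator]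
    intro y hy
    have := h y
    rwa [LinearMap.mem_ker.1 hy, map_zero, abs_nonpos_iff] at this
  obtain ⟨g₀, hg₀⟩ := hT
  have hg₀' : ∀ y, g₀ (ρ y) = T y := fun y => LinearMap.congr_fun hg₀ y
  obtain ⟨g, hg, -⟩ := Module.Dual.exists_continuous_extension_of_le_seminorm_real
    (LinearMap.range ρ) (g₀.domRestrict (LinearMap.range ρ)) hq (by
      rintro ⟨_, y, rfl⟩
      exact (le_abs_self _).trans ((congrArg _ (hg₀' y)).trans_le (h y)))
  exact ⟨g, fun y => (hg ⟨ρ y, y, rfl⟩).trans (hg₀' y)⟩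

/-- The section θχ may be traded for any test section with the same restriction to `X`. The Seeley
extension of its representative from the quadrant, times a bump function, is one, and its
derivatives are controlled by the restriction alone. -/
theorem AdaptedCharts.exists_seminorm_bound
    (hι : IsSmoothEmbedding (modelWithCornersEuclideanQuadrant n) (𝓡 n) ∞ ι)
    (hΦ : ContMDiff ((modelWithCornersEuclideanQuadrant n).prod 𝓘(ℝ, F))
      ((𝓡 n).prod 𝓘(ℝ, F)) ∞
      (fun w : TotalSpace F W => (⟨ι w.proj, Φ w.proj w.snd⟩ : TotalSpace F W')))
    {c : BundleChart (modelWithCornersEuclideanQuadrant n) F W} {c' : BundleChart (𝓡 n) F W'}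
    (hc : AdaptedCharts ι c c') (T : TestSection (𝓡 n) F r W' →L[ℝ] ℝ)
    (hT : functionalSupport T ⊆ range ι)
    {y₀ : EuclideanSpace ℝ (Fin n)} {δ δ₀ : ℝ} (hδ0 : 0 < δ)
    (hδ : δ < δ₀) (hball : Metric.closedBall y₀ δ₀ ⊆ c'.domain) {θ : C^∞⟮𝓡 n, X'; ℝ⟯}
    (hθ : tsupport θ ⊆ c'.source ∩ c'.φ.extend (𝓡 n) ⁻¹' Metric.ball y₀ δ) :
    ∃ q : Seminorm ℝ Cₛ^(r : WithTop ℕ∞)⟮modelWithCornersEuclideanQuadrant n; F, W⟯,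
      Continuous q ∧ ∀ χ : TestSection (𝓡 n) F r W',
        |T (smulTestSection θ χ)| ≤ q (restrictTestSection hΦ χ) := by
  have : CompleteSpace F := FiniteDimensional.complete ℝ F
  set K := Metric.closedBall y₀ δ
  set K₁ := Metric.closedBall y₀ δ₀
  have hKK₁ : K ⊆ K₁ := Metric.closedBall_subset_closedBall hδ.le
  have hK : IsCompact K := isCompact_closedBall _ _
  have hK₁ : IsCompact K₁ := isCompact_closedBall _ _
  have hKQ : IsCompact (c.domain ∩ K) := hc.isCompact_domain_inter_closedBall (hKK₁.trans hball)
  -- The extension need not have compact support. The bump confines it to `K₁` without changing it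
  -- on `K`, which contains the support of `f`.
  let h : ContDiffBump y₀ := ⟨δ, δ₀, hδ0, hδ⟩
  have hh0 : ∀ y ∉ K₁, h y = 0 := fun y hy => h.zero_of_le_dist (not_le.1 hy).le
  have hh1 : ∀ y ∈ K, h y = 1 := fun y hy => h.one_of_mem_closedBall hy
  obtain ⟨A, _, hA, _, hAB⟩ := hc.exists_fiber_transition hΦ
  have hθA : ContDiffOn ℝ ∞ (fun y => θ ((c'.φ.extend (𝓡 n)).symm y) • A y) c.domain :=
    (contMDiffOn_iff_contDiffOn.1 (θ.contMDiff.comp_contMDiffOn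
      (c'.contMDiffOn_extend_symm.mono hc.domain_subset))).smul hA
  obtain ⟨L, hL⟩ := exists_quadrant_extension (F := F) (r := r) n
  obtain ⟨N, hN, C, hC0, hC⟩ := exists_bound_testSection T c' hK₁ hball
  choose D hD0 hD using fun k => exists_bound_iteratedFDerivWithin_clm_comp
    (uniqueDiffOn_univ (𝕜 := ℝ)) (uniqueDiffOn_univ (𝕜 := ℝ)) contDiffOn_id (mapsTo_id univ)
    (B := fun y => h y • ContinuousLinearMap.id ℝ F)
    (h.contDiff.smul contDiff_const).contDiffOn hK₁ (subset_univ K₁) k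
  choose G hG0 hG using fun k => exists_bound_iteratedFDerivWithin_clm_comp
    c.uniqueDiffOn_domain c.uniqueDiffOn_domain contDiffOn_id (mapsTo_id _) hθA hKQ
    inter_subset_left k
  -- C comes from continuity of T, N + 1 counts the orders, `D` is due to the bump, `L` to the
  -- extension and `G` to θA. `L` enters by absolute value since its sign is not recorded.
  set a : ℝ := C * ((N + 1) * ∑ m ∈ Finset.range (N + 1),
    D m * ∑ j ∈ Finset.range (m + 1), |L j| * G j)
  have ha : 0 ≤ a := mul_nonneg hC0 (mul_nonneg (by positivity) (Finset.sum_nonneg fun m _ =>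
    mul_nonneg (hD0 m) (Finset.sum_nonneg fun j _ => mul_nonneg (abs_nonneg _) (hG0 j))))
  let a' : NNReal := ⟨a, ha⟩
  refine ⟨a' • chartNorm c hKQ inter_subset_left hN,
    (continuous_chartNorm c hKQ inter_subset_left hN).const_smul a', fun χ => ?_⟩
  change _ ≤ a * chartNorm c hKQ inter_subset_left hN (restrictTestSection hΦ χ)
  set p := chartNorm c hKQ inter_subset_left hN (restrictTestSection hΦ χ)
  have hp : 0 ≤ p := apply_nonneg _ _
  have hθχ : ∀ x, (smulTestSection θ χ).toSection x ≠ 0 →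
      x ∈ (c'.φ.extend (𝓡 n)).symm '' K := fun x hx =>
    image_mono inter_subset_right (c'.mem_image_symm_of_smul_ne_zero hθ hx)
  obtain ⟨f, hf, hfe, -, hfK⟩ := c'.exists_contDiffOn_range
    (c'.contDiffOn_localRep (smulTestSection θ χ).toSection)
    hK (hKK₁.trans hball) fun y hy hyK => c'.localRep_eq_zero hy <| by_contra fun h => by
      obtain ⟨z, hz, hzy⟩ := hθχ _ h
      have hzy' : z = y := by
        rw [← c'.extend_right_inv (hball (hKK₁ hz)), hzy, c'.extend_right_inv hy]
      exact hyK (hzy' ▸ hz)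
  rw [ModelWithCorners.range_eq_univ, contDiffOn_univ] at hf
  obtain ⟨g, hg, hgf, hgb⟩ := hL f (BoundedContDiff.of_hasCompactSupport hf
    (HasCompactSupport.intro hK hfK))
  have hhg : ContDiff ℝ r fun y => h y • g y := h.contDiff.smul hg.1
  obtain ⟨ψ, hψ, hψK⟩ := c'.exists_testSection_localRep_eq hhg.contDiffOn hK₁ hball
    fun y _ hy => by rw [hh0 y hy, zero_smul]
  -- On the quadrant g = f, while h = 1 on `K` and f = 0 off `K`; so hg = f there and the two test
  -- sections agree on `X`.
  have hTψ : T (smulTestSection θ χ) = T ψ := by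
    rw [← sub_eq_zero, ← map_sub]
    refine apply_eq_zero_of_comp_eq_zero hι W T hT _ fun x => ?_
    change (smulTestSection θ χ).toSection (ι x) - ψ.toSection (ι x) = 0
    by_cases hx : ι x ∈ c'.source
    · have hxd := c'.extend_mem_domain hx
      have hxQ := hc.mem_quadrant hxd (c'.extend_left_inv hx).symm
      have h1 := (c'.section_eq_zero_iff_localRep
        ((smulTestSection θ χ).toSection - ψ.toSection : Cₛ^(r : WithTop ℕ∞)⟮𝓡 n; F, W'⟯)
        hxd).2 (by
          rw [c'.localRep_sub _ _ hxd, hψ _ hxd, ← hfe hxd, hgf hxQ]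
          by_cases hyK : c'.φ.extend (𝓡 n) (ι x) ∈ K
          · rw [hh1 _ hyK, one_smul, sub_self]
          · rw [hfK _ hyK, smul_zero, sub_self])
      rwa [c'.extend_left_inv hx] at h1
    · have h1 : ∀ K ⊆ c'.domain, ι x ∉ (c'.φ.extend (𝓡 n)).symm '' K := by
        rintro K hK ⟨y, hy, hyx⟩
        exact hx (hyx ▸ c'.symm_mem_source (hK hy))
      rw [by_contra fun h => h1 _ (hKK₁.trans hball) (hθχ _ h),
        by_contra fun h => h1 _ hball (hψK _ h), sub_zero]
  -- On the quadrant part of `K` the function f equals θA applied to the representative of the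
  -- restriction. Being C^r on the whole space, its full derivatives there are those within
  -- `c.domain`.
  have hfb : ∀ j ≤ N, ∀ y ∈ quadrant n, ‖iteratedFDeriv ℝ j f y‖ ≤ G j * p := by
    intro j hj y hy
    by_cases hyK : y ∈ K
    · have hyc : y ∈ c.domain := hc.domain_eq ▸ ⟨hball (hKK₁ hyK), hy⟩
      have hjr : (j : WithTop ℕ∞) ≤ r := by exact_mod_cast (Nat.cast_le.2 hj).trans hN
      have h1 : EqOn f (fun y => (θ ((c'.φ.extend (𝓡 n)).symm y) • A y)
          (c.localRep (restrictTestSection hΦ χ) y)) c.domain := by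
        intro z hz
        have hz' := hc.domain_subset hz
        rw [hfe hz']
        change _ = θ ((c'.φ.extend (𝓡 n)).symm z) • A z (c.localRep (restrictTestSection hΦ χ) z)
        rw [← ((hAB z hz).2 _ _ (restrictTestSection_apply hΦ χ)).1,
          c'.localRep_eq_fiberEquiv _ hz', c'.localRep_eq_fiberEquiv _ hz', smulTestSection_apply,
          map_smul]
      rw [← iteratedFDerivWithin_eq_iteratedFDeriv c.uniqueDiffOn_domain
        (hf.of_le hjr).contDiffAt hyc, iteratedFDerivWithin_congr h1 hyc]
      refine (hG j _ ((c.contDiffOn_localRep _).of_le hjr) y ⟨hyc, hyK⟩).trans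
        (mul_le_mul_of_nonneg_left ?_ (hG0 j))
      exact (Finset.sum_le_sum_of_subset_of_nonneg (Finset.range_mono (Nat.succ_le_succ hj))
        fun _ _ _ => norm_nonneg _).trans (sum_norm_le_chartNorm c hKQ inter_subset_left hN _
          ⟨hyc, hyK⟩)
    · rw [← iteratedFDerivWithin_univ, iteratedFDerivWithin_eq_zero_of_eqOn_diff hK.isClosed
        (fun x _ hx => hfK x hx) j (mem_univ y) hyK, norm_zero]
      exact mul_nonneg (hG0 j) hp
  rw [hTψ, mul_assoc, mul_assoc]
  refine (hC ψ hψK).trans (mul_le_mul_of_nonneg_left (chartNorm_le c' hK₁ hball hN _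
    (mul_nonneg (Finset.sum_nonneg fun m _ => mul_nonneg (hD0 m) (Finset.sum_nonneg fun j _ =>
      mul_nonneg (abs_nonneg _) (hG0 j))) hp) fun m hm y hy => ?_) hC0)
  have hmr : (m : WithTop ℕ∞) ≤ r := by exact_mod_cast (Nat.cast_le.2 hm).trans hN
  rw [iteratedFDerivWithin_congr (fun z hz => hψ z hz) (hball hy),
    c'.iteratedFDerivWithin_domain _ _ (hball hy), ModelWithCorners.range_eq_univ]
  refine (hD m g (hg.1.of_le hmr).contDiffOn y hy).trans ?_
  have hsum : ∑ j ∈ Finset.range (m + 1), ‖iteratedFDerivWithin ℝ j g univ y‖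
      ≤ (∑ j ∈ Finset.range (m + 1), |L j| * G j) * p := by
    rw [Finset.sum_mul]
    refine Finset.sum_le_sum fun j hj => ?_
    have hjN : j ≤ N := (Finset.mem_range_succ_iff.1 hj).trans hm
    rw [iteratedFDerivWithin_univ, mul_assoc]
    exact (hgb j ((Nat.cast_le.2 hjN).trans hN) _ (hfb j hjN) y).trans
      (mul_le_mul_of_nonneg_right (le_abs_self _) (mul_nonneg (hG0 j) hp))
  refine (mul_le_mul_of_nonneg_left hsum (hD0 m)).trans ?_
  rw [← mul_assoc]
  exact mul_le_mul_of_nonneg_right (Finset.single_le_sum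
    (f := fun m : ℕ => D m * ∑ j ∈ Finset.range (m + 1), |L j| * G j)
    (fun m _ => mul_nonneg (hD0 m) (Finset.sum_nonneg fun j _ =>
      mul_nonneg (abs_nonneg _) (hG0 j))) (Finset.mem_range_succ_iff.2 hm)) hp

/-- A functional supported in `X` is bounded by a continuous seminorm of the restriction. -/
theorem exists_seminorm_bound_of_functionalSupport_subset
    (hι : IsSmoothEmbedding (modelWithCornersEuclideanQuadrant n) (𝓡 n) ∞ ι)
    (hΦ : ContMDiff ((modelWithCornersEuclideanQuadrant n).prod 𝓘(ℝ, F))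
      ((𝓡 n).prod 𝓘(ℝ, F)) ∞
      (fun w : TotalSpace F W => (⟨ι w.proj, Φ w.proj w.snd⟩ : TotalSpace F W')))
    (T : TestSection (𝓡 n) F r W' →L[ℝ] ℝ) (hT : functionalSupport T ⊆ range ι) :
    ∃ q : Seminorm ℝ Cₛ^(r : WithTop ℕ∞)⟮modelWithCornersEuclideanQuadrant n; F, W⟯,
      Continuous q ∧ ∀ χ : TestSection (𝓡 n) F r W', |T χ| ≤ q (restrictTestSection hΦ χ) := by
  have := sigmaCompactSpace_of_chartedSpace n X'
  obtain ⟨t, θ, hθT, hθ⟩ := exists_smooth_partition (I := 𝓡 n)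
    (isCompact_range hι.isEmbedding.continuous) (Q := fun θ =>
      ∃ q : Seminorm ℝ Cₛ^(r : WithTop ℕ∞)⟮modelWithCornersEuclideanQuadrant n; F, W⟯,
        Continuous q ∧ ∀ χ : TestSection (𝓡 n) F r W',
          |T (smulTestSection θ χ)| ≤ q (restrictTestSection hΦ χ)) fun p hp => by
      obtain ⟨x, rfl⟩ := hp
      obtain ⟨c, c', hxc, hc⟩ := exists_adaptedCharts (F := F) (W := W) (W' := W') hι x
      have hxc' : ι x ∈ c'.source := by rwa [hc.source_eq] at hxc
      obtain ⟨δ₀, hδ₀, hball⟩ := Metric.nhds_basis_closedBall.mem_iff.1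
        ((isOpen_domain_boundaryless c').mem_nhds (c'.extend_mem_domain hxc'))
      exact ⟨_, c'.isOpen_source_inter_ball (c'.φ.extend (𝓡 n) (ι x)) (δ₀ / 2),
        ⟨hxc', Metric.mem_ball_self (half_pos hδ₀)⟩, fun θ hθ =>
          hc.exists_seminorm_bound hι hΦ T hT (half_pos hδ₀) (half_lt_self hδ₀) hball hθ⟩
  choose q hq hTq using hθT
  refine ⟨∑ i, q i, Seminorm.continuous_finsetSum fun i _ => hq i, fun χ => ?_⟩
  -- The partition sums to 1 only on `range ι`, but the difference of the two sides is T of a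
  -- section vanishing on `X`.
  have h1 : T χ = ∑ i, T (smulTestSection (θ i) χ) := by
    rw [← map_sum, ← sub_eq_zero, ← map_sub]
    refine apply_eq_zero_of_comp_eq_zero hι W T hT _ fun x => ?_
    change χ.toSection (ι x) - (∑ i, smulTestSection (θ i) χ).toSection (ι x) = 0
    simp only [TestSection.sum_apply, smulTestSection_apply]
    rw [← Finset.sum_smul, hθ _ (mem_range_self x), one_smul, sub_self]
  rw [h1, ← FunLike.coeAddMonoidHom_apply (∑ i, q i), map_sum, Finset.sum_apply]
  exact (Finset.abs_sum_le_sum_abs _ _).trans (Finset.sum_le_sum fun i _ => hTq i χ)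

/-- The complement of the compact set `range ι` is open and null: sections supported there restrict
to 0. -/
theorem functionalSupport_comp_restrictTestSection_subset
    (hι : IsSmoothEmbedding (modelWithCornersEuclideanQuadrant n) (𝓡 n) ∞ ι)
    (hΦ : ContMDiff ((modelWithCornersEuclideanQuadrant n).prod 𝓘(ℝ, F))
      ((𝓡 n).prod 𝓘(ℝ, F)) ∞
      (fun w : TotalSpace F W => (⟨ι w.proj, Φ w.proj w.snd⟩ : TotalSpace F W')))
    (T : Cₛ^(r : WithTop ℕ∞)⟮modelWithCornersEuclideanQuadrant n; F, W⟯ →L[ℝ] ℝ) :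
    functionalSupport (T.comp (restrictTestSection (V' := W') hΦ)) ⊆ range ι := by
  rw [functionalSupport, compl_subset_comm]
  refine subset_sUnion_of_mem ⟨(isCompact_range hι.isEmbedding.continuous).isClosed.isOpen_compl,
    fun χ hχ => ?_⟩
  have h : restrictTestSection hΦ χ = 0 := by
    refine ContMDiffSection.ext fun x => ?_
    change _ = (0 : W x)
    rw [← (Φ x).map_eq_zero_iff, restrictTestSection_apply]
    by_contra hx
    exact hχ (subset_closure hx) (mem_range_self x)
  rw [ContinuousLinearMap.comp_apply, h, map_zero]

end Image

end SupportedFunctionals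

end

/-! ### Assembly of the theorem -/

theorem mainTheorem6 {n : ℕ} (r : ℕ∞)
    {F : Type*} [NormedAddCommGroup F] [NormedSpace ℝ F] [FiniteDimensional ℝ F]
    -- the compact manifold with corners `X` and the vector bundle `W → X`
    {X : Type*} [TopologicalSpace X] [ChartedSpace (EuclideanQuadrant n) X]
    [IsManifold (modelWithCornersEuclideanQuadrant n) ∞ X] [CompactSpace X]
    {W : X → Type*} [TopologicalSpace (TotalSpace F W)]
    [∀ x, AddCommGroup (W x)] [∀ x, Module ℝ (W x)] [∀ x, TopologicalSpace (W x)]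
    [FiberBundle F W] [VectorBundle ℝ F W]
    [ContMDiffVectorBundle ∞ F W (modelWithCornersEuclideanQuadrant n)]
    -- the manifold without boundary `X'` of the same dimension and the vector bundle `W' → X'`
    {X' : Type*} [TopologicalSpace X'] [T2Space X'] [SecondCountableTopology X']
    [ChartedSpace (EuclideanSpace ℝ (Fin n)) X'] [IsManifold (𝓡 n) ∞ X']
    {W' : X' → Type*} [TopologicalSpace (TotalSpace F W')]
    [∀ y, AddCommGroup (W' y)] [∀ y, Module ℝ (W' y)] [∀ y, TopologicalSpace (W' y)]
    [FiberBundle F W'] [VectorBundle ℝ F W'] [ContMDiffVectorBundle ∞ F W' (𝓡 n)]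
    -- `X'` is an extension of `X`
    (ι : X → X') (_hι : IsSmoothEmbedding (modelWithCornersEuclideanQuadrant n) (𝓡 n) ∞ ι)
    -- `W'` is an extension of `W`
    (Φ : ∀ x, W x ≃ₗ[ℝ] W' (ι x))
    (_hΦ : ContMDiff ((modelWithCornersEuclideanQuadrant n).prod 𝓘(ℝ, F))
      ((𝓡 n).prod 𝓘(ℝ, F)) ∞
      (fun w : TotalSpace F W => (⟨ι w.proj, Φ w.proj w.snd⟩ : TotalSpace F W'))) :
    ∃ ρ : SupportedFunctionals.TestSection (𝓡 n) F r W' →L[ℝ]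
        Cₛ^(r : WithTop ℕ∞)⟮modelWithCornersEuclideanQuadrant n; F, W⟯,
      (∀ χ x, Φ x (ρ χ x) = χ.toSection (ι x)) ∧
      Function.Injective
        (fun T : Cₛ^(r : WithTop ℕ∞)⟮modelWithCornersEuclideanQuadrant n; F, W⟯ →L[ℝ] ℝ =>
          T.comp ρ) ∧
      range
        (fun T : Cₛ^(r : WithTop ℕ∞)⟮modelWithCornersEuclideanQuadrant n; F, W⟯ →L[ℝ] ℝ =>
          T.comp ρ) =
        {T' | SupportedFunctionals.functionalSupport T' ⊆ range ι} := by
  refine ⟨SupportedFunctionals.restrictTestSection _hΦ,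
    SupportedFunctionals.restrictTestSection_apply _hΦ, fun T₁ T₂ h => ?_, ?_⟩
  · refine ContinuousLinearMap.ext fun s => sub_eq_zero.1 ?_
    exact SupportedFunctionals.eq_zero_of_forall_restrictTestSection _hι _hΦ (T₁ - T₂)
      (fun χ => sub_eq_zero.2 (DFunLike.congr_fun h χ)) s
  · refine subset_antisymm ?_ fun T' hT' => ?_
    · rintro _ ⟨T, rfl⟩
      exact SupportedFunctionals.functionalSupport_comp_restrictTestSection_subset _hι _hΦ T
    · obtain ⟨q, hq, hTq⟩ :=
        SupportedFunctionals.exists_seminorm_bound_of_functionalSupport_subset _hι _hΦ T' hT'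
      have : PolynormableSpace ℝ
          Cₛ^(r : WithTop ℕ∞)⟮modelWithCornersEuclideanQuadrant n; F, W⟯ :=
        SupportedFunctionals.withSeminorms_section.toPolynormableSpace
      obtain ⟨T, hT⟩ := SupportedFunctionals.exists_continuousLinearMap_comp_eq
        (SupportedFunctionals.restrictTestSection _hΦ).toLinearMap T'.toLinearMap q hq hTq
      exact ⟨T, ContinuousLinearMap.ext hT⟩
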